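/- **Words.** Let $Prop=\{p_0,\dots,p_{n+2}\}$, $n\ge 0$, where $p_0=call$, $p_1=ret$, $p_2=int$. Any finite set $X$ of propositions with three special elements $call,ret,int$ induces the pushdown alphabet $\Sigma_X$ of the sets $a\subseteq X$ that contain exactly one of these three (calls, returns, internal actions). An infinite timed word $w=(\sigma,\tau)$ over $\Sigma_X$ has letters $\sigma_i\in\Sigma_X$ and non-negative, non-decreasing, unbounded time stamps $\tau_i$. Well-matched words are given by $u::=\varepsilon\mid a\,u\mid c\,u\,r\,u$ ($a$ internal, $c$ a call, $r$ a return); $j>i$ is the matching return of the call $i$ if $j$ is a return and $\sigma[i+1,j-1]$ is well-matched. The abstract successor of $i$ is its matching return (if any) when $i$ is a call, and otherwise $i+1$ if $i+1$ is not a return; in all other cases it is undefined. The caller of $i$ is the greatest call $j<i$ whose abstract successor is undefined or greater than $i$. $Pos(g,i)$ is $\mathbb N$, $Pos(a,i)$ is the set of positions on the maximal abstract path through $i$, and $Pos(c,i)$ is the set of positions obtained from $i$ by iterating the caller. **Logic.** ECNTL formulas over $Prop$ are built from $\top$ and $p\in Prop$ with $\vee,\neg$, next $X^d$, previous $P^{d'}$,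 until $U^d$, since $S^{d'}$, and the real-time modalities $\rhd^d_I$, $\lhd^{d'}_I$, where $d\in\{g,a\}$, $d'\in\{g,a,c\}$ (global, abstract, caller) and $I$ is an interval of non-negative reals with end points in $\mathbb N\cup\{\infty\}$. $X^d$ refers to the global or abstract successor, $P^g,P^a$ to the position whose global/abstract successor is the current one, $P^c$ to the caller; $U^d$ and $S^{d'}$ are until and since relativized to $Pos(d,i)$, $Pos(d',i)$. $\rhd^d_I\psi$ (resp. $\lhd^{d'}_I\psi$) holds at $i$ if there is a next position $j>i$ in $Pos(d,i)$ (resp. a last position $j<i$ in $Pos(d',i)$) where $\psi$ holds, and $|\tau_j-\tau_i|\in I$. A word is a model of $\varphi$ if $\varphi$ holds at position $0$. $|\varphi|$ is the number of distinct subformulas, $Const_\varphi$ the set of finite end points of the intervals in $\varphi$, and $size(\varphi)=|\varphi|+k$, where $k$ is the length in binary of the largest constant in $Const_\varphi$. $\varphi$ is non-recursive if real-time modalities are applied only to propositions. **Automata.** The event clocks over $X$ are $x^{d'}_p$ and $y^d_p$ for $p\in X$: at position $i$, $x^{d'}_p$ (resp. $y^d_p$) is the time since the last $j<i$ in $Pos(d',i)$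 (resp. until the next $j>i$ in $Pos(d,i)$) with $p\in\sigma_j$, and is undefined if there is none. A generalized Büchi event-clock nested automaton (ECNA) over $\Sigma_X$ has finitely many states, a set of initial states, finitely many stack symbols, finitely many push, pop and internal transitions (taken on calls, returns and internal actions respectively; a pop on the empty stack reads the bottom symbol and leaves it), each guarded by a conjunction of atomic constraints $z\in I$ or "$z$ undefined" on clocks $z$, and a finite family of acceptance sets of states, each of which an accepting run must visit infinitely often. **Hintikka sequences.** Let $p_\infty$ be a fresh proposition and identify $\neg\neg\psi$ with $\psi$. $Cl(\varphi)$ consists of $\top$, $X^a\top$, $P^a\top$, the elements of $Prop\cup\{p_\infty\}$, the subformulas of $\varphi$, the formulas $X^d(\psi_1U^d\psi_2)$ and $P^{d'}(\psi_1S^{d'}\psi_2)$ for the subformulas $\psi_1U^d\psi_2$, $\psi_1S^{d'}\psi_2$ of $\varphi$, and all negations of these. An atom is a set $A\subseteq Cl(\varphi)$ with $\top\in A$, exactly one of $call,ret,int$ in $A$, and such that, for all formulas in $Cl(\varphi)$: $\psi\in A$ iff $\neg\psi\notin A$; $\psi_1\vee\psi_2\in A$ iff $\psi_1\in A$ or $\psi_2\in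 A$; $\psi_1U^d\psi_2\in A$ iff $\psi_2\in A$ or $\{\psi_1,X^d(\psi_1U^d\psi_2)\}\subseteq A$; $\psi_1S^{d'}\psi_2\in A$ iff $\psi_2\in A$ or $\{\psi_1,P^{d'}(\psi_1S^{d'}\psi_2)\}\subseteq A$; if $X^a\top\notin A$ then no $X^a\psi$ is in $A$; if $P^a\top\notin A$ then no $P^a\psi$ is in $A$. Let $Caller(A)$ be the set of formulas $P^c\psi$ in $A$. For $e\in\{g,a\}$, $A\to_e B$ means that for all $X^e\psi,P^e\psi\in Cl(\varphi)$: $X^e\psi\in A$ iff $\psi\in B$, and $P^e\psi\in B$ iff $\psi\in A$; for $e=a$ also $Caller(A)=Caller(B)$. A Hintikka sequence of $\varphi$ is an infinite timed word over $\Sigma_{Cl(\varphi)}$ (formulas of $Cl(\varphi)$ seen as propositions) whose letters $A_0,A_1,\dots$ are atoms such that $\neg P^{d'}\psi\in A_0$ for all $P^{d'}\psi\in Cl(\varphi)$, and for all $i\ge0$: 1. $A_i\to_g A_{i+1}$. 2. If $call\notin A_i$ and $ret\notin A_{i+1}$, then $A_i\to_a A_{i+1}$ and ($p_\infty\in A_i$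 iff $p_\infty\in A_{i+1}$). 3. If $call\notin A_i$ and $ret\in A_{i+1}$, then $X^a\top\notin A_i$, and $P^a\top\in A_{i+1}$ iff the return $i+1$ has a matching call; if $P^a\top\notin A_{i+1}$, then $p_\infty\in A_i\cap A_{i+1}$ and $Caller(A_{i+1})=\emptyset$. 4. If $call\in A_i$ and $i$ has no matching return, then $X^a\top\notin A_i$ and $p_\infty\in A_i$; if it has matching return $j$, then $A_i\to_a A_j$ and ($p_\infty\in A_i$ iff $p_\infty\in A_j$). If $call\in A_i$ and $ret\notin A_{i+1}$, then $P^a\top\notin A_{i+1}$, $Caller(A_{i+1})=\{P^c\psi\in Cl(\varphi):\psi\in A_i\}$, and ($X^a\top\in A_i$ iff $p_\infty\notin A_{i+1}$). 5. For all $\lhd^{d'}_I\psi,\rhd^d_I\psi\in Cl(\varphi)$: $\lhd^{d'}_I\psi\in A_i$ iff the value of $x^{d'}_\psi$ at $i$ is defined and in $I$, and $\rhd^d_I\psi\in A_i$ iff the value of $y^d_\psi$ at $i$ is defined and in $I$. It is fair if $p_\infty\in A_i$ for infinitely many $i$; for each $\psi_1U^g\psi_2\in Cl(\varphi)$ infinitely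 many $A_i$ contain $\psi_2$ or $\neg(\psi_1U^g\psi_2)$; and for each $\psi_1U^a\psi_2\in Cl(\varphi)$ infinitely many $A_i$ contain $p_\infty$ and one of $\psi_2,\neg(\psi_1U^a\psi_2)$. It is initialized if $\varphi\in A_0$. **Theorem.** There are an absolute constant $C$ and algorithms (while-programs on binary trees, every instruction costing at least the size of the tree it is applied to) as follows. (a) Given $n$ (as the list of the propositions in $Prop$) and an ECNTL formula $\varphi$ over $Prop$ (as a syntax tree, numbers in binary), the first algorithm outputs in time at most $2^{C(n+size(\varphi))}$ an explicit description of a generalized Büchi ECNA over $\Sigma_{Cl(\varphi)}$ with at most $2^{C(n+|\varphi|)}$ states and at most $2^{C(n+|\varphi|)}$ stack symbols, at most $C|\varphi|$ clocks occurring in its constraints, and all constants of its constraints in $Const_\varphi\cup\{0\}$, that accepts exactly the initialized fair Hintikka sequences of $\varphi$. (b) Given $n$ and a non-recursive $\varphi$, the second algorithm outputs, within the same bounds on time, states, stack symbols, clocks and constants, a generalized Büchi ECNA over $\Sigma_{Prop}$ that accepts exactly the infinite models of $\varphi$. In particular, for fixed $Prop$ these bounds are $2^{O(size(\varphi))}$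 for the time, $2^{O(|\varphi|)}$ for states and stack symbols, and $O(|\varphi|)$ for the clocks. -/

import Mathlib

namespace ECNTL

/-! ## Pushdown alphabets and infinite timed words -/

/-- A set of atomic propositions with the three special propositions `call`, `ret`, `int`. -/
class RecProps (P : Type) where
  call : P
  ret : P
  intl : P
  call_ne_ret : call ≠ ret
  call_ne_intl : call ≠ intl
  ret_ne_intl : ret ≠ intl

open RecProps

/-- The propositions `p_0, …, p_{n+2}`; the first three are `call`, `ret`, `int`. -/
instance finRecProps (n : ℕ) : RecProps (Fin (n + 3)) where
  call := ⟨0, by omega⟩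
  ret := ⟨1, by omega⟩
  intl := ⟨2, by omega⟩
  call_ne_ret := by simp
  call_ne_intl := by simp
  ret_ne_intl := by simp

section Words
variable {P : Type} [RecProps P]

def IsCall (a : Finset P) : Prop := call ∈ a ∧ ret ∉ a ∧ intl ∉ a
def IsRet (a : Finset P) : Prop := ret ∈ a ∧ call ∉ a ∧ intl ∉ a
def IsInt (a : Finset P) : Prop := intl ∈ a ∧ call ∉ a ∧ ret ∉ a

/-- Infinite timed words over the pushdown alphabet induced by `P`. -/
structure TimedWord (P : Type) [RecProps P] where
  letter : ℕ → Finset P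
  time : ℕ → ℝ
  letter_mem : ∀ i, IsCall (letter i) ∨ IsRet (letter i) ∨ IsInt (letter i)
  time_nonneg : ∀ i, 0 ≤ time i
  time_mono : Monotone time
  time_diverges : ∀ t : ℝ, ∃ i, t ≤ time i

/-- Well-matched finite words. -/
inductive WellMatched : List (Finset P) → Prop
  | nil : WellMatched []
  | internal (a : Finset P) (u : List (Finset P)) :
      IsInt a → WellMatched u → WellMatched (a :: u)
  | call (c r : Finset P) (u v : List (Finset P)) :
      IsCall c → IsRet r → WellMatched u → WellMatched v →
      WellMatched (c :: (u ++ r :: v))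

/-- `j` is the matching return of the call position `i` (the infix strictly between `i` and `j`
is well-matched). -/
def Matching (σ : ℕ → Finset P) (i j : ℕ) : Prop :=
  IsCall (σ i) ∧ i < j ∧ IsRet (σ j) ∧
    WellMatched ((List.range' (i + 1) (j - (i + 1))).map σ)

/-- `j` is the abstract successor of `i`; the abstract successor of `i` is undefined iff there
is no such `j`. -/
def AbsSucc (σ : ℕ → Finset P) (i j : ℕ) : Prop :=
  Matching σ i j ∨ (¬ IsCall (σ i) ∧ j = i + 1 ∧ ¬ IsRet (σ j))

/-- `j` is the caller of `i`: the greatest call position before `i` whose abstract successor is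
undefined or greater than `i`. -/
def CallerOf (σ : ℕ → Finset P) (i j : ℕ) : Prop :=
  IsGreatest {k | k < i ∧ IsCall (σ k) ∧
    ((¬ ∃ m, AbsSucc σ k m) ∨ ∃ m, AbsSucc σ k m ∧ i < m)} j

/-- Directions of the past modalities and of the recorder clocks. -/
inductive Dir
  | glob | abs | caller
  deriving DecidableEq

/-- Directions of the future modalities and of the predictor clocks. -/
inductive FDir
  | glob | abs
  deriving DecidableEq

def FDir.toDir : FDir → Dir
  | .glob => .glob
  | .abs => .abs

/-- The positions visited, respectively, by the whole word, by the maximal abstract path through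
`i` (everything reachable from `i` by iterating the abstract successor forwards or backwards),
and by the caller path from `i`. -/
def Pos (σ : ℕ → Finset P) : Dir → ℕ → Set ℕ
  | .glob, _ => Set.univ
  | .abs, i => {j | Relation.ReflTransGen (AbsSucc σ) i j ∨ Relation.ReflTransGen (AbsSucc σ) j i}
  | .caller, i => {j | Relation.ReflTransGen (CallerOf σ) i j}

/-- `j` is the (global or abstract) successor of `i`. -/
def IsSucc (σ : ℕ → Finset P) : FDir → ℕ → ℕ → Prop
  | .glob, i, j => j = i + 1
  | .abs, i, j => AbsSucc σ i j

/-- `j` is the predecessor of `i` in the given direction. -/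
def IsPred (σ : ℕ → Finset P) : Dir → ℕ → ℕ → Prop
  | .glob, i, j => i = j + 1
  | .abs, i, j => AbsSucc σ j i
  | .caller, i, j => CallerOf σ i j

end Words

/-! ## Intervals, event clocks, clock constraints -/

/-- Intervals of non-negative reals: the left end point with a flag (`true` = closed), and the
right end point with such a flag, or `none` for a right-unbounded interval. -/
structure Interval where
  lo : ℕ
  loClosed : Bool
  hi : Option (ℕ × Bool)
  deriving DecidableEq

def Interval.toSet (I : Interval) : Set ℝ :=
  {t | 0 ≤ t ∧ (if I.loClosed then (I.lo : ℝ) ≤ t else (I.lo : ℝ) < t) ∧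
    match I.hi with
    | none => True
    | some (b, true) => t ≤ b
    | some (b, false) => t < b}

/-- The finite end points of an interval. -/
def Interval.consts (I : Interval) : Finset ℕ :=
  match I.hi with
  | none => {I.lo}
  | some (b, _) => {I.lo, b}

/-- Event clocks: recorders `x_p^d` and predictors `y_p^d`. -/
inductive Clock (P : Type)
  | recorder (d : Dir) (p : P)
  | predictor (d : FDir) (p : P)
  deriving DecidableEq

/-- The right-hand sides of atomic constraints: an interval, or "undefined". -/
inductive Guard
  | within (I : Interval)
  | undef
  deriving DecidableEq

/-- Satisfaction by a clock value, `none` being the undefined value. -/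
def Guard.Sat : Guard → Option ℝ → Prop
  | .within I, v => ∃ t, v = some t ∧ t ∈ I.toSet
  | .undef, v => v = none

/-- The constants of a guard. -/
def Guard.consts : Guard → Finset ℕ
  | .within I => I.consts
  | .undef => ∅

/-- A clock constraint: a finite conjunction of atomic constraints `z ∈ I`. -/
abbrev Constraint (P : Type) := Finset (Clock P × Guard)

section Clocks
variable {P : Type} [RecProps P]

/-- `j` is the last position before `i`, among those of direction `d`, where `p` occurs. -/
def LastOcc (w : TimedWord P) (d : Dir) (p : P) (i j : ℕ) : Prop :=
  j < i ∧ p ∈ w.letter j ∧ j ∈ Pos w.letter d i ∧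
    ∀ k, j < k → k < i → k ∈ Pos w.letter d i → p ∉ w.letter k

/-- `j` is the first position after `i`, among those of direction `d`, where `p` occurs. -/
def NextOcc (w : TimedWord P) (d : FDir) (p : P) (i j : ℕ) : Prop :=
  i < j ∧ p ∈ w.letter j ∧ j ∈ Pos w.letter d.toDir i ∧
    ∀ k, i < k → k < j → k ∈ Pos w.letter d.toDir i → p ∉ w.letter k

open Classical in
/-- The deterministic valuation of the event clocks at position `i`. -/
noncomputable def clockVal (w : TimedWord P) (i : ℕ) : Clock P → Option ℝ
  | .recorder d p =>
      if h : ∃ j, LastOcc w d p i j then some (w.time i - w.time h.choose) else none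
  | .predictor d p =>
      if h : ∃ j, NextOcc w d p i j then some (w.time h.choose - w.time i) else none

def Constraint.Sat (θ : Constraint P) (w : TimedWord P) (i : ℕ) : Prop :=
  ∀ c ∈ θ, c.2.Sat (clockVal w i c.1)

end Clocks

/-! ## Generalized Büchi event-clock nested automata -/

/-- Generalized Büchi ECNA over the pushdown alphabet induced by `P`; states and stack symbols
are drawn from the types `Q` and `Γ`. In pop transitions `none` is the stack bottom symbol. -/
structure ECNA (P Q Γ : Type) [RecProps P] where
  states : Finset Q
  stackSyms : Finset Γ
  init : Finset Q
  push : Finset (Q × Finset P × Constraint P × Q × Γ)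
  pop : Finset (Q × Finset P × Constraint P × Option Γ × Q)
  internal : Finset (Q × Finset P × Constraint P × Q)
  acc : Finset (Finset Q)
  init_sub : init ⊆ states
  push_mem : ∀ q a θ q' γ, (q, a, θ, q', γ) ∈ push →
    q ∈ states ∧ IsCall a ∧ q' ∈ states ∧ γ ∈ stackSyms
  pop_mem : ∀ q a θ g q', (q, a, θ, g, q') ∈ pop →
    q ∈ states ∧ IsRet a ∧ (∀ γ, g = some γ → γ ∈ stackSyms) ∧ q' ∈ states
  internal_mem : ∀ q a θ q', (q, a, θ, q') ∈ internal → q ∈ states ∧ IsInt a ∧ q' ∈ states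
  acc_sub : ∀ F ∈ acc, F ⊆ states

namespace ECNA
variable {P Q Γ : Type} [RecProps P]

/-- `(st i, stk i)` is an infinite run on `w`; the list `stk i` is the stack content, top first
and without the bottom symbol. -/
structure IsRun (A : ECNA P Q Γ) (w : TimedWord P) (st : ℕ → Q) (stk : ℕ → List Γ) : Prop where
  start : st 0 ∈ A.init
  start_stack : stk 0 = []
  push : ∀ i, IsCall (w.letter i) → ∃ θ γ,
    (st i, w.letter i, θ, st (i + 1), γ) ∈ A.push ∧ stk (i + 1) = γ :: stk i ∧
      Constraint.Sat θ w i
  pop : ∀ i, IsRet (w.letter i) → ∃ θ g,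
    (st i, w.letter i, θ, g, st (i + 1)) ∈ A.pop ∧ Constraint.Sat θ w i ∧
      ((∃ γ, g = some γ ∧ stk i = γ :: stk (i + 1)) ∨
        (g = none ∧ stk i = [] ∧ stk (i + 1) = []))
  internal : ∀ i, IsInt (w.letter i) → ∃ θ,
    (st i, w.letter i, θ, st (i + 1)) ∈ A.internal ∧ stk (i + 1) = stk i ∧
      Constraint.Sat θ w i

/-- Generalized Büchi acceptance of an infinite timed word. -/
def Accepts (A : ECNA P Q Γ) (w : TimedWord P) : Prop :=
  ∃ st stk, A.IsRun w st stk ∧ ∀ F ∈ A.acc, ∀ m, ∃ i, m ≤ i ∧ st i ∈ F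

/-- `c` is an atomic constraint of some transition. -/
def Uses (A : ECNA P Q Γ) (c : Clock P × Guard) : Prop :=
  (∃ δ ∈ A.push, c ∈ δ.2.2.1) ∨ (∃ δ ∈ A.pop, c ∈ δ.2.2.1) ∨ (∃ δ ∈ A.internal, c ∈ δ.2.2.1)

/-- The clocks used by the automaton. -/
def clocks (A : ECNA P Q Γ) : Set (Clock P) := {z | ∃ g, A.Uses (z, g)}

/-- The constants used by the automaton. -/
def consts (A : ECNA P Q Γ) : Set ℕ := {k | ∃ z g, A.Uses (z, g) ∧ k ∈ g.consts}

end ECNA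

/-! ## The logic ECNTL -/

inductive Formula (P : Type)
  | tru
  | prop (p : P)
  | or (f g : Formula P)
  | neg (f : Formula P)
  | next (d : FDir) (f : Formula P)
  | prev (d : Dir) (f : Formula P)
  | untl (d : FDir) (f g : Formula P)
  | since (d : Dir) (f g : Formula P)
  | nextClock (d : FDir) (I : Interval) (f : Formula P)
  | prevClock (d : Dir) (I : Interval) (f : Formula P)
  deriving DecidableEq

namespace Formula
variable {P : Type}

/-- The set of subformulas. -/
def sub [DecidableEq P] : Formula P → Finset (Formula P)
  | tru => {tru}
  | prop p => {prop p}
  | or f g => insert (or f g) (sub f ∪ sub g)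
  | neg f => insert (neg f) (sub f)
  | next d f => insert (next d f) (sub f)
  | prev d f => insert (prev d f) (sub f)
  | untl d f g => insert (untl d f g) (sub f ∪ sub g)
  | since d f g => insert (since d f g) (sub f ∪ sub g)
  | nextClock d I f => insert (nextClock d I f) (sub f)
  | prevClock d I f => insert (prevClock d I f) (sub f)

/-- `|φ|`, the number of distinct subformulas. -/
def len [DecidableEq P] (f : Formula P) : ℕ := f.sub.card

/-- The finite end points of the intervals of the real-time modalities. -/
def consts : Formula P → Finset ℕ
  | tru => ∅
  | prop _ => ∅
  | or f g => consts f ∪ consts g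
  | neg f => consts f
  | next _ f => consts f
  | prev _ f => consts f
  | untl _ f g => consts f ∪ consts g
  | since _ f g => consts f ∪ consts g
  | nextClock _ I f => I.consts ∪ consts f
  | prevClock _ I f => I.consts ∪ consts f

/-- The size of a formula: `|φ|` plus the binary length of the largest constant. -/
def size [DecidableEq P] (f : Formula P) : ℕ := f.len + Nat.size (f.consts.sup id)

/-- The non-recursive fragment: real-time modalities are applied to propositions only. -/
def NonRecursive : Formula P → Prop
  | tru => True
  | prop _ => True
  | or f g => NonRecursive f ∧ NonRecursive g
  | neg f => NonRecursive f
  | next _ f => NonRecursive f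
  | prev _ f => NonRecursive f
  | untl _ f g => NonRecursive f ∧ NonRecursive g
  | since _ f g => NonRecursive f ∧ NonRecursive g
  | nextClock _ _ f => ∃ p, f = prop p
  | prevClock _ _ f => ∃ p, f = prop p

/-- Satisfaction at a position of an infinite timed word. -/
def Sat [RecProps P] (w : TimedWord P) : Formula P → ℕ → Prop
  | tru, _ => True
  | prop p, i => p ∈ w.letter i
  | or f g, i => Sat w f i ∨ Sat w g i
  | neg f, i => ¬ Sat w f i
  | next d f, i => ∃ j, i < j ∧ IsSucc w.letter d i j ∧ Sat w f j
  | prev d f, i => ∃ j, j < i ∧ IsPred w.letter d i j ∧ Sat w f j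
  | untl d f g, i => ∃ j, i ≤ j ∧ j ∈ Pos w.letter d.toDir i ∧ Sat w g j ∧
      ∀ k, i ≤ k → k < j → k ∈ Pos w.letter d.toDir i → Sat w f k
  | since d f g, i => ∃ j, j ≤ i ∧ j ∈ Pos w.letter d i ∧ Sat w g j ∧
      ∀ k, j < k → k ≤ i → k ∈ Pos w.letter d i → Sat w f k
  | nextClock d I f, i => ∃ j, i < j ∧ j ∈ Pos w.letter d.toDir i ∧ Sat w f j ∧
      w.time j - w.time i ∈ I.toSet ∧
      ∀ k, i < k → k < j → k ∈ Pos w.letter d.toDir i → ¬ Sat w f k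
  | prevClock d I f, i => ∃ j, j < i ∧ j ∈ Pos w.letter d i ∧ Sat w f j ∧
      w.time i - w.time j ∈ I.toSet ∧
      ∀ k, j < k → k < i → k ∈ Pos w.letter d i → ¬ Sat w f k

/-- `w` is an (infinite) model of `f`. -/
def IsModel [RecProps P] (f : Formula P) (w : TimedWord P) : Prop := f.Sat w 0

/-- Renaming of propositions. -/
def map {P' : Type} (e : P → P') : Formula P → Formula P'
  | tru => tru
  | prop p => prop (e p)
  | or f g => or (map e f) (map e g)
  | neg f => neg (map e f)
  | next d f => next d (map e f)
  | prev d f => prev d (map e f)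
  | untl d f g => untl d (map e f) (map e g)
  | since d f g => since d (map e f) (map e g)
  | nextClock d I f => nextClock d I (map e f)
  | prevClock d I f => prevClock d I (map e f)

/-- Negation with `¬¬ψ` identified with `ψ`. -/
def negate : Formula P → Formula P
  | neg f => f
  | f => neg f

/-- The formula `X^d(f U^d g)` for an until formula, `P^d(f S^d g)` for a since formula, and
nothing otherwise. -/
def unfolding [DecidableEq P] : Formula P → Finset (Formula P)
  | untl d f g => {next d (untl d f g)}
  | since d f g => {prev d (since d f g)}
  | _ => ∅

end Formula

/-! ## Hintikka sequences -/

section Hintikka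
variable {P : Type} [DecidableEq P] [Fintype P]

open Formula

/-- The closure of `φ` without the negations. The extra proposition `p_∞` is
`none : Option P`; a proposition `p` of `P` is `some p`. -/
def closureBase (φ : Formula P) : Finset (Formula (Option P)) :=
  {tru, next .abs tru, prev .abs tru} ∪ Finset.univ.image prop ∪
    (φ.map some).sub ∪ (φ.map some).sub.biUnion unfolding

/-- The closure `Cl(φ)`. -/
def closure (φ : Formula P) : Finset (Formula (Option P)) :=
  closureBase φ ∪ (closureBase φ).image negate

/-- The elements of `Cl(φ)`, seen as atomic propositions. -/
abbrev ClProp (φ : Formula P) : Type := {ψ : Formula (Option P) // ψ ∈ closure φ}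

theorem prop_mem_closure (φ : Formula P) (p : Option P) : prop p ∈ closure φ := by
  simp [closure, closureBase]

instance clRecProps [RecProps P] (φ : Formula P) : RecProps (ClProp φ) where
  call := ⟨prop (some call), prop_mem_closure φ _⟩
  ret := ⟨prop (some ret), prop_mem_closure φ _⟩
  intl := ⟨prop (some intl), prop_mem_closure φ _⟩
  call_ne_ret := by simpa using call_ne_ret
  call_ne_intl := by simpa using call_ne_intl
  ret_ne_intl := by simpa using ret_ne_intl

/-- A letter over `Cl(φ)` as a set of formulas. -/
def fset {φ : Formula P} (a : Finset (ClProp φ)) : Finset (Formula (Option P)) :=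
  a.map (Function.Embedding.subtype _)

/-- Atoms of `φ`. -/
structure IsAtom [RecProps P] (φ : Formula P) (A : Finset (Formula (Option P))) : Prop where
  sub : A ⊆ closure φ
  tru_mem : tru ∈ A
  neg_iff : ∀ ψ ∈ closure φ, ψ ∈ A ↔ ψ.negate ∉ A
  or_iff : ∀ f g, Formula.or f g ∈ closure φ → (Formula.or f g ∈ A ↔ f ∈ A ∨ g ∈ A)
  exactly_one : (prop (some call) ∈ A ∧ prop (some ret) ∉ A ∧ prop (some intl) ∉ A) ∨
    (prop (some ret) ∈ A ∧ prop (some call) ∉ A ∧ prop (some intl) ∉ A) ∨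
    (prop (some intl) ∈ A ∧ prop (some call) ∉ A ∧ prop (some ret) ∉ A)
  untl_iff : ∀ d f g, untl d f g ∈ closure φ →
    (untl d f g ∈ A ↔ g ∈ A ∨ (f ∈ A ∧ next d (untl d f g) ∈ A))
  since_iff : ∀ d f g, since d f g ∈ closure φ →
    (since d f g ∈ A ↔ g ∈ A ∨ (f ∈ A ∧ prev d (since d f g) ∈ A))
  next_abs : next .abs tru ∉ A → ∀ ψ, next .abs ψ ∈ closure φ → next .abs ψ ∉ A
  prev_abs : prev .abs tru ∉ A → ∀ ψ, prev .abs ψ ∈ closure φ → prev .abs ψ ∉ A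

/-- The next requirements (direction `d`) of `A` and the previous requirements (direction `d'`)
of `B` are those that hold in `B`, respectively in `A`. -/
def Linked (φ : Formula P) (d : FDir) (d' : Dir) (A B : Finset (Formula (Option P))) : Prop :=
  (∀ ψ, next d ψ ∈ closure φ → (next d ψ ∈ A ↔ ψ ∈ B)) ∧
  (∀ ψ, prev d' ψ ∈ closure φ → (prev d' ψ ∈ B ↔ ψ ∈ A))

def NextPrev (φ : Formula P) (A B : Finset (Formula (Option P))) : Prop :=
  Linked φ .glob .glob A B

/-- The caller formulas of `A`. -/
def callerSet (A : Finset (Formula (Option P))) : Set (Formula (Option P)) :=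
  {χ | χ ∈ A ∧ ∃ ψ, χ = prev .caller ψ}

def AbsNextPrev (φ : Formula P) (A B : Finset (Formula (Option P))) : Prop :=
  Linked φ .abs .abs A B ∧ callerSet A = callerSet B

/-- The proposition `p_∞`. -/
abbrev pInf : Formula (Option P) := prop none

/-- Hintikka sequences of `φ`: infinite timed words over the pushdown alphabet induced by
`Cl(φ)`, subject to the following conditions. -/
structure IsHintikka [RecProps P] (φ : Formula P) (w : TimedWord (ClProp φ)) : Prop where
  atom : ∀ i, IsAtom φ (fset (w.letter i))
  initial : ∀ d ψ, prev d ψ ∈ closure φ → neg (prev d ψ) ∈ fset (w.letter 0)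
  global : ∀ i, NextPrev φ (fset (w.letter i)) (fset (w.letter (i + 1)))
  /- the position `i` is not a call and `i + 1` is not a return -/
  step : ∀ i, prop (some call) ∉ fset (w.letter i) →
    prop (some ret) ∉ fset (w.letter (i + 1)) →
    AbsNextPrev φ (fset (w.letter i)) (fset (w.letter (i + 1))) ∧
    (pInf ∈ fset (w.letter i) ↔ pInf ∈ fset (w.letter (i + 1)))
  /- the position `i` is not a call and `i + 1` is a return -/
  beforeRet : ∀ i, prop (some call) ∉ fset (w.letter i) →
    prop (some ret) ∈ fset (w.letter (i + 1)) →
    next .abs tru ∉ fset (w.letter i) ∧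
    (prev .abs tru ∈ fset (w.letter (i + 1)) ↔ ∃ j, Matching w.letter j (i + 1)) ∧
    (prev .abs tru ∉ fset (w.letter (i + 1)) →
      pInf ∈ fset (w.letter i) ∧ pInf ∈ fset (w.letter (i + 1)) ∧
      callerSet (fset (w.letter (i + 1))) = ∅)
  /- the position `i` is a call without matching return -/
  unmatchedCall : ∀ i, prop (some call) ∈ fset (w.letter i) →
    (¬ ∃ j, AbsSucc w.letter i j) →
    next .abs tru ∉ fset (w.letter i) ∧ pInf ∈ fset (w.letter i)
  /- the position `i` is a call with matching return `j` -/
  matchedCall : ∀ i j, prop (some call) ∈ fset (w.letter i) → AbsSucc w.letter i j →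
    AbsNextPrev φ (fset (w.letter i)) (fset (w.letter j)) ∧
    (pInf ∈ fset (w.letter i) ↔ pInf ∈ fset (w.letter j))
  /- the position `i` is a call and `i + 1` is not a return, hence starts a new abstract path -/
  afterCall : ∀ i, prop (some call) ∈ fset (w.letter i) →
    prop (some ret) ∉ fset (w.letter (i + 1)) →
    prev .abs tru ∉ fset (w.letter (i + 1)) ∧
    callerSet (fset (w.letter (i + 1))) =
      {χ | χ ∈ closure φ ∧ ∃ ψ, χ = prev .caller ψ ∧ ψ ∈ fset (w.letter i)} ∧
    (next .abs tru ∈ fset (w.letter i) ↔ pInf ∉ fset (w.letter (i + 1)))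
  past : ∀ i d I (ψ : ClProp φ), prevClock d I ψ.1 ∈ closure φ →
    (prevClock d I ψ.1 ∈ fset (w.letter i) ↔
      (Guard.within I).Sat (clockVal w i (.recorder d ψ)))
  future : ∀ i d I (ψ : ClProp φ), nextClock d I ψ.1 ∈ closure φ →
    (nextClock d I ψ.1 ∈ fset (w.letter i) ↔
      (Guard.within I).Sat (clockVal w i (.predictor d ψ)))

/-- The fairness requirement. -/
structure IsFair [RecProps P] (φ : Formula P) (w : TimedWord (ClProp φ)) : Prop where
  inf : ∀ m, ∃ i, m ≤ i ∧ pInf ∈ fset (w.letter i)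
  untl_glob : ∀ f g, untl .glob f g ∈ closure φ → ∀ m, ∃ i, m ≤ i ∧
    (g ∈ fset (w.letter i) ∨ neg (untl .glob f g) ∈ fset (w.letter i))
  untl_abs : ∀ f g, untl .abs f g ∈ closure φ → ∀ m, ∃ i, m ≤ i ∧
    pInf ∈ fset (w.letter i) ∧
    (g ∈ fset (w.letter i) ∨ neg (untl .abs f g) ∈ fset (w.letter i))

/-- Initialized fair Hintikka sequences of `φ`. -/
def IsInitFairHintikka [RecProps P] (φ : Formula P) (w : TimedWord (ClProp φ)) : Prop :=
  IsHintikka φ w ∧ IsFair φ w ∧ φ.map some ∈ fset (w.letter 0)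

end Hintikka

/-! ## Computation: while-programs on binary trees, with running times -/

/-- Binary trees, the data of the programs. -/
inductive Data
  | nil
  | cons (a b : Data)
  deriving DecidableEq

/-- The number of nodes, leaves included. -/
def Data.size : Data → ℕ
  | .nil => 1
  | .cons a b => a.size + b.size + 1

/-- Programs. Each transforms one tree: `hd`, `tl` take the two subtrees, `pair f g` applies `f`
and `g` to the same tree and joins the results, `seq f g` is `f` followed by `g`, `ite c f g`
runs `f` if the value of `c` is not `nil` and `g` otherwise, and `loop c f` repeats `f` as long as
the value of `c` is not `nil`. -/
inductive Prog
  | id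
  | nil
  | hd
  | tl
  | pair (f g : Prog)
  | seq (f g : Prog)
  | ite (c f g : Prog)
  | loop (c f : Prog)

/-- `p.Runs x y t`: started on `x`, the program `p` halts with value `y` after time `t`. Every
instruction is charged at least the size of the tree it is applied to, so that no operation on
large trees is cheap and the size of a value never exceeds the time spent on it. -/
inductive Prog.Runs : Prog → Data → Data → ℕ → Prop
  | id (x) : Runs .id x x x.size
  | nil (x) : Runs .nil x .nil x.size
  | hd (a b) : Runs .hd (.cons a b) a (Data.cons a b).size
  | hd_nil : Runs .hd .nil .nil 1
  | tl (a b) : Runs .tl (.cons a b) b (Data.cons a b).size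
  | tl_nil : Runs .tl .nil .nil 1
  | pair {f g x a b s t} : Runs f x a s → Runs g x b t →
      Runs (.pair f g) x (.cons a b) (s + t + x.size)
  | seq {f g x y z s t} : Runs f x y s → Runs g y z t → Runs (.seq f g) x z (s + t + 1)
  | ite_true {c f g x a b y s t} : Runs c x (.cons a b) s → Runs f x y t →
      Runs (.ite c f g) x y (s + t + x.size)
  | ite_false {c f g x y s t} : Runs c x .nil s → Runs g x y t →
      Runs (.ite c f g) x y (s + t + x.size)
  | loop_done {c f x s} : Runs c x .nil s → Runs (.loop c f) x x (s + x.size)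
  | loop_step {c f x a b y z s t u} : Runs c x (.cons a b) s → Runs f x y t →
      Runs (.loop c f) y z u → Runs (.loop c f) x z (s + t + u + x.size)

/-! ## Encodings by trees -/

def listCode : List Data → Data
  | [] => .nil
  | x :: l => .cons x (listCode l)

/-- Unary tags. -/
def tag : ℕ → Data
  | 0 => .nil
  | k + 1 => .cons .nil (tag k)

/-- Types whose elements have one code each. -/
class Enc (α : Type) where
  code : α → Data

instance : Enc Data := ⟨fun x => x⟩
instance : Enc Bool := ⟨fun b => if b then tag 1 else tag 0⟩
/-- Numbers are coded in binary. -/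
instance : Enc ℕ := ⟨fun k => listCode (k.bits.map Enc.code)⟩
instance {m : ℕ} : Enc (Fin m) := ⟨fun i => Enc.code i.val⟩
instance {α : Type} [Enc α] : Enc (Option α) :=
  ⟨fun o => match o with
    | none => .nil
    | some a => .cons .nil (Enc.code a)⟩
instance {α : Type} [Enc α] {p : α → Prop} : Enc {a // p a} := ⟨fun a => Enc.code a.1⟩
instance : Enc Dir := ⟨fun d => match d with
  | .glob => tag 0
  | .abs => tag 1
  | .caller => tag 2⟩
instance : Enc FDir := ⟨fun d => Enc.code d.toDir⟩
instance : Enc Interval := ⟨fun I =>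
  .cons (Enc.code I.lo) (.cons (Enc.code I.loClosed)
    (match I.hi with
      | none => .nil
      | some (b, c) => .cons (Enc.code b) (Enc.code c)))⟩
instance : Enc Guard := ⟨fun g => match g with
  | .within I => .cons .nil (Enc.code I)
  | .undef => .nil⟩
instance {P : Type} [Enc P] : Enc (Clock P) := ⟨fun z => match z with
  | .recorder d p => .cons (tag 0) (.cons (Enc.code d) (Enc.code p))
  | .predictor d p => .cons (tag 1) (.cons (Enc.code d) (Enc.code p))⟩

/-- The syntax tree of a formula. -/
def Formula.code {P : Type} [Enc P] : Formula P → Data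
  | .tru => .cons (tag 0) .nil
  | .prop p => .cons (tag 1) (Enc.code p)
  | .or f g => .cons (tag 2) (.cons f.code g.code)
  | .neg f => .cons (tag 3) f.code
  | .next d f => .cons (tag 4) (.cons (Enc.code d) f.code)
  | .prev d f => .cons (tag 5) (.cons (Enc.code d) f.code)
  | .untl d f g => .cons (tag 6) (.cons (Enc.code d) (.cons f.code g.code))
  | .since d f g => .cons (tag 7) (.cons (Enc.code d) (.cons f.code g.code))
  | .nextClock d I f => .cons (tag 8) (.cons (Enc.code d) (.cons (Enc.code I) f.code))
  | .prevClock d I f => .cons (tag 9) (.cons (Enc.code d) (.cons (Enc.code I) f.code))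

instance {P : Type} [Enc P] : Enc (Formula P) := ⟨Formula.code⟩

/-- The input of the construction: the list of all propositions, and the formula. -/
def inputCode (n : ℕ) (φ : Formula (Fin (n + 3))) : Data :=
  .cons (listCode ((List.finRange (n + 3)).map Enc.code)) φ.code

/-- `Rep.IsCode a x`: the tree `x` describes the object `a`. A finite set is described by any
list, in any order and possibly with repetitions, of descriptions of its elements. -/
class Rep (α : Type) where
  IsCode : α → Data → Prop

instance {α : Type} [Enc α] : Rep α := ⟨fun a x => x = Enc.code a⟩
instance {α β : Type} [Rep α] [Rep β] : Rep (α × β) :=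
  ⟨fun a x => ∃ y z, x = .cons y z ∧ Rep.IsCode a.1 y ∧ Rep.IsCode a.2 z⟩
instance {α : Type} [Rep α] : Rep (Finset α) :=
  ⟨fun s x => ∃ l : List Data, x = listCode l ∧
    (∀ a ∈ s, ∃ y ∈ l, Rep.IsCode a y) ∧ (∀ y ∈ l, ∃ a ∈ s, Rep.IsCode a y)⟩

/-- `x` is an explicit description of the automaton `A`: of its states, stack symbols, initial
states, transitions, and acceptance sets. -/
def ECNA.IsCode {P Q Γ : Type} [RecProps P] [Enc P] [Enc Q] [Enc Γ] (A : ECNA P Q Γ) (x : Data) :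
    Prop :=
  Rep.IsCode (A.states, A.stackSyms, A.init, A.push, A.pop, A.internal, A.acc) x

end ECNTL

open ECNTL

/-!
The automaton guesses an atom of `φ` at each position. Its states are the sets of closure formulas,
represented by lists of codes, and at a call it pushes its state, so that at the matching return
both atoms are at hand. Most conditions on Hintikka sequences relate the atoms at two consecutive
positions or at a call and its matching return, and can be checked in this way. The exception is
that a call whose atom contains `X^a ⊤` must have a matching return. Fairness takes care of it: if
the promised return never came, `p_∞` would fail at all later positions
(`pInf_not_mem_of_unmatched`), but a fair sequence contains `p_∞` infinitely often. Hence fair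
Hintikka sequences are described by local conditions (`genHintikka_iff_local`). That the stack of a
run holds the states at the calls not yet matched is a statement about `pstk`, which is computed
letter by letter, and its relation to well-matched infixes (`pstk_top`, `mem_pstk_iff`).

The real-time formulas of an atom are checked by the clock constraint of the transition. The
complement of an interval is a union of the values below it, the values above it, and the undefined
value, so that the automaton guesses which atomic constraints hold and checks that they assert the
right truth values (`clocksAgree_iff`). The only constants are those of `φ` and `0`.

Both parts of the theorem are instances of one construction. A labelling assigns to each
proposition of the alphabet the formula it stands for, and the letter at a position must consist of
the propositions whose labels are in the guessed atom. For the alphabet of the closure each formula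
labels itself, and the guessed sequence is the word (`exists_genHintikka_val_iff`). For the
alphabet `Prop` and a non-recursive formula, the atoms are guessed on top of the word. The
real-time modalities then refer only to propositions that can be read off the word, and the truth
lemma `GenHintikka.truth` shows that a word carries an initialized fair Hintikka sequence exactly
if it is a model (`exists_genHintikka_iff`). For the existence one takes the formulas true at each
position and lets `p_∞` hold at the positions in the scope of no matched call.

For the running time, `PT` is the class of functions on trees computed by programs in polynomial
time. It is closed under composition, conditionals, folds and suitably bounded iteration, and hence
under the usual operations on lists, and the predicates decided in polynomial time (`PTP`) are
closed under Boolean operations and quantification over list elements. The description of the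
automaton is obtained in this way from the list of the closure formulas, the list of atomic
constraints, and the lists of all sublists of these two (`pow_runs`), so its computation takes time
polynomial in the size of the input and in two to the number of formulas and constraints
(`descD_runs`). These numbers are linear in `n + |φ|`. The input is a syntax tree, which may be
larger than the number of subformulas, but only exponentially (`size_code_formula_le`). Altogether
the time is `2 ^ O(n + size(φ))`.
-/

namespace ECNTL

/-! ### Polynomial-time functions on trees -/

namespace Data

/-- The left subtree; the tree `nil` is its own left subtree. -/
def hd : Data → Data
  | nil => nil
  | cons a _ => a

/-- The right subtree; the tree `nil` is its own right subtree. -/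
def tl : Data → Data
  | nil => nil
  | cons _ b => b

/-- Every tree is the code of exactly one list of trees. -/
def toList : Data → List Data
  | nil => []
  | cons a b => a :: b.toList

@[simp] theorem hd_cons (a b : Data) : (cons a b).hd = a := rfl
@[simp] theorem tl_cons (a b : Data) : (cons a b).tl = b := rfl
@[simp] theorem hd_nil : nil.hd = nil := rfl
@[simp] theorem tl_nil : nil.tl = nil := rfl
@[simp] theorem toList_nil : nil.toList = [] := rfl
@[simp] theorem toList_cons (a b : Data) : (cons a b).toList = a :: b.toList := rfl
@[simp] theorem size_nil : nil.size = 1 := rfl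
@[simp] theorem size_cons (a b : Data) : (cons a b).size = a.size + b.size + 1 := rfl

@[simp] theorem toList_listCode (l : List Data) : (listCode l).toList = l := by
  induction l with
  | nil => rfl
  | cons a l ih => simp [listCode, ih]

@[simp] theorem listCode_toList (d : Data) : listCode d.toList = d := by
  induction d with
  | nil => rfl
  | cons a b _ ih => simp [listCode, ih]

theorem size_pos (d : Data) : 1 ≤ d.size := by
  cases d <;> simp

theorem hd_size_le (d : Data) : d.hd.size ≤ d.size := by
  cases d
  · rfl
  · rw [hd_cons, size_cons]; omega

theorem tl_size_le (d : Data) : d.tl.size ≤ d.size := by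
  cases d
  · rfl
  · rw [tl_cons, size_cons]; omega

theorem size_of_mem {e d : Data} (h : e ∈ d.toList) : e.size < d.size := by
  induction d with
  | nil => simp at h
  | cons a b _ ih =>
    rcases List.mem_cons.1 h with rfl | h
    · rw [size_cons]; omega
    · have := ih h
      simp; omega

theorem length_toList_lt (d : Data) : d.toList.length < d.size := by
  induction d with
  | nil => simp
  | cons a b _ ih =>
    have := a.size_pos
    simp; omega

theorem size_eq_sum (d : Data) : d.size = (d.toList.map fun e => e.size + 1).sum + 1 := by
  induction d with
  | nil => rfl
  | cons a b _ ih => simp only [size_cons, toList_cons, List.map_cons, List.sum_cons]; omega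

end Data

open Data

theorem size_listCode (l : List Data) :
    (listCode l).size = (l.map fun e => e.size + 1).sum + 1 := by
  rw [size_eq_sum, toList_listCode]

theorem size_listCode_append (l m : List Data) :
    (listCode (l ++ m)).size + 1 = (listCode l).size + (listCode m).size := by
  simp [size_listCode]; omega

theorem size_listCode_le_of_mem {l : List Data} {B : ℕ} (h : ∀ e ∈ l, e.size ≤ B) :
    (listCode l).size ≤ l.length * (B + 1) + 1 := by
  rw [size_listCode]
  have := List.sum_le_card_nsmul (l.map fun e => e.size + 1) (B + 1) (by simpa using h)
  simpa using this

theorem size_tag (k : ℕ) : (tag k).size = 2 * k + 1 := by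
  induction k with
  | zero => rfl
  | succ k ih => simp [tag, ih]; omega

/-- A value is never larger than the time spent on it. -/
theorem Prog.Runs.output_le {p : Prog} {x y : Data} {t : ℕ} (h : p.Runs x y t) : y.size ≤ t := by
  induction h with
  | @pair f g x a b s t _ _ _ _ => have := x.size_pos; simp only [size_cons]; omega
  | nil x => exact x.size_pos
  | _ => (try simp only [size_cons, size_nil] at *); omega

/-- `p` computes `F` in time `(size + 1) ^ k`. -/
def Computes (p : Prog) (F : Data → Data) (k : ℕ) : Prop :=
  ∀ x, ∃ t, p.Runs x (F x) t ∧ t ≤ (x.size + 1) ^ k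

/-- The functions on trees computed by programs in polynomial time. -/
def PT (F : Data → Data) : Prop := ∃ p k, Computes p F k

/-- Three powers of `a` and a unit, the shape of the cost of each composite instruction, are again
bounded by a power of `a`. -/
theorem pow_add_three_le {a : ℕ} (ha : 2 ≤ a) (i j k : ℕ) :
    a ^ i + a ^ j + a ^ k ≤ a ^ (i + j + k + 2) := by
  have h0 : 1 ≤ a := by omega
  have hi : a ^ i ≤ a ^ (i + j + k) := Nat.pow_le_pow_right h0 (by omega)
  have hj : a ^ j ≤ a ^ (i + j + k) := Nat.pow_le_pow_right h0 (by omega)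
  have hk : a ^ k ≤ a ^ (i + j + k) := Nat.pow_le_pow_right h0 (by omega)
  have h4 : 4 ≤ a ^ 2 := by nlinarith
  calc a ^ i + a ^ j + a ^ k ≤ a ^ (i + j + k) * 4 := by omega
    _ ≤ a ^ (i + j + k) * a ^ 2 := Nat.mul_le_mul_left _ h4
    _ = a ^ (i + j + k + 2) := by rw [← pow_add]

theorem add_one_le_pow_succ {a k b : ℕ} (ha : 2 ≤ a) (hb : b ≤ a ^ k) : b + 1 ≤ a ^ (k + 1) := by
  have : 1 ≤ a ^ k := Nat.one_le_pow _ _ (by omega)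
  rw [pow_succ]; nlinarith

theorem two_le_size_add_one (x : Data) : 2 ≤ x.size + 1 := by
  have := x.size_pos; omega

namespace PT

theorem size_le {F : Data → Data} (h : PT F) : ∃ k, ∀ x, (F x).size ≤ (x.size + 1) ^ k := by
  obtain ⟨p, k, h⟩ := h
  exact ⟨k, fun x => let ⟨_, h1, h2⟩ := h x; h1.output_le.trans h2⟩

theorem id : PT fun x => x :=
  ⟨.id, 1, fun x => ⟨_, .id x, by simp⟩⟩

theorem hd_id : PT fun x => x.hd :=
  ⟨.hd, 1, fun x => by
    cases x with
    | nil => exact ⟨_, .hd_nil, by simp⟩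
    | cons a b => exact ⟨_, .hd a b, by simp⟩⟩

theorem tl_id : PT fun x => x.tl :=
  ⟨.tl, 1, fun x => by
    cases x with
    | nil => exact ⟨_, .tl_nil, by simp⟩
    | cons a b => exact ⟨_, .tl a b, by simp⟩⟩

theorem nil : PT fun _ => Data.nil :=
  ⟨.nil, 1, fun x => ⟨_, .nil x, by simp⟩⟩

theorem comp {G F : Data → Data} (hG : PT G) (hF : PT F) : PT fun x => G (F x) := by
  obtain ⟨p, k, hp⟩ := hF
  obtain ⟨q, l, hq⟩ := hG
  refine ⟨.seq p q, k + (k + 1) * l + 0 + 2, fun x => ?_⟩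
  obtain ⟨s, h1, h2⟩ := hp x
  obtain ⟨t, h3, h4⟩ := hq (F x)
  refine ⟨_, .seq h1 h3, ?_⟩
  have ha := two_le_size_add_one x
  have h5 : t ≤ (x.size + 1) ^ ((k + 1) * l) := by
    rw [pow_mul]
    exact h4.trans (Nat.pow_le_pow_left (add_one_le_pow_succ ha (h1.output_le.trans h2)) _)
  have := pow_add_three_le ha k ((k + 1) * l) 0
  simp only [pow_zero] at this
  omega

theorem pair {F G : Data → Data} (hF : PT F) (hG : PT G) : PT fun x => .cons (F x) (G x) := by
  obtain ⟨p, k, hp⟩ := hF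
  obtain ⟨q, l, hq⟩ := hG
  refine ⟨.pair p q, k + l + 1 + 2, fun x => ?_⟩
  obtain ⟨s, h1, h2⟩ := hp x
  obtain ⟨t, h3, h4⟩ := hq x
  refine ⟨_, .pair h1 h3, ?_⟩
  have := pow_add_three_le (two_le_size_add_one x) k l 1
  simp only [pow_one] at this
  omega

theorem hd {F : Data → Data} (hF : PT F) : PT fun x => (F x).hd := comp hd_id hF
theorem tl {F : Data → Data} (hF : PT F) : PT fun x => (F x).tl := comp tl_id hF

theorem const (d : Data) : PT fun _ => d := by
  induction d with
  | nil => exact nil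
  | cons a b iha ihb => exact pair iha ihb

/-- A conditional on whether `C x` is `nil`, the tree that programs read as false. -/
theorem ite_nil {C F G : Data → Data} (hC : PT C) (hF : PT F) (hG : PT G) :
    PT fun x => if C x = .nil then F x else G x := by
  obtain ⟨c, m, hc⟩ := hC
  obtain ⟨p, k, hp⟩ := hF
  obtain ⟨q, l, hq⟩ := hG
  refine ⟨.ite c q p, m + (k + l) + 1 + 2, fun x => ?_⟩
  obtain ⟨r, h1, h2⟩ := hc x
  obtain ⟨s, h3, h4⟩ := hp x
  obtain ⟨t, h5, h6⟩ := hq x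
  have := pow_add_three_le (two_le_size_add_one x) m (k + l) 1
  simp only [pow_one] at this
  have hk : (x.size + 1) ^ k ≤ (x.size + 1) ^ (k + l) := Nat.pow_le_pow_right (by omega) (by omega)
  have hl : (x.size + 1) ^ l ≤ (x.size + 1) ^ (k + l) := Nat.pow_le_pow_right (by omega) (by omega)
  by_cases h : C x = .nil
  · rw [h] at h1
    simp only [h, if_true]
    exact ⟨_, .ite_false h1 h3, by omega⟩
  · simp only [h, if_false]
    obtain ⟨a, b, hab⟩ : ∃ a b, C x = .cons a b := by
      cases h' : C x with
      | nil => exact absurd h' h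
      | cons a b => exact ⟨a, b, rfl⟩
    rw [hab] at h1
    exact ⟨_, .ite_true h1 h5, by omega⟩

end PT

/-- A loop whose condition fails for the first time after `N` rounds computes the `N`-th iterate of
its body. Its time is bounded in terms of the number `B` that exceeds the sizes of all intermediate
results. -/
theorem Prog.Runs.loop_of_iterate {c s : Prog} {C S : Data → Data} {m l B : ℕ}
    (hc : Computes c C m) (hs : Computes s S l) :
    ∀ (N : ℕ) (x : Data), (∀ j ≤ N, (S^[j] x).size + 1 ≤ B) → (∀ j < N, C (S^[j] x) ≠ .nil) →
      C (S^[N] x) = .nil →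
      ∃ t, (Prog.loop c s).Runs x (S^[N] x) t ∧ t ≤ (N + 1) * (B ^ m + B ^ l + B) := by
  intro N
  induction N with
  | zero =>
    intro x hB _ h0
    obtain ⟨t, h1, h2⟩ := hc x
    have hx := hB 0 le_rfl
    simp only [Function.iterate_zero, id_eq] at h0 hx ⊢
    rw [h0] at h1
    refine ⟨_, .loop_done h1, ?_⟩
    have := h2.trans (Nat.pow_le_pow_left hx m)
    omega
  | succ N ih =>
    intro x hB hne h0
    have hx := hB 0 (by omega)
    have hn := hne 0 (by omega)
    simp only [Function.iterate_zero, id_eq] at hx hn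
    obtain ⟨t, h1, h2⟩ := hc x
    obtain ⟨u, h3, h4⟩ := hs x
    obtain ⟨v, h5, h6⟩ := ih (S x) (fun j hj => by
        simpa only [Function.iterate_succ_apply] using hB (j + 1) (by omega))
      (fun j hj => by simpa only [Function.iterate_succ_apply] using hne (j + 1) (by omega))
      (by simpa only [Function.iterate_succ_apply] using h0)
    obtain ⟨a, b, hab⟩ : ∃ a b, C x = .cons a b := by
      cases h' : C x with
      | nil => exact absurd h' hn
      | cons a b => exact ⟨a, b, rfl⟩
    rw [hab] at h1
    rw [Function.iterate_succ_apply]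
    refine ⟨_, .loop_step h1 h3 h5, ?_⟩
    have h7 := h2.trans (Nat.pow_le_pow_left hx m)
    have h8 := h4.trans (Nat.pow_le_pow_left hx l)
    rw [Nat.add_mul (N + 1)]
    omega

theorem loop_time_le {N B : ℕ} (hB : 2 ≤ B) (hN : N + 1 ≤ B) (m l : ℕ) :
    (N + 1) * (B ^ m + B ^ l + B) ≤ B ^ (m + l + 1 + 2 + 1) := by
  have := pow_add_three_le hB m l 1
  rw [pow_one] at this
  rw [pow_succ, Nat.mul_comm (B ^ _)]
  exact Nat.mul_le_mul hN this

/-- A loop whose body `S` does nothing once the condition `C` is `nil` computes any sufficiently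
high iterate of `S`. -/
theorem PT.iterate {S C F : Data → Data} (hS : PT S) (hC : PT C) (idle : ∀ x, C x = .nil → S x = x)
    (k : ℕ) (h : ∀ x, ∃ M ≤ (x.size + 1) ^ k, C (S^[M] x) = .nil ∧ F x = S^[M] x ∧
      ∀ j ≤ M, (S^[j] x).size ≤ (x.size + 1) ^ k) : PT F := by
  obtain ⟨c, m, hc⟩ := hC
  obtain ⟨s, l, hs⟩ := hS
  refine ⟨.loop c s, (k + 1) * (m + l + 1 + 2 + 1), fun x => ?_⟩
  obtain ⟨M, hM, h0, hF, hb⟩ := h x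
  have hex : ∃ N, C (S^[N] x) = .nil := ⟨M, h0⟩
  classical
  let N := Nat.find hex
  have hNM : N ≤ M := Nat.find_min' hex h0
  have hN : C (S^[N] x) = .nil := Nat.find_spec hex
  have heq : S^[M] x = S^[N] x := by
    obtain ⟨d, rfl⟩ := Nat.exists_eq_add_of_le hNM
    rw [Nat.add_comm, Function.iterate_add_apply]
    exact Function.iterate_fixed (idle _ hN) d
  have ha := two_le_size_add_one x
  obtain ⟨t, h1, h2⟩ := Prog.Runs.loop_of_iterate (B := (x.size + 1) ^ (k + 1)) hc hs N x
    (fun j hj => add_one_le_pow_succ ha (hb j (hj.trans hNM)))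
    (fun j hj => Nat.find_min hex hj) hN
  rw [hF, heq]
  refine ⟨t, h1, h2.trans ?_⟩
  rw [pow_mul]
  refine loop_time_le ?_ (add_one_le_pow_succ ha (hNM.trans hM)) m l
  calc 2 ≤ x.size + 1 := ha
    _ = (x.size + 1) ^ 1 := (pow_one _).symm
    _ ≤ _ := Nat.pow_le_pow_right (by omega) (by omega)

/-- A program for left folds. The bound `B` on the sizes of the partial results need not be
polynomial in the size of the input. -/
theorem foldl_runs {g : Data → Data → Data → Data} (hg : PT fun y => g y.hd y.tl.hd y.tl.tl) :
    ∃ p k, ∀ x l a B, (∀ j, ((l.toList.take j).foldl (fun a e => g x e a) a).size ≤ B) →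
      ∃ t, Prog.Runs p (.cons x (.cons l a)) (l.toList.foldl (fun a e => g x e a) a) t ∧
        t ≤ (x.size + l.size + B + 3) ^ k := by
  -- The state of the loop consists of the input, the rest of the list, and the accumulator.
  let S : Data → Data := fun y =>
    .cons y.hd (.cons y.tl.hd.tl (g y.hd y.tl.hd.hd y.tl.tl))
  have hS : PT S := by
    refine .pair (.hd .id) (.pair (.tl (.hd (.tl .id))) ?_)
    exact PT.comp hg (.pair (.hd .id) (.pair (.hd (.hd (.tl .id))) (.tl (.tl .id))))
  have hC : PT fun y => y.tl.hd := .hd (.tl .id)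
  have hE : PT fun y => y.tl.tl := .tl (.tl .id)
  obtain ⟨c, m, hc⟩ := hC
  obtain ⟨s, r, hs⟩ := hS
  obtain ⟨e, q, he⟩ := hE
  refine ⟨.seq (.loop c s) e, (m + r + 1 + 2 + 1) + q + 0 + 2, fun x l a B hB => ?_⟩
  have hit : ∀ (j : ℕ) (l a : Data), S^[j] (.cons x (.cons l a)) =
      .cons x (.cons (listCode (l.toList.drop j))
        ((l.toList.take j).foldl (fun a e => g x e a) a)) ∨ l.toList.length < j := by
    intro j
    induction j with
    | zero => intro l a; left; simp
    | succ j ih =>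
      intro l a
      cases l with
      | nil => right; simp
      | cons b l =>
        rcases ih l (g x b a) with h | h
        · left
          rw [Function.iterate_succ_apply]
          exact h
        · right; simpa using h
  have hit' : ∀ j ≤ l.toList.length, S^[j] (.cons x (.cons l a)) =
      .cons x (.cons (listCode (l.toList.drop j))
        ((l.toList.take j).foldl (fun a e => g x e a) a)) := fun j hj =>
    (hit j l a).resolve_right (by omega)
  have hdrop : ∀ j, (listCode (l.toList.drop j)).size ≤ l.size := by
    intro j
    have := size_listCode_append (l.toList.take j) (l.toList.drop j)
    rw [List.take_append_drop, listCode_toList] at this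
    have := (listCode (l.toList.take j)).size_pos
    omega
  set M := x.size + l.size + B + 3 with hM
  have h2M : 2 ≤ M := by omega
  obtain ⟨t, h1, h2⟩ := Prog.Runs.loop_of_iterate (B := M) hc hs l.toList.length
    (.cons x (.cons l a))
    (fun j hj => by
      rw [hit' j hj]
      have := hdrop j
      have := hB j
      simp only [size_cons]; omega)
    (fun j hj => by
      rw [hit' j hj.le]
      have : (l.toList.drop j) ≠ [] := by simpa using hj
      obtain ⟨b, l', h'⟩ := List.exists_cons_of_ne_nil this
      simp [h', listCode])
    (by rw [hit' _ le_rfl]; simp [listCode])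
  obtain ⟨u, h3, h4⟩ := he (S^[l.toList.length] (.cons x (.cons l a)))
  have hfin : (S^[l.toList.length] (.cons x (.cons l a))).size + 1 ≤ M := by
    rw [hit' _ le_rfl]
    have := hdrop l.toList.length
    have := hB l.toList.length
    simp only [size_cons]; omega
  have h5 := h4.trans (Nat.pow_le_pow_left hfin q)
  have h6 := h2.trans (loop_time_le h2M (by have := l.length_toList_lt; omega) m r)
  refine ⟨t + u + 1, ?_, ?_⟩
  · have h7 := Prog.Runs.seq h1 h3
    rwa [hit' _ le_rfl, List.take_length] at h7
  · have := pow_add_three_le h2M (m + r + 1 + 2 + 1) q 0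
    simp only [pow_zero] at this
    omega

namespace PT

/-- A fold over a list whose partial results stay of polynomial size. In `g x e a` the tree `x` is
the input, `e` the list element and `a` the accumulator. A program for `g` takes them as the single
tree `cons x (cons e a)`; the same convention, without the accumulator, holds for the functions and
predicates of list elements below. -/
theorem foldl {L I : Data → Data} {g : Data → Data → Data → Data} (hL : PT L) (hI : PT I)
    (hg : PT fun y => g y.hd y.tl.hd y.tl.tl)
    (hb : ∃ k, ∀ x j, (((L x).toList.take j).foldl (fun a e => g x e a) (I x)).size ≤
      (x.size + 1) ^ k) :
    PT fun x => (L x).toList.foldl (fun a e => g x e a) (I x) := by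
  obtain ⟨k, hb⟩ := hb
  obtain ⟨p, m, hp⟩ := foldl_runs hg
  obtain ⟨q, l, hq⟩ := pair id (pair hL hI)
  obtain ⟨r, hr⟩ := hL.size_le
  refine ⟨.seq q p, l + ((1 + r + k + 2 + 2) * m) + 0 + 2, fun x => ?_⟩
  obtain ⟨s, h1, h2⟩ := hq x
  obtain ⟨t, h3, h4⟩ := hp x (L x) (I x) _ (hb x)
  refine ⟨_, .seq h1 h3, ?_⟩
  have ha := two_le_size_add_one x
  have h5 := pow_add_three_le ha 1 r k
  have h6 : x.size + (L x).size + (x.size + 1) ^ k + 3 ≤ (x.size + 1) ^ (1 + r + k + 2 + 2) := by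
    have h7 := hr x
    rw [pow_add _ _ 2]
    have : 4 ≤ (x.size + 1) ^ 2 := by nlinarith
    have : 1 ≤ (x.size + 1) ^ (1 + r + k + 2) := Nat.one_le_pow _ _ (by omega)
    rw [pow_one] at h5
    nlinarith
  have h8 := h4.trans (Nat.pow_le_pow_left h6 m)
  rw [← pow_mul] at h8
  have := pow_add_three_le ha l ((1 + r + k + 2 + 2) * m) 0
  simp only [pow_zero] at this
  omega

/-- A fold whose accumulator grows at each step by an amount that is polynomial in the sizes of
the context and of the list element. -/
theorem foldl_of_growth {L I : Data → Data} {g : Data → Data → Data → Data} (hL : PT L) (hI : PT I)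
    (hg : PT fun y => g y.hd y.tl.hd y.tl.tl)
    (hb : ∃ k, ∀ x, ∀ e ∈ (L x).toList, ∀ a, (g x e a).size ≤ a.size + (x.size + 1) ^ k) :
    PT fun x => (L x).toList.foldl (fun a e => g x e a) (I x) := by
  refine foldl hL hI hg ?_
  obtain ⟨k, hb⟩ := hb
  obtain ⟨r, hr⟩ := hL.size_le
  obtain ⟨m, hm⟩ := hI.size_le
  refine ⟨m + (r + k) + 0 + 2, fun x j => ?_⟩
  have key : ∀ (l : List Data) (a : Data), (∀ e ∈ l, e ∈ (L x).toList) →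
      (l.foldl (fun a e => g x e a) a).size ≤ a.size + l.length * (x.size + 1) ^ k := by
    intro l
    induction l with
    | nil => simp
    | cons e l ih =>
      intro a h
      have h1 := ih (g x e a) fun e he => h e (by simp [he])
      have h2 := hb x e (h e (by simp)) a
      simp only [List.foldl_cons, List.length_cons, Nat.add_mul, one_mul]
      omega
  have h1 := key ((L x).toList.take j) (I x) fun e he => List.mem_of_mem_take he
  have h2 : ((L x).toList.take j).length ≤ (x.size + 1) ^ r :=
    (List.length_take_le' ..).trans ((L x).length_toList_lt.le.trans (hr x))
  have h3 := Nat.mul_le_mul_right ((x.size + 1) ^ k) h2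
  rw [← pow_add] at h3
  have := pow_add_three_le (two_le_size_add_one x) m (r + k) 0
  have := hm x
  omega

end PT

/-! ### Polynomial-time predicates -/

open Classical in
/-- The truth value of a proposition, as a tree. -/
noncomputable def ofProp (p : Prop) : Data := if p then .cons .nil .nil else .nil

theorem ofProp_eq_nil {p : Prop} : ofProp p = .nil ↔ ¬ p := by
  unfold ofProp; split_ifs <;> simp_all

/-- The predicates on trees decided by programs in polynomial time. -/
def PTP (c : Data → Prop) : Prop := PT fun x => ofProp (c x)

namespace PTP

theorem ite {c : Data → Prop} [∀ x, Decidable (c x)] {F G : Data → Data} (hc : PTP c) (hF : PT F)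
    (hG : PT G) : PT fun x => if c x then F x else G x := by
  have := PT.ite_nil hc hG hF
  convert this using 2 with x
  by_cases h : c x <;> simp [h, ofProp_eq_nil]

theorem of_iff {c d : Data → Prop} (hc : PTP c) (h : ∀ x, d x ↔ c x) : PTP d := by
  have : d = c := by funext x; exact propext (h x)
  rwa [this]

theorem not {c : Data → Prop} (hc : PTP c) : PTP fun x => ¬ c x := by
  classical
  have := ite hc (PT.const .nil) (PT.const (.cons .nil .nil))
  unfold PTP
  convert this using 2 with x
  unfold ofProp
  by_cases h : c x <;> simp [h]

theorem and {c d : Data → Prop} (hc : PTP c) (hd : PTP d) : PTP fun x => c x ∧ d x := by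
  classical
  have := ite hc hd (PT.const .nil)
  unfold PTP
  convert this using 2 with x
  unfold ofProp
  by_cases h : c x <;> simp [h]

theorem or {c d : Data → Prop} (hc : PTP c) (hd : PTP d) : PTP fun x => c x ∨ d x :=
  of_iff (not (and (not hc) (not hd))) fun x => by tauto

theorem imp {c d : Data → Prop} (hc : PTP c) (hd : PTP d) : PTP fun x => c x → d x :=
  of_iff (or (not hc) hd) fun x => by tauto

theorem iff {c d : Data → Prop} (hc : PTP c) (hd : PTP d) : PTP fun x => (c x ↔ d x) :=
  of_iff (and (imp hc hd) (imp hd hc)) fun x => by tauto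

theorem eq_nil {F : Data → Data} (hF : PT F) : PTP fun x => F x = .nil := by
  classical
  have := PT.ite_nil hF (PT.const (.cons .nil .nil)) (PT.const .nil)
  unfold PTP
  convert this using 2 with x
  unfold ofProp
  split_ifs <;> rfl

end PTP

open Classical in
/-- One step of the comparison of two trees. The list of the pairs of subtrees still to be compared
is the right subtree of `y`. The left subtree is the answer: it becomes `nil`, together with the
list, once a difference is found. -/
noncomputable def eqStep (y : Data) : Data :=
  if y.tl = .nil then y else
  if y.tl.hd.hd = .nil then
    (if y.tl.hd.tl = .nil then .cons y.hd y.tl.tl else .nil)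
  else
    (if y.tl.hd.tl = .nil then .nil else
      .cons y.hd (.cons (.cons y.tl.hd.hd.hd y.tl.hd.tl.hd)
        (.cons (.cons y.tl.hd.hd.tl y.tl.hd.tl.tl) y.tl.tl)))

theorem eqStep_size_le (y : Data) : (eqStep y).size ≤ y.size := by
  rcases y with _ | ⟨f, _ | ⟨_ | ⟨_ | ⟨a, b⟩, _ | ⟨c, d⟩⟩, w⟩⟩ <;> simp [eqStep] <;> omega

/-- After enough steps no pair is left to be compared, and the answer `f` is kept exactly if all
pairs `w` were equal. The total size of the first components bounds the number of steps. -/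
theorem eqStep_iterate (w : List (Data × Data)) : ∀ (n : ℕ) (f : Data),
    (w.map fun p => p.1.size).sum ≤ n →
    (eqStep^[n] (.cons f (listCode (w.map fun p => .cons p.1 p.2)))).tl = .nil ∧
      ((∀ p ∈ w, p.1 = p.2) →
        (eqStep^[n] (.cons f (listCode (w.map fun p => .cons p.1 p.2)))).hd = f) ∧
      ((¬ ∀ p ∈ w, p.1 = p.2) →
        (eqStep^[n] (.cons f (listCode (w.map fun p => .cons p.1 p.2)))).hd = .nil) := by
  intro n
  induction n generalizing w with
  | zero =>
    intro f h
    rcases w with _ | ⟨⟨a, b⟩, w⟩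
    · simp [listCode]
    · have := a.size_pos
      simp at h; omega
  | succ n ih =>
    intro f h
    have hfix : ∀ n, eqStep^[n] .nil = .nil := fun n =>
      Function.iterate_fixed (by simp [eqStep]) n
    rw [Function.iterate_succ_apply]
    rcases w with _ | ⟨⟨_ | ⟨a, a'⟩, _ | ⟨b, b'⟩⟩, w⟩
    · have : eqStep (.cons f (listCode (([] : List (Data × Data)).map fun p => .cons p.1 p.2))) =
        (.cons f (listCode (([] : List (Data × Data)).map fun p => .cons p.1 p.2))) := by
        simp [eqStep, listCode]
      rw [this]
      exact ih [] f (by simp)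
    · have := ih w f (by simp at h; omega)
      simpa [eqStep, listCode] using this
    · simp [eqStep, listCode, hfix]
    · simp [eqStep, listCode, hfix]
    · have := ih ((a, b) :: (a', b') :: w) f (by simp at h ⊢; omega)
      simpa [eqStep, listCode, and_assoc] using this

theorem PT.eqStep : PT eqStep := by
  classical
  unfold ECNTL.eqStep
  refine PT.ite_nil (.tl .id) .id (PT.ite_nil (.hd (.hd (.tl .id)))
    (PT.ite_nil (.tl (.hd (.tl .id))) (.pair (.hd .id) (.tl (.tl .id))) .nil)
    (PT.ite_nil (.tl (.hd (.tl .id))) .nil (.pair (.hd .id) (.pair (.pair ?_ ?_)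
      (.pair (.pair ?_ ?_) (.tl (.tl .id)))))))
  · exact .hd (.hd (.hd (.tl .id)))
  · exact .hd (.tl (.hd (.tl .id)))
  · exact .tl (.hd (.hd (.tl .id)))
  · exact .tl (.tl (.hd (.tl .id)))

/-- Equality of trees is decidable in polynomial time. -/
theorem PTP.eq {F G : Data → Data} (hF : PT F) (hG : PT G) : PTP fun x => F x = G x := by
  classical
  have h1 : PT fun y => eqStep^[y.size] y := by
    have idle : ∀ x, x.tl = .nil → ECNTL.eqStep x = x := by
      intro x hx; simp [ECNTL.eqStep, hx]
    refine PT.iterate PT.eqStep (PT.tl .id) idle 1 fun x => ?_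
    have hsz : ∀ j, (ECNTL.eqStep^[j] x).size ≤ x.size := by
      intro j
      induction j with
      | zero => simp
      | succ j ih =>
        rw [Function.iterate_succ_apply']
        exact (eqStep_size_le _).trans ih
    refine ⟨x.size, by simp, ?_, rfl, fun j _ => by have := hsz j; simp; omega⟩
    -- the number of nodes of the left components of the work list decreases
    have hdec : ∀ (n : ℕ) (y : Data), (y.tl.toList.map fun e => e.hd.size).sum ≤ n →
        (ECNTL.eqStep^[n] y).tl = .nil := by
      intro n
      induction n with
      | zero =>
        intro y h
        rcases y with _ | ⟨f, _ | ⟨e, w⟩⟩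
        · simp
        · simp
        · have := e.hd.size_pos
          simp at h; omega
      | succ n ih =>
        intro y h
        rw [Function.iterate_succ_apply]
        apply ih
        rcases y with _ | ⟨f, _ | ⟨_ | ⟨_ | ⟨a, b⟩, _ | ⟨c, d⟩⟩, w⟩⟩ <;>
          simp [ECNTL.eqStep] at h ⊢ <;> omega
    apply hdec
    calc (x.tl.toList.map fun e => e.hd.size).sum
        ≤ (x.tl.toList.map fun e => e.size + 1).sum :=
          List.sum_le_sum fun e _ => (hd_size_le e).trans (by omega)
      _ ≤ x.tl.size := by rw [size_eq_sum]; omega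
      _ ≤ x.size := tl_size_le x
  have h2 := PT.hd (PT.comp h1 (PT.pair (PT.const (.cons .nil .nil))
    (PT.pair (PT.pair hF hG) PT.nil)))
  unfold PTP
  convert h2 using 2 with x
  have := (eqStep_iterate [(F x, G x)]
    (Data.cons (.cons .nil .nil) (.cons (.cons (F x) (G x)) .nil)).size (.cons .nil .nil)
    (by simp; omega)).2
  simp only [List.map_cons, List.map_nil, listCode, List.mem_singleton, forall_eq] at this
  by_cases h : F x = G x
  · rw [this.1 h]; simp [ofProp, h]
  · rw [this.2 h]; simp [ofProp, h]

/-- Bounded quantification over the elements of a list. -/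
theorem PTP.ball {L : Data → Data} {c : Data → Data → Prop} (hL : PT L)
    (hc : PTP fun y => c y.hd y.tl) : PTP fun x => ∀ e ∈ (L x).toList, c x e := by
  classical
  have h := PT.foldl (g := fun x e a => if c x e then a else .nil) hL
    (PT.const (.cons .nil .nil)) (by
      refine PTP.ite ?_ (.tl (.tl .id)) .nil
      exact PT.comp hc (.pair (.hd .id) (.hd (.tl .id)))) ⟨2, fun x j => by
        have : ∀ (l : List Data) (a : Data), a.size ≤ 3 →
            (l.foldl (fun a e => if c x e then a else .nil) a).size ≤ 3 := by
          intro l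
          induction l with
          | nil => simp
          | cons e l ih =>
            intro a ha
            refine ih _ ?_
            by_cases h : c x e <;> simp [h, ha]
        refine (this _ _ (by simp)).trans ?_
        have := two_le_size_add_one x
        nlinarith⟩
  unfold PTP
  convert h using 2 with x
  have : ∀ (l : List Data) (a : Data), l.foldl (fun a e => if c x e then a else .nil) a =
      if ∀ e ∈ l, c x e then a else .nil := by
    intro l
    induction l with
    | nil => simp
    | cons e l ih =>
      intro a
      rw [List.foldl_cons, ih]
      by_cases h1 : c x e <;> simp [h1]
  rw [this]
  unfold ofProp
  split_ifs <;> rfl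

theorem PTP.bex {L : Data → Data} {c : Data → Data → Prop} (hL : PT L)
    (hc : PTP fun y => c y.hd y.tl) : PTP fun x => ∃ e ∈ (L x).toList, c x e :=
  of_iff (not (ball (c := fun x e => ¬ c x e) hL (not hc))) fun x => by push Not; rfl

theorem PTP.mem {F L : Data → Data} (hF : PT F) (hL : PT L) : PTP fun x => F x ∈ (L x).toList :=
  of_iff (bex hL (c := fun x e => F x = e) (eq (PT.comp hF (PT.hd .id)) (PT.tl .id)))
    fun x => by simp

/-! ### Lists as trees -/

theorem PT.reverse {L : Data → Data} (hL : PT L) : PT fun x => listCode (L x).toList.reverse := by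
  have h := PT.foldl_of_growth (g := fun _ e a => .cons e a) hL PT.nil
    (.pair (.hd (.tl .id)) (.tl (.tl .id))) (by
      obtain ⟨r, hr⟩ := hL.size_le
      refine ⟨r + 1, fun x e he a => ?_⟩
      have := size_of_mem he
      have := add_one_le_pow_succ (two_le_size_add_one x) (hr x)
      simp only [size_cons]
      omega)
  convert h using 2 with x
  have : ∀ (l : List Data) (a : Data),
      l.foldl (fun a e => Data.cons e a) a = listCode (l.reverse ++ a.toList) := by
    intro l
    induction l with
    | nil => simp
    | cons e l ih => intro a; simp [ih]
  simp [this]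

theorem PT.append {L M : Data → Data} (hL : PT L) (hM : PT M) :
    PT fun x => listCode ((L x).toList ++ (M x).toList) := by
  have h := PT.foldl_of_growth (g := fun _ e a => .cons e a) hL.reverse hM
    (.pair (.hd (.tl .id)) (.tl (.tl .id))) (by
      obtain ⟨r, hr⟩ := hL.reverse.size_le
      refine ⟨r + 1, fun x e he a => ?_⟩
      have := size_of_mem he
      have := add_one_le_pow_succ (two_le_size_add_one x) (hr x)
      simp only [size_cons]
      omega)
  convert h using 2 with x
  have : ∀ (l : List Data) (a : Data),
      l.foldl (fun a e => Data.cons e a) a = listCode (l.reverse ++ a.toList) := by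
    intro l
    induction l with
    | nil => simp
    | cons e l ih => intro a; simp [ih]
  simp [this]

/-- The concatenation of the lists `f e`, for `e` in the list `l`. -/
def Data.flatMap (l : Data) (f : Data → Data) : Data :=
  listCode (l.toList.flatMap fun e => (f e).toList)

@[simp] theorem Data.toList_flatMap (l : Data) (f : Data → Data) :
    (l.flatMap f).toList = l.toList.flatMap fun e => (f e).toList := by
  simp [Data.flatMap]

theorem PT.flatMap {L : Data → Data} {f : Data → Data → Data} (hL : PT L)
    (hf : PT fun y => f y.hd y.tl) : PT fun x => (L x).flatMap (f x) := by
  have hf' : PT fun y => f y.hd y.tl.hd := PT.comp hf (.pair (.hd .id) (.hd (.tl .id)))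
  have h := PT.foldl_of_growth
    (g := fun x e a => listCode ((f x e).toList ++ a.toList)) hL.reverse PT.nil
    (PT.append hf' (.tl (.tl .id))) (by
      obtain ⟨r, hr⟩ := hL.reverse.size_le
      obtain ⟨k, hk⟩ := hf.size_le
      refine ⟨(1 + r + 0 + 2) * k, fun x e he a => ?_⟩
      have h1 := size_listCode_append (f x e).toList a.toList
      simp only [listCode_toList] at h1
      have h2 := hk (.cons x e)
      simp only [hd_cons, tl_cons, size_cons] at h2
      have h3 : x.size + e.size + 1 + 1 ≤ (x.size + 1) ^ (1 + r + 0 + 2) := by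
        have := pow_add_three_le (two_le_size_add_one x) 1 r 0
        have := size_of_mem he
        have := hr x
        simp only [pow_one, pow_zero] at *
        omega
      have h4 := h2.trans (Nat.pow_le_pow_left h3 k)
      rw [← pow_mul] at h4
      omega)
  convert h using 2 with x
  have : ∀ (l : List Data) (a : Data),
      l.foldl (fun a e => listCode ((f x e).toList ++ a.toList)) a =
        listCode ((l.reverse.flatMap fun e => (f x e).toList) ++ a.toList) := by
    intro l
    induction l with
    | nil => simp
    | cons e l ih => intro a; simp [ih]
  simp [this, Data.flatMap]

/-- The list of the values of `f` on the list `l`. -/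
def Data.map (l : Data) (f : Data → Data) : Data := listCode (l.toList.map f)

@[simp] theorem Data.toList_map (l : Data) (f : Data → Data) :
    (l.map f).toList = l.toList.map f := by
  simp [Data.map]

theorem PT.map {L : Data → Data} {f : Data → Data → Data} (hL : PT L)
    (hf : PT fun y => f y.hd y.tl) : PT fun x => (L x).map (f x) := by
  have h := PT.flatMap (f := fun x e => .cons (f x e) .nil) hL (.pair hf .nil)
  convert h using 2 with x
  simp [Data.map, Data.flatMap, List.map_eq_flatMap]

open Classical in
/-- The list of the elements of `l` with the property `c`. -/
noncomputable def Data.filter (l : Data) (c : Data → Prop) : Data :=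
  listCode (l.toList.filter fun e => decide (c e))

@[simp] theorem Data.mem_filter {l : Data} {c : Data → Prop} {e : Data} :
    e ∈ (l.filter c).toList ↔ e ∈ l.toList ∧ c e := by
  simp [Data.filter]

theorem PT.filter {L : Data → Data} {c : Data → Data → Prop} (hL : PT L)
    (hc : PTP fun y => c y.hd y.tl) : PT fun x => (L x).filter (c x) := by
  classical
  have h := PT.flatMap (f := fun x e => if c x e then .cons e .nil else .nil) hL
    (PTP.ite hc (.pair (.tl .id) .nil) .nil)
  convert h using 2 with x
  simp only [Data.filter, Data.flatMap]
  congr 1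
  induction (L x).toList with
  | nil => rfl
  | cons e l ih => by_cases h1 : c x e <;> simp [h1, ih]

open Classical in
/-- The elements of a list without repetitions. -/
noncomputable def Data.dedup (l : Data) : Data :=
  l.toList.foldl (fun a e => if e ∈ a.toList then a else .cons e a) .nil

theorem PT.dedup {L : Data → Data} (hL : PT L) : PT fun x => (L x).dedup := by
  classical
  refine PT.foldl_of_growth (g := fun _ e a => if e ∈ a.toList then a else .cons e a) hL PT.nil
    (PTP.ite (PTP.mem (.hd (.tl .id)) (.tl (.tl .id))) (.tl (.tl .id))
      (.pair (.hd (.tl .id)) (.tl (.tl .id)))) ?_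
  obtain ⟨r, hr⟩ := hL.size_le
  refine ⟨r + 1, fun x e he a => ?_⟩
  have := size_of_mem he
  have := add_one_le_pow_succ (two_le_size_add_one x) (hr x)
  split_ifs
  · omega
  · simp only [size_cons]
    omega

theorem Data.dedup_spec (l : Data) :
    l.dedup.toList.Nodup ∧ ∀ e, e ∈ l.dedup.toList ↔ e ∈ l.toList := by
  classical
  have : ∀ (l : List Data) (a : Data), a.toList.Nodup →
      (l.foldl (fun a e => if e ∈ a.toList then a else Data.cons e a) a).toList.Nodup ∧
      ∀ e, e ∈ (l.foldl (fun a e => if e ∈ a.toList then a else Data.cons e a) a).toList ↔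
        e ∈ l ∨ e ∈ a.toList := by
    intro l
    induction l with
    | nil => intro a ha; simpa using ha
    | cons b l ih =>
      intro a ha
      by_cases hb : b ∈ a.toList
      · obtain ⟨h1, h2⟩ := ih a ha
        simp only [List.foldl_cons, hb, if_true]
        refine ⟨h1, fun e => ?_⟩
        rw [h2]
        constructor
        · rintro (h | h) <;> simp [h]
        · rintro (h | h)
          · rcases List.mem_cons.1 h with rfl | h
            · exact Or.inr hb
            · exact Or.inl h
          · exact Or.inr h
      · obtain ⟨h1, h2⟩ := ih (.cons b a) (by simp [hb, ha])
        simp only [List.foldl_cons, hb, if_false]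
        refine ⟨h1, fun e => ?_⟩
        rw [h2]
        simp only [toList_cons, List.mem_cons]
        tauto
  have h := this l.toList .nil (by simp)
  exact ⟨h.1, fun e => (h.2 e).trans (by simp)⟩

/-! ### The list of all sublists -/

/-- The sublists of a list, doubling their number with each element. -/
def Data.pow (l : Data) : Data :=
  l.toList.foldl (fun a e => listCode (a.toList ++ (a.map (.cons e)).toList)) (.cons .nil .nil)

/-- The fold that defines `Data.pow`, for an arbitrary accumulator `a`: the lists obtained extend
members of `a` by elements of `l`; every choice of elements of `l` is realized; the number of lists
doubles with each element of `l`; and the lists grow by at most the size of `l`. -/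
theorem pow_foldl (l : List Data) : ∀ a : Data,
    (∀ s ∈ (l.foldl (fun a e => listCode (a.toList ++ (a.map (.cons e)).toList)) a).toList,
      ∃ s₀ ∈ a.toList, ∀ e ∈ s.toList, e ∈ l ∨ e ∈ s₀.toList) ∧
    (∀ q : Data → Prop, ∀ s₀ ∈ a.toList, ∃ s ∈ (l.foldl
      (fun a e => listCode (a.toList ++ (a.map (.cons e)).toList)) a).toList,
      ∀ e, e ∈ s.toList ↔ (e ∈ l ∧ q e) ∨ e ∈ s₀.toList) ∧
    (l.foldl (fun a e => listCode (a.toList ++ (a.map (.cons e)).toList)) a).toList.length =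
      2 ^ l.length * a.toList.length ∧
    (∀ B, (∀ s ∈ a.toList, s.size ≤ B) → ∀ s ∈ (l.foldl
      (fun a e => listCode (a.toList ++ (a.map (.cons e)).toList)) a).toList,
      s.size ≤ B + (listCode l).size) := by
  classical
  induction l with
  | nil =>
    intro a
    refine ⟨fun s hs => ⟨s, hs, fun e he => Or.inr he⟩, fun q s hs => ⟨s, hs, by simp⟩, by simp,
      fun B h s hs => (h s hs).trans (by omega)⟩
  | cons b l ih =>
    intro a
    obtain ⟨h1, h2, h3, h4⟩ := ih (listCode (a.toList ++ (a.map (.cons b)).toList))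
    simp only [List.foldl_cons]
    refine ⟨fun s hs => ?_, fun q s₀ hs₀ => ?_, ?_, fun B hB s hs => ?_⟩
    · obtain ⟨s₁, hs₁, h⟩ := h1 s hs
      simp only [toList_listCode, List.mem_append, toList_map, List.mem_map] at hs₁
      rcases hs₁ with hs₁ | ⟨s₂, hs₂, rfl⟩
      · exact ⟨s₁, hs₁, fun e he => (h e he).imp (fun h => by simp [h]) fun h => h⟩
      · refine ⟨s₂, hs₂, fun e he => ?_⟩
        rcases h e he with h | h
        · simp [h]
        · rcases List.mem_cons.1 h with rfl | h
          · simp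
          · exact Or.inr h
    · by_cases hq : q b
      · obtain ⟨s, hs, h⟩ := h2 q (.cons b s₀) (by simpa using Or.inr hs₀)
        refine ⟨s, hs, fun e => (h e).trans ?_⟩
        simp only [toList_cons, List.mem_cons]
        have : e = b → q e := fun h => h ▸ hq
        tauto
      · obtain ⟨s, hs, h⟩ := h2 q s₀ (by simpa using Or.inl hs₀)
        refine ⟨s, hs, fun e => (h e).trans ?_⟩
        simp only [List.mem_cons]
        have : q e → e ≠ b := fun h h' => hq (h' ▸ h)
        tauto
    · rw [h3]
      simp only [toList_listCode, List.length_append, toList_map, List.length_map,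
        List.length_cons, pow_succ]
      ring
    · have := h4 (B + b.size + 1) (by
        intro s hs
        simp only [toList_listCode, List.mem_append, toList_map, List.mem_map] at hs
        rcases hs with hs | ⟨s₂, hs₂, rfl⟩
        · have := hB s hs; omega
        · have := hB s₂ hs₂; simp only [size_cons]; omega) s hs
      simp only [listCode, size_cons]
      omega

namespace Data

theorem subset_of_mem_pow {l s : Data} (hs : s ∈ l.pow.toList) : ∀ e ∈ s.toList, e ∈ l.toList := by
  obtain ⟨s₀, h0, h⟩ := (pow_foldl l.toList (.cons .nil .nil)).1 s hs
  intro e he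
  simp only [toList_cons, toList_nil, List.mem_singleton] at h0
  simpa [h0] using h e he

/-- Every subset of the elements of a list is the set of elements of some sublist. -/
theorem exists_mem_pow (l : Data) (q : Data → Prop) :
    ∃ s ∈ l.pow.toList, ∀ e, e ∈ s.toList ↔ e ∈ l.toList ∧ q e := by
  obtain ⟨s, hs, h⟩ := (pow_foldl l.toList (.cons .nil .nil)).2.1 q .nil (by simp)
  exact ⟨s, hs, by simpa using h⟩

theorem length_pow (l : Data) : l.pow.toList.length = 2 ^ l.toList.length := by
  have := (pow_foldl l.toList (.cons .nil .nil)).2.2.1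
  rwa [toList_cons, toList_nil, List.length_singleton, mul_one] at this

end Data

/-- The list of all sublists is computed in time polynomial in the size of the list and
in the number of its sublists. -/
theorem pow_runs : ∃ p k, ∀ l : Data, ∃ t, Prog.Runs p l l.pow t ∧
    t ≤ (2 ^ l.toList.length * (l.size + 5)) ^ k := by
  have hg : PT fun y => (fun _ e a => listCode (a.toList ++ (a.map (.cons e)).toList) :
      Data → Data → Data → Data) y.hd y.tl.hd y.tl.tl :=
    PT.append (.tl (.tl .id)) (PT.map (f := fun y e => .cons y.tl.hd e) (.tl (.tl .id))
      (.pair (.hd (.tl (.hd .id))) (.tl .id)))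
  obtain ⟨p, k, hp⟩ := foldl_runs
    (g := fun _ e a => listCode (a.toList ++ (a.map (.cons e)).toList)) hg
  obtain ⟨q, m, hq⟩ := PT.pair .nil (PT.pair .id (PT.const (.cons .nil .nil)))
  refine ⟨.seq q p, m + 3 * k + 0 + 2, fun l => ?_⟩
  obtain ⟨s, h1, h2⟩ := hq l
  set W := 2 ^ l.toList.length * (l.size + 5) with hW
  have hpos : 1 ≤ 2 ^ l.toList.length := Nat.one_le_two_pow
  have hlW : l.size + 5 ≤ W := by rw [hW]; nlinarith
  obtain ⟨t, h3, h4⟩ := hp .nil l (.cons .nil .nil) (W + 1) (fun j => by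
    obtain ⟨-, -, ha, hb⟩ := pow_foldl (l.toList.take j) (.cons .nil .nil)
    have hb' := hb 1 (by simp)
    have htake : (listCode (l.toList.take j)).size ≤ l.size := by
      have := size_listCode_append (l.toList.take j) (l.toList.drop j)
      rw [List.take_append_drop, listCode_toList] at this
      have := (listCode (l.toList.drop j)).size_pos
      omega
    have hlen : 2 ^ (l.toList.take j).length ≤ 2 ^ l.toList.length :=
      Nat.pow_le_pow_right (by omega) (List.length_take_le' ..)
    rw [← listCode_toList (List.foldl _ _ _)]
    refine (size_listCode_le_of_mem (B := l.size + 1) fun e he => (hb' e he).trans (by omega)).trans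
      ?_
    rw [ha]
    simp only [toList_cons, toList_nil, List.length_cons, List.length_nil, zero_add, mul_one]
    have := Nat.mul_le_mul hlen (show l.size + 1 + 1 ≤ l.size + 5 by omega)
    omega)
  refine ⟨_, .seq h1 h3, ?_⟩
  have h5 := h2.trans (Nat.pow_le_pow_left (show l.size + 1 ≤ W by omega) m)
  have h6 : (Data.nil.size + l.size + (W + 1) + 3) ≤ W ^ 3 := by
    have : 6 ≤ W := by have := l.size_pos; omega
    have h36 : 36 ≤ W ^ 2 := by nlinarith
    rw [pow_succ]
    simp only [size_nil]
    nlinarith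
  have h7 := h4.trans (Nat.pow_le_pow_left h6 k)
  rw [← pow_mul] at h7
  have := pow_add_three_le (show 2 ≤ W by omega) m (3 * k) 0
  simp only [pow_zero] at this
  omega

end ECNTL
namespace ECNTL
open RecProps

/-! ### The stack of pending calls -/

section Stack
variable {P : Type} [RecProps P]

theorem IsCall.not_isRet {a : Finset P} (h : IsCall a) : ¬ IsRet a := fun h' => h.2.1 h'.1
theorem IsInt.not_isRet {a : Finset P} (h : IsInt a) : ¬ IsRet a := fun h' => h.2.2 h'.1
theorem IsInt.not_isCall {a : Finset P} (h : IsInt a) : ¬ IsCall a := fun h' => h.2.1 h'.1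

theorem WellMatched.append {u v : List (Finset P)} (hu : WellMatched u) (hv : WellMatched v) :
    WellMatched (u ++ v) := by
  induction hu with
  | nil => exact hv
  | internal a u ha _ ih => exact .internal a _ ha ih
  | call c r u u' hc hr hu _ _ ih =>
    simpa using WellMatched.call c r u (u' ++ v) hc hr hu ih

open Classical in
/-- The stack of the positions of the calls before position `i` that are not yet matched, the
last one first. -/
noncomputable def pstk (σ : ℕ → Finset P) : ℕ → List ℕ
  | 0 => []
  | i + 1 => if IsCall (σ i) then i :: pstk σ i else
      if IsRet (σ i) then (pstk σ i).tail else pstk σ i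

variable {σ : ℕ → Finset P}

theorem pstk_succ_call {i : ℕ} (h : IsCall (σ i)) : pstk σ (i + 1) = i :: pstk σ i := by
  simp [pstk, h]

theorem pstk_succ_ret {i : ℕ} (h : IsRet (σ i)) : pstk σ (i + 1) = (pstk σ i).tail := by
  have : ¬ IsCall (σ i) := fun h' => h'.not_isRet h
  simp [pstk, h, this]

theorem pstk_succ_int {i : ℕ} (h : ¬ IsCall (σ i)) (h' : ¬ IsRet (σ i)) :
    pstk σ (i + 1) = pstk σ i := by
  simp [pstk, h, h']

/-- A well-matched infix leaves the stack unchanged. -/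
theorem pstk_add_of_wellMatched {u : List (Finset P)} (hu : WellMatched u) :
    ∀ a, (List.range' a u.length).map σ = u → pstk σ (a + u.length) = pstk σ a := by
  induction hu with
  | nil => intro a _; rfl
  | internal c u hc _ ih =>
    intro a h
    simp only [List.length_cons, List.range'_succ, List.map_cons, List.cons.injEq] at h
    have h1 := ih (a + 1) h.2
    rw [List.length_cons, show a + (u.length + 1) = a + 1 + u.length by omega, h1,
      pstk_succ_int] <;> rw [h.1]
    exacts [hc.not_isCall, hc.not_isRet]
  | call c r u v hc hr _ _ ihu ihv =>
    intro a h
    rw [List.length_cons, List.length_append, List.length_cons] at *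
    rw [List.range'_succ, ← List.range'_append_1, List.range'_succ] at h
    simp only [List.map_cons, List.map_append, List.cons.injEq] at h
    obtain ⟨h1, h2⟩ := h
    have h3 := List.append_inj h2 (by simp)
    obtain ⟨h4, h5⟩ := h3
    simp only [List.cons.injEq] at h5
    have e1 := ihu _ h4
    have e2 := ihv _ h5.2
    have e3 : pstk σ (a + 1) = a :: pstk σ a := pstk_succ_call (by rwa [h1])
    have e4 : pstk σ (a + 1 + u.length + 1) = (pstk σ (a + 1 + u.length)).tail :=
      pstk_succ_ret (by rwa [h5.1])
    rw [show a + (u.length + (v.length + 1) + 1) = a + 1 + u.length + 1 + v.length by omega, e2,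
      e4, e1, e3, List.tail_cons]

theorem wellMatched_infix_append {a b c : ℕ} (hab : a ≤ b) (hbc : b ≤ c)
    (h1 : WellMatched ((List.range' a (b - a)).map σ))
    (h2 : WellMatched ((List.range' b (c - b)).map σ)) :
    WellMatched ((List.range' a (c - a)).map σ) := by
  have : List.range' a (c - a) = List.range' a (b - a) ++ List.range' b (c - b) := by
    have := @List.range'_append_1 a (b - a) (c - b)
    rw [show a + (b - a) = b by omega, show b - a + (c - b) = c - a by omega] at this
    exact this.symm
  rw [this, List.map_append]
  exact h1.append h2

/-- The top of the stack is a call, separated from the current position by a well-matched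
infix, and below it is the stack at that call. -/
theorem pstk_top (hσ : ∀ i, IsCall (σ i) ∨ IsRet (σ i) ∨ IsInt (σ i)) :
    ∀ (j : ℕ) {i : ℕ} {rest : List ℕ}, pstk σ j = i :: rest → i < j ∧ IsCall (σ i) ∧
      WellMatched ((List.range' (i + 1) (j - (i + 1))).map σ) ∧ pstk σ i = rest := by
  intro j
  induction j using Nat.strong_induction_on with
  | _ j ih =>
    intro i rest h
    cases j with
    | zero => simp [pstk] at h
    | succ j =>
      rcases hσ j with hc | hr | hi
      · rw [pstk_succ_call hc] at h
        obtain ⟨rfl, rfl⟩ := List.cons.inj h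
        exact ⟨by omega, hc, by simpa using WellMatched.nil, rfl⟩
      · rw [pstk_succ_ret hr] at h
        obtain ⟨k, l, hk⟩ : ∃ k l, pstk σ j = k :: l := by
          cases h' : pstk σ j with
          | nil => simp [h'] at h
          | cons k l => exact ⟨k, l, rfl⟩
        obtain ⟨k1, k2, k3, k4⟩ := ih j (by omega) hk
        rw [hk, List.tail_cons] at h
        rw [h] at k4
        obtain ⟨i1, i2, i3, i4⟩ := ih k (by omega) k4
        refine ⟨by omega, i2, ?_, i4⟩
        refine wellMatched_infix_append (b := k) (by omega) (by omega) i3 ?_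
        have h5 := WellMatched.call _ _ _ _ k2 hr k3 .nil
        convert h5 using 1
        rw [show j + 1 - k = (j - (k + 1)) + 1 + 1 by omega, List.range'_succ, List.range'_concat]
        simp only [List.map_cons, List.map_append, List.map_nil]
        congr 4
        simp; omega
      · rw [pstk_succ_int hi.not_isCall hi.not_isRet] at h
        obtain ⟨i1, i2, i3, i4⟩ := ih j (by omega) h
        refine ⟨by omega, i2, ?_, i4⟩
        refine wellMatched_infix_append (b := j) (by omega) (by omega) i3 ?_
        simpa using WellMatched.internal _ _ hi .nil

variable (hσ : ∀ i, IsCall (σ i) ∨ IsRet (σ i) ∨ IsInt (σ i))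

/-- At a matched return, its call is the top of the stack. -/
theorem Matching.pstk_eq {i j : ℕ} (h : Matching σ i j) : pstk σ j = i :: pstk σ i := by
  obtain ⟨hc, hij, -, hw⟩ := h
  have := pstk_add_of_wellMatched (σ := σ) hw (i + 1) (by simp)
  simp only [List.length_map, List.length_range'] at this
  rwa [show i + 1 + (j - (i + 1)) = j by omega, pstk_succ_call hc] at this

include hσ

theorem matching_of_pstk {i j : ℕ} {rest : List ℕ} (hj : IsRet (σ j)) (h : pstk σ j = i :: rest) :
    Matching σ i j := by
  obtain ⟨h1, h2, h3, -⟩ := pstk_top hσ j h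
  exact ⟨h2, h1, hj, h3⟩

theorem pstk_eq_nil_iff {j : ℕ} (hj : IsRet (σ j)) : pstk σ j = [] ↔ ¬ ∃ i, Matching σ i j := by
  constructor
  · rintro h ⟨i, hi⟩
    simp [hi.pstk_eq] at h
  · intro h
    cases h' : pstk σ j with
    | nil => rfl
    | cons i rest => exact absurd ⟨i, matching_of_pstk hσ hj h'⟩ h

theorem lt_of_mem_pstk : ∀ (i : ℕ) {k : ℕ}, k ∈ pstk σ i → k < i ∧ IsCall (σ k) := by
  intro i
  induction i using Nat.strong_induction_on with
  | _ i ih =>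
    intro k hk
    cases h : pstk σ i with
    | nil => simp [h] at hk
    | cons a l =>
      obtain ⟨h1, h2, -, h4⟩ := pstk_top hσ i h
      rw [h] at hk
      rcases List.mem_cons.1 hk with rfl | hk
      · exact ⟨h1, h2⟩
      · obtain ⟨h5, h6⟩ := ih a h1 (h4 ▸ hk)
        exact ⟨by omega, h6⟩

theorem le_head_of_mem_pstk {i a k : ℕ} {l : List ℕ} (h : pstk σ i = a :: l) (hk : k ∈ pstk σ i) :
    k ≤ a := by
  rw [h] at hk
  rcases List.mem_cons.1 hk with rfl | hk
  · exact le_rfl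
  · rw [← (pstk_top hσ i h).2.2.2] at hk
    exact (lt_of_mem_pstk hσ a hk).1.le

omit hσ in
theorem not_mem_pstk_of_le {i m : ℕ} (him : i < m) (h : i ∉ pstk σ m) :
    ∀ k, m ≤ k → i ∉ pstk σ k := by
  intro k hk
  induction k, hk using Nat.le_induction with
  | base => exact h
  | succ k hk ih =>
    unfold pstk
    split_ifs
    · simp [ih]; omega
    · exact fun h' => ih (List.mem_of_mem_tail h')
    · exact ih

/-- A call is pending as long as no matching return has occurred. -/
theorem mem_pstk_iff {k i : ℕ} (hk : IsCall (σ k)) (hki : k < i) :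
    k ∈ pstk σ i ↔ ¬ ∃ j < i, Matching σ k j := by
  constructor
  · rintro h ⟨j, hj, hm⟩
    have h1 : pstk σ (j + 1) = pstk σ k := by
      rw [pstk_succ_ret hm.2.2.1, hm.pstk_eq, List.tail_cons]
    have h2 : k ∉ pstk σ (j + 1) := by
      rw [h1]
      exact fun h' => absurd (lt_of_mem_pstk hσ k h').1 (lt_irrefl _)
    exact not_mem_pstk_of_le (by have := hm.2.1; omega) h2 i hj h
  · induction i, hki using Nat.le_induction with
    | base => intro _; rw [pstk_succ_call hk]; simp
    | succ i hi ih =>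
      intro h
      have h1 := ih fun ⟨j, hj, hm⟩ => h ⟨j, by omega, hm⟩
      unfold pstk
      split_ifs with hc hr
      · simp [h1]
      · cases h' : pstk σ i with
        | nil => simp [h'] at h1
        | cons a l =>
          rw [h'] at h1
          rcases List.mem_cons.1 h1 with rfl | h1
          · exact absurd ⟨i, by omega, matching_of_pstk hσ hr h'⟩ h
          · exact h1
      · exact h1

omit hσ in
theorem Matching.left_unique {i i' j : ℕ} (h : Matching σ i j) (h' : Matching σ i' j) : i = i' := by
  have := h.pstk_eq.symm.trans h'.pstk_eq
  exact (List.cons.inj this).1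

theorem Matching.right_unique {i j j' : ℕ} (h : Matching σ i j) (h' : Matching σ i j') :
    j = j' := by
  have key : ∀ {j j'}, Matching σ i j → Matching σ i j' → ¬ j < j' := by
    intro j j' h h' hlt
    have h1 : i ∈ pstk σ j' := by simp [h'.pstk_eq]
    exact (mem_pstk_iff hσ h.1 h'.2.1).1 h1 ⟨j, hlt, h⟩
  rcases lt_trichotomy j j' with h1 | h1 | h1
  · exact absurd h1 (key h h')
  · exact h1
  · exact absurd h1 (key h' h)

/-! ### Abstract paths and callers -/

omit hσ in
theorem absSucc_call_iff {i j : ℕ} (h : IsCall (σ i)) : AbsSucc σ i j ↔ Matching σ i j := by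
  simp [AbsSucc, h]

omit hσ in
theorem AbsSucc.lt {i j : ℕ} (h : AbsSucc σ i j) : i < j := by
  rcases h with h | h
  · exact h.2.1
  · omega

theorem AbsSucc.right_unique {i j j' : ℕ} (h : AbsSucc σ i j) (h' : AbsSucc σ i j') : j = j' := by
  rcases h with h | h <;> rcases h' with h' | h'
  · exact h.right_unique hσ h'
  · exact absurd h.1 h'.1
  · exact absurd h'.1 h.1
  · omega

omit hσ in
theorem AbsSucc.left_unique {i i' j : ℕ} (h : AbsSucc σ i j) (h' : AbsSucc σ i' j) : i = i' := by
  rcases h with h | h <;> rcases h' with h' | h'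
  · exact h.left_unique h'
  · exact absurd h.2.2.1 h'.2.2
  · exact absurd h'.2.2.1 h.2.2
  · omega

omit hσ in
/-- A return has an abstract predecessor only if it has a matching call. -/
theorem absSucc_ret_iff {i j : ℕ} (h : IsRet (σ j)) : AbsSucc σ i j ↔ Matching σ i j := by
  simp only [AbsSucc, h, not_true_eq_false, and_false, or_false]

open Classical in
/-- The stack of the calls in whose scope position `i` lies: a matching return is no longer in
the scope of its call. -/
noncomputable def cstk (σ : ℕ → Finset P) (i : ℕ) : List ℕ :=
  if IsRet (σ i) then (pstk σ i).tail else pstk σ i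

/-- The calls in whose scope `i` lies are the candidates for the caller of `i`. -/
theorem mem_cstk_iff {k i : ℕ} : k ∈ cstk σ i ↔ k < i ∧ IsCall (σ k) ∧
    ((¬ ∃ m, AbsSucc σ k m) ∨ ∃ m, AbsSucc σ k m ∧ i < m) := by
  have hlt : k ∈ cstk σ i → k < i ∧ IsCall (σ k) := by
    unfold cstk
    split_ifs
    · exact fun h => lt_of_mem_pstk hσ i (List.mem_of_mem_tail h)
    · exact lt_of_mem_pstk hσ i
  by_cases hk : k < i ∧ IsCall (σ k)
  swap
  · constructor
    · exact fun h => absurd (hlt h) hk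
    · exact fun h => absurd ⟨h.1, h.2.1⟩ hk
  obtain ⟨hki, hc⟩ := hk
  have h1 : k ∈ cstk σ i ↔ ¬ ∃ j < i + 1, Matching σ k j := by
    unfold cstk
    split_ifs with hr
    · rw [← pstk_succ_ret hr, mem_pstk_iff hσ hc (by omega)]
    · rw [mem_pstk_iff hσ hc hki, not_iff_not]
      constructor
      · rintro ⟨j, hj, h⟩; exact ⟨j, by omega, h⟩
      · rintro ⟨j, hj, h⟩
        refine ⟨j, lt_of_le_of_ne (by omega) ?_, h⟩
        rintro rfl; exact hr h.2.2.1
  rw [h1]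
  simp only [absSucc_call_iff hc, hki, hc, true_and]
  constructor
  · intro h
    by_cases h2 : ∃ m, Matching σ k m
    · obtain ⟨m, hm⟩ := h2
      exact Or.inr ⟨m, hm, by by_contra h3; exact h ⟨m, by omega, hm⟩⟩
    · exact Or.inl h2
  · rintro (h | ⟨m, hm, him⟩) ⟨j, hj, h'⟩
    · exact h ⟨j, h'⟩
    · have := hm.right_unique hσ h'
      omega

/-- The caller is the innermost call in whose scope the position lies. -/
theorem callerOf_iff {i j : ℕ} : CallerOf σ i j ↔ ∃ rest, cstk σ i = j :: rest := by
  have hset : {k | k < i ∧ IsCall (σ k) ∧ ((¬ ∃ m, AbsSucc σ k m) ∨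
      ∃ m, AbsSucc σ k m ∧ i < m)} = {k | k ∈ cstk σ i} := by
    ext k; exact (mem_cstk_iff hσ).symm
  have hhead : ∀ {a l}, cstk σ i = a :: l → ∀ k ∈ cstk σ i, k ≤ a := by
    intro a l h k hk
    unfold cstk at h hk
    split_ifs at h hk with hr
    · rw [← pstk_succ_ret hr] at h hk
      exact le_head_of_mem_pstk hσ h hk
    · exact le_head_of_mem_pstk hσ h hk
  unfold CallerOf
  rw [hset]
  constructor
  · rintro ⟨h1, h2⟩
    cases h : cstk σ i with
    | nil => simp [h] at h1
    | cons a l =>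
      have h3 : a ≤ j := h2 (by simp [h])
      have h4 : j ≤ a := hhead h j h1
      exact ⟨l, by rw [le_antisymm h3 h4]⟩
  · rintro ⟨rest, h⟩
    exact ⟨by simp [h], fun k hk => hhead h k hk⟩

omit hσ in
theorem CallerOf.right_unique {i j j' : ℕ} (h : CallerOf σ i j) (h' : CallerOf σ i j') : j = j' :=
  IsGreatest.unique h h'

omit hσ in
theorem CallerOf.lt {i j : ℕ} (h : CallerOf σ i j) : j < i := h.1.1

theorem callerOf_congr {i i' : ℕ} (h : cstk σ i = cstk σ i') (j : ℕ) :
    CallerOf σ i j ↔ CallerOf σ i' j := by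
  rw [callerOf_iff hσ, callerOf_iff hσ, h]

omit hσ in
theorem cstk_succ {i : ℕ} (h : ¬ IsCall (σ i)) (h' : ¬ IsRet (σ (i + 1))) :
    cstk σ (i + 1) = cstk σ i := by
  unfold cstk
  rw [if_neg h']
  split_ifs with hr
  · exact pstk_succ_ret hr
  · exact pstk_succ_int h hr

omit hσ in
theorem Matching.cstk_eq {i j : ℕ} (h : Matching σ i j) : cstk σ j = cstk σ i := by
  unfold cstk
  rw [if_pos h.2.2.1, if_neg h.1.not_isRet, h.pstk_eq, List.tail_cons]

omit hσ in
theorem AbsSucc.cstk_eq {i j : ℕ} (h : AbsSucc σ i j) : cstk σ j = cstk σ i := by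
  rcases h with h | ⟨h1, rfl, h2⟩
  · exact h.cstk_eq
  · exact cstk_succ h1 h2

theorem callerOf_succ_call {i : ℕ} (h : IsCall (σ i)) (h' : ¬ IsRet (σ (i + 1))) :
    CallerOf σ (i + 1) i := by
  rw [callerOf_iff hσ]
  unfold cstk
  rw [if_neg h', pstk_succ_call h]
  exact ⟨_, rfl⟩

theorem not_callerOf_unmatched {i j : ℕ} (h : IsRet (σ i)) (h' : ¬ ∃ k, Matching σ k i) :
    ¬ CallerOf σ i j := by
  rw [callerOf_iff hσ]
  unfold cstk
  simp [h, (pstk_eq_nil_iff hσ h).2 h']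

omit hσ in
theorem not_callerOf_zero {j : ℕ} : ¬ CallerOf σ 0 j := fun h => by
  have := h.lt; omega

/-- Position `i` lies strictly between a call and its matching return. -/
def Enclosed (σ : ℕ → Finset P) (i : ℕ) : Prop := ∃ c j, Matching σ c j ∧ c < i ∧ i < j

/-- Matching pairs do not cross. -/
theorem Matching.not_crossing {a b c d : ℕ} (h : Matching σ a b) (h' : Matching σ c d)
    (h1 : a < c) (h2 : c < b) : d < b := by
  by_contra hdb
  have hbd : b ≤ d := by omega
  rcases hbd.lt_or_eq with hlt | rfl
  · -- at `b`, the call `c` is pending above `a`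
    have hc : c ∈ pstk σ b := (mem_pstk_iff hσ h'.1 h2).2 fun ⟨j, hj, hm⟩ => by
      have := hm.right_unique hσ h'
      omega
    have := le_head_of_mem_pstk hσ h.pstk_eq hc
    omega
  · have := h.left_unique h'
    omega

/-- All positions on an abstract path lie in the scope of the same matched calls. -/
theorem enclosed_congr_abs {i j : ℕ} (h : AbsSucc σ i j) : Enclosed σ i ↔ Enclosed σ j := by
  rcases h with h | ⟨h1, rfl, h2⟩
  · constructor
    · rintro ⟨c, d, hm, h1, h2⟩
      exact ⟨c, d, hm, by have := h.2.1; omega, hm.not_crossing hσ h h1 h2⟩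
    · rintro ⟨c, d, hm, h1, h2⟩
      refine ⟨c, d, hm, ?_, by have := h.2.1; omega⟩
      by_contra h3
      rcases (show i ≤ c by omega).lt_or_eq with h4 | rfl
      · have := h.not_crossing hσ hm h4 h1; omega
      · have := h.right_unique hσ hm; omega
  · constructor
    · rintro ⟨c, d, hm, h3, h4⟩
      refine ⟨c, d, hm, by omega, lt_of_le_of_ne (by omega) ?_⟩
      rintro rfl; exact h2 hm.2.2.1
    · rintro ⟨c, d, hm, h3, h4⟩
      refine ⟨c, d, hm, lt_of_le_of_ne (by omega) ?_, by omega⟩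
      rintro rfl; exact h1 hm.1

/-- An unmatched return lies in the scope of no matched call. -/
theorem not_enclosed_unmatched_ret {i : ℕ} (h : IsRet (σ i)) (h' : ¬ ∃ k, Matching σ k i) :
    ¬ Enclosed σ i := by
  rintro ⟨c, d, hm, h1, h2⟩
  have : c ∈ pstk σ i := (mem_pstk_iff hσ hm.1 h1).2 fun ⟨j, hj, hm'⟩ => by
    have := hm'.right_unique hσ hm; omega
  rw [(pstk_eq_nil_iff hσ h).2 h'] at this
  simp at this

/-- An unmatched call lies in the scope of no matched call. -/
theorem not_enclosed_unmatched_call {i : ℕ} (h : IsCall (σ i)) (h' : ¬ ∃ k, Matching σ i k) :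
    ¬ Enclosed σ i := by
  rintro ⟨c, d, hm, h1, h2⟩
  have hi : i ∈ pstk σ d := (mem_pstk_iff hσ h h2).2 fun ⟨j, _, hj⟩ => h' ⟨j, hj⟩
  have := le_head_of_mem_pstk hσ hm.pstk_eq hi
  omega

theorem enclosed_succ_call {i : ℕ} (h : IsCall (σ i)) (h' : ¬ IsRet (σ (i + 1))) :
    Enclosed σ (i + 1) ↔ ∃ k, Matching σ i k := by
  constructor
  · rintro ⟨c, d, hm, h1, h2⟩
    rcases (show c ≤ i by omega).lt_or_eq with h3 | rfl
    · by_contra hn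
      exact not_enclosed_unmatched_call hσ h hn ⟨c, d, hm, h3, by omega⟩
    · exact ⟨d, hm⟩
  · rintro ⟨k, hk⟩
    refine ⟨i, k, hk, by omega, lt_of_le_of_ne hk.2.1 ?_⟩
    rintro rfl; exact h' hk.2.2.1

/-- There are arbitrarily late positions in the scope of no matched call: after any position
comes the end of the outermost matching pair around it. -/
theorem exists_not_enclosed (m : ℕ) : ∃ i, m ≤ i ∧ ¬ Enclosed σ i := by
  by_cases h : Enclosed σ m
  swap
  · exact ⟨m, le_rfl, h⟩
  classical
  have hex : ∃ c, ∃ d, Matching σ c d ∧ c < m ∧ m < d := h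
  obtain ⟨d, hm, h1, h2⟩ := Nat.find_spec hex
  refine ⟨d, h2.le, ?_⟩
  rintro ⟨c', d', hm', h3, h4⟩
  have h5 : Nat.find hex ≤ c' ∨ c' < Nat.find hex := by omega
  rcases h5 with h5 | h5
  · rcases h5.lt_or_eq with h6 | h6
    · have := hm.not_crossing hσ hm' h6 h3; omega
    · rw [h6] at hm
      have := hm.right_unique hσ hm'; omega
  · exact Nat.find_min hex h5 ⟨d', hm', by omega, by omega⟩

end Stack

/-! ### Positions reached along the directions -/

section Paths
variable {P : Type} [RecProps P] {σ : ℕ → Finset P}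

theorem IsSucc.lt {d : FDir} {i j : ℕ} (h : IsSucc σ d i j) : i < j := by
  cases d with
  | glob => simp only [IsSucc] at h; omega
  | abs => exact AbsSucc.lt h

theorem IsPred.lt {d : Dir} {i j : ℕ} (h : IsPred σ d i j) : j < i := by
  cases d with
  | glob => simp only [IsPred] at h; omega
  | abs => exact AbsSucc.lt h
  | caller => exact CallerOf.lt h

theorem IsSucc.right_unique (hσ : ∀ i, IsCall (σ i) ∨ IsRet (σ i) ∨ IsInt (σ i)) {d : FDir}
    {i j j' : ℕ} (h : IsSucc σ d i j) (h' : IsSucc σ d i j') : j = j' := by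
  cases d with
  | glob => simp only [IsSucc] at h h'; omega
  | abs => exact AbsSucc.right_unique hσ h h'

theorem IsPred.right_unique {d : Dir}
    {i j j' : ℕ} (h : IsPred σ d i j) (h' : IsPred σ d i j') : j = j' := by
  cases d with
  | glob => simp only [IsPred] at h h'; omega
  | abs => exact AbsSucc.left_unique h h'
  | caller => exact CallerOf.right_unique h h'

theorem reflTransGen_le {R : ℕ → ℕ → Prop} (hR : ∀ i j, R i j → i < j) {i j : ℕ}
    (h : Relation.ReflTransGen R i j) : i ≤ j := by
  induction h with
  | refl => exact le_rfl
  | tail _ h ih => exact ih.trans (hR _ _ h).le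

theorem mem_pos_iff_of_le {d : FDir} {i j : ℕ} (hij : i ≤ j) :
    j ∈ Pos σ d.toDir i ↔ Relation.ReflTransGen (IsSucc σ d) i j := by
  cases d with
  | glob =>
    simp only [FDir.toDir, Pos, Set.mem_univ, true_iff]
    induction j, hij using Nat.le_induction with
    | base => exact .refl
    | succ j _ ih => exact ih.tail rfl
  | abs =>
    simp only [FDir.toDir, Pos, Set.mem_ofPred_eq]
    constructor
    · rintro (h | h)
      · exact h
      · have := reflTransGen_le (fun _ _ => AbsSucc.lt) h
        obtain rfl : i = j := by omega
        exact .refl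
    · exact fun h => Or.inl h

theorem mem_pos_iff_of_ge {d : Dir} {i j : ℕ} (hij : j ≤ i) :
    j ∈ Pos σ d i ↔ Relation.ReflTransGen (IsPred σ d) i j := by
  cases d with
  | glob =>
    simp only [Pos, Set.mem_univ, true_iff]
    induction i, hij using Nat.le_induction with
    | base => exact .refl
    | succ i _ ih => exact Relation.ReflTransGen.head rfl ih
  | abs =>
    simp only [Pos, Set.mem_ofPred_eq]
    have hsw : Relation.ReflTransGen (IsPred σ .abs) i j ↔
        Relation.ReflTransGen (AbsSucc σ) j i := by
      have : IsPred σ .abs = Function.swap (AbsSucc σ) := rfl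
      rw [this, Relation.reflTransGen_swap]
    rw [hsw]
    constructor
    · rintro (h | h)
      · have := reflTransGen_le (fun _ _ => AbsSucc.lt) h
        obtain rfl : i = j := by omega
        exact .refl
      · exact h
    · exact fun h => Or.inr h
  | caller => rfl

/-- The expansion law of an until along a functional relation. -/
theorem until_unfold {α : Type} [PartialOrder α] {R : α → α → Prop} (hR : ∀ i j, R i j → i < j)
    (hu : ∀ i j j', R i j → R i j' → j = j') (f g : α → Prop) (i : α) :
    (∃ j, Relation.ReflTransGen R i j ∧ g j ∧
      ∀ k, k < j → Relation.ReflTransGen R i k → f k) ↔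
    g i ∨ f i ∧ ∃ i', R i i' ∧ ∃ j, Relation.ReflTransGen R i' j ∧ g j ∧
      ∀ k, k < j → Relation.ReflTransGen R i' k → f k := by
  have hle : ∀ {i j}, Relation.ReflTransGen R i j → i ≤ j := by
    intro i j h
    induction h with
    | refl => exact le_rfl
    | tail _ h ih => exact ih.trans (hR _ _ h).le
  constructor
  · rintro ⟨j, hj, hg, hf⟩
    rcases hj.cases_head with rfl | ⟨i', h1, h2⟩
    · exact Or.inl hg
    · refine Or.inr ⟨hf i ((hR _ _ h1).trans_le (hle h2)) .refl, i', h1, j, h2, hg,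
        fun k hk h => hf k hk (h.head h1)⟩
  · rintro (h | ⟨hf, i', h1, j, h2, hg, hf'⟩)
    · exact ⟨i, .refl, h, fun k hk h => absurd hk (hle h).not_gt⟩
    · refine ⟨j, h2.head h1, hg, fun k hk h => ?_⟩
      rcases h.cases_head with rfl | ⟨i'', h3, h4⟩
      · exact hf
      · rw [hu _ _ _ h3 h1] at h4
        exact hf' k hk h4

theorem sat_untl_iff_path (w : TimedWord P) (d : FDir) (f g : Formula P) (i : ℕ) :
    (Formula.untl d f g).Sat w i ↔
      ∃ j, Relation.ReflTransGen (IsSucc w.letter d) i j ∧ g.Sat w j ∧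
        ∀ k, k < j → Relation.ReflTransGen (IsSucc w.letter d) i k → f.Sat w k := by
  simp only [Formula.Sat]
  refine exists_congr fun j => ?_
  constructor
  · rintro ⟨h1, h2, h3, h4⟩
    refine ⟨(mem_pos_iff_of_le h1).1 h2, h3, fun k hk h => ?_⟩
    have := reflTransGen_le (fun _ _ => IsSucc.lt) h
    exact h4 k this hk ((mem_pos_iff_of_le this).2 h)
  · rintro ⟨h2, h3, h4⟩
    have h1 := reflTransGen_le (fun _ _ => IsSucc.lt) h2
    exact ⟨h1, (mem_pos_iff_of_le h1).2 h2, h3, fun k hik hk h =>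
      h4 k hk ((mem_pos_iff_of_le hik).1 h)⟩

theorem sat_untl_iff (w : TimedWord P) (d : FDir) (f g : Formula P) (i : ℕ) :
    (Formula.untl d f g).Sat w i ↔
      g.Sat w i ∨ (f.Sat w i ∧ (Formula.next d (.untl d f g)).Sat w i) := by
  have key := sat_untl_iff_path w d f g
  rw [key, until_unfold (fun _ _ => IsSucc.lt) (fun _ _ _ => IsSucc.right_unique w.letter_mem)]
  refine or_congr Iff.rfl (and_congr Iff.rfl ?_)
  simp only [← key]
  exact exists_congr fun j => ⟨fun h => ⟨IsSucc.lt h.1, h⟩, fun h => h.2⟩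

theorem sat_since_iff (w : TimedWord P) (d : Dir) (f g : Formula P) (i : ℕ) :
    (Formula.since d f g).Sat w i ↔
      g.Sat w i ∨ (f.Sat w i ∧ (Formula.prev d (.since d f g)).Sat w i) := by
  have hle : ∀ {i j}, Relation.ReflTransGen (IsPred w.letter d) i j → j ≤ i := by
    intro i j h
    induction h with
    | refl => exact le_rfl
    | tail _ h ih => exact (IsPred.lt h).le.trans ih
  have key : ∀ i, (Formula.since d f g).Sat w i ↔
      ∃ j, Relation.ReflTransGen (IsPred w.letter d) i j ∧ g.Sat w j ∧
        ∀ k, j < k → Relation.ReflTransGen (IsPred w.letter d) i k → f.Sat w k := by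
    intro i
    simp only [Formula.Sat]
    refine exists_congr fun j => ?_
    constructor
    · rintro ⟨h1, h2, h3, h4⟩
      refine ⟨(mem_pos_iff_of_ge h1).1 h2, h3, fun k hk h => ?_⟩
      exact h4 k hk (hle h) ((mem_pos_iff_of_ge (hle h)).2 h)
    · rintro ⟨h2, h3, h4⟩
      exact ⟨hle h2, (mem_pos_iff_of_ge (hle h2)).2 h2, h3, fun k hk hik h =>
        h4 k hk ((mem_pos_iff_of_ge hik).1 h)⟩
  have hu := until_unfold (α := ℕᵒᵈ) (R := IsPred w.letter d) (fun _ _ => IsPred.lt)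
    (fun _ _ _ => IsPred.right_unique) (fun k => f.Sat w k) (fun k => g.Sat w k) i
  rw [key]
  refine (hu : _ ↔ _).trans (or_congr Iff.rfl (and_congr Iff.rfl ?_))
  exact exists_congr fun j => ⟨fun h => ⟨IsPred.lt h.1, h.1, (key j).2 h.2⟩,
    fun h => ⟨h.2.1, (key j).1 h.2.2⟩⟩

/-- Matching pairs, abstract paths and callers depend only on which positions are calls, returns
and internal actions. -/
theorem matching_congr {P' : Type} [RecProps P'] {σ' : ℕ → Finset P'}
    (hσ : ∀ i, IsCall (σ i) ∨ IsRet (σ i) ∨ IsInt (σ i))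
    (hσ' : ∀ i, IsCall (σ' i) ∨ IsRet (σ' i) ∨ IsInt (σ' i))
    (hc : ∀ i, IsCall (σ i) ↔ IsCall (σ' i)) (hr : ∀ i, IsRet (σ i) ↔ IsRet (σ' i)) :
    AbsSucc σ = AbsSucc σ' ∧ CallerOf σ = CallerOf σ' ∧ Matching σ = Matching σ' ∧
      Pos σ = Pos σ' := by
  have hs : ∀ i, pstk σ i = pstk σ' i := by
    intro i
    induction i with
    | zero => rfl
    | succ i ih => unfold pstk; split_ifs <;> simp_all
  have hm : Matching σ = Matching σ' := by
    funext i j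
    refine propext ⟨fun h => ?_, fun h => ?_⟩
    · exact matching_of_pstk hσ' ((hr j).1 h.2.2.1) ((hs j).symm.trans h.pstk_eq)
    · exact matching_of_pstk hσ ((hr j).2 h.2.2.1) ((hs j).trans h.pstk_eq)
  have ha : AbsSucc σ = AbsSucc σ' := by
    funext i j
    simp only [AbsSucc, hm, hc, hr]
  have hcl : CallerOf σ = CallerOf σ' := by
    funext i j
    simp only [CallerOf, ha, hc]
  refine ⟨ha, hcl, hm, ?_⟩
  funext d i
  cases d <;> simp only [Pos, ha, hcl]

end Paths
end ECNTL
namespace ECNTL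
open RecProps

/-! ### The closure of a formula -/

section Closure
variable {P : Type}

namespace Formula

/-- The immediate subformulas. -/
def args : Formula P → List (Formula P)
  | tru => []
  | prop _ => []
  | or f g => [f, g]
  | neg f => [f]
  | next _ f => [f]
  | prev _ f => [f]
  | untl _ f g => [f, g]
  | since _ f g => [f, g]
  | nextClock _ _ f => [f]
  | prevClock _ _ f => [f]

variable [DecidableEq P]

theorem self_mem_sub (f : Formula P) : f ∈ f.sub := by
  cases f <;> simp [sub]

theorem mem_sub_of_args {f g h : Formula P} (hg : g ∈ f.sub) (hh : h ∈ g.args) : h ∈ f.sub := by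
  induction f with
  | tru | prop _ =>
    simp only [sub, Finset.mem_singleton] at hg
    subst hg
    simp [args] at hh
  | neg a ih | next _ a ih | prev _ a ih | nextClock _ _ a ih | prevClock _ _ a ih =>
    simp only [sub, Finset.mem_insert] at hg ⊢
    rcases hg with rfl | hg
    · simp only [args, List.mem_singleton] at hh
      subst hh
      exact Or.inr (self_mem_sub _)
    · exact Or.inr (ih hg)
  | or a b iha ihb | untl _ a b iha ihb | since _ a b iha ihb =>
    simp only [sub, Finset.mem_insert, Finset.mem_union] at hg ⊢
    rcases hg with rfl | hg | hg
    · simp only [args, List.mem_cons, List.not_mem_nil, or_false] at hh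
      rcases hh with rfl | rfl
      · exact Or.inr (Or.inl (self_mem_sub _))
      · exact Or.inr (Or.inr (self_mem_sub _))
    · exact Or.inr (Or.inl (iha hg))
    · exact Or.inr (Or.inr (ihb hg))

end Formula

open Formula
variable [DecidableEq P] [Fintype P] {φ : Formula P}

theorem mem_closureBase {ψ : Formula (Option P)} : ψ ∈ closureBase φ ↔
    ψ = tru ∨ ψ = next .abs tru ∨ ψ = prev .abs tru ∨ (∃ p, ψ = prop p) ∨ ψ ∈ (φ.map some).sub ∨
      ∃ χ ∈ (φ.map some).sub, ψ ∈ χ.unfolding := by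
  simp only [closureBase, Finset.mem_union, Finset.mem_insert, Finset.mem_singleton,
    Finset.mem_image, Finset.mem_univ, true_and, Finset.mem_biUnion, eq_comm (b := ψ)]
  tauto

omit [Fintype P] in
theorem mem_unfolding {ψ χ : Formula (Option P)} (h : ψ ∈ χ.unfolding) :
    (∃ d f g, χ = untl d f g ∧ ψ = next d χ) ∨ ∃ d f g, χ = since d f g ∧ ψ = prev d χ := by
  cases χ <;> simp_all [unfolding]

theorem mem_closureBase_of_args {ψ χ : Formula (Option P)} (h : ψ ∈ closureBase φ)
    (hχ : χ ∈ ψ.args) : χ ∈ closureBase φ := by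
  rw [mem_closureBase] at h
  rcases h with rfl | rfl | rfl | ⟨p, rfl⟩ | h | ⟨ξ, hξ, h⟩
  · simp [args] at hχ
  · simp only [args, List.mem_singleton] at hχ
    exact mem_closureBase.2 (Or.inl hχ)
  · simp only [args, List.mem_singleton] at hχ
    exact mem_closureBase.2 (Or.inl hχ)
  · simp [args] at hχ
  · exact mem_closureBase.2 (by simp [mem_sub_of_args h hχ])
  · rcases mem_unfolding h with ⟨d, f, g, -, rfl⟩ | ⟨d, f, g, -, rfl⟩ <;>
    · simp only [args, List.mem_singleton] at hχ
      subst hχ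
      exact mem_closureBase.2 (by simp [hξ])

theorem mem_closure {ψ : Formula (Option P)} :
    ψ ∈ closure φ ↔ ψ ∈ closureBase φ ∨ ∃ χ ∈ closureBase φ, χ.negate = ψ := by
  simp [closure]

omit [DecidableEq P] [Fintype P] in
theorem negate_of_not_neg {ψ : Formula P} (h : ∀ f, ψ ≠ neg f) : ψ.negate = neg ψ := by
  cases ψ <;> simp_all [negate]

theorem mem_closureBase_of_closure {ψ : Formula (Option P)} (h : ψ ∈ closure φ)
    (hn : ∀ f, ψ ≠ neg f) : ψ ∈ closureBase φ := by
  rcases mem_closure.1 h with h | ⟨χ, hχ, rfl⟩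
  · exact h
  · by_cases hc : ∀ f, χ ≠ neg f
    · exact absurd (negate_of_not_neg hc) (hn _)
    · push Not at hc
      obtain ⟨f, rfl⟩ := hc
      exact mem_closureBase_of_args hχ (by simp [args, negate])

theorem negate_mem_closure {ψ : Formula (Option P)} (h : ψ ∈ closure φ) :
    ψ.negate ∈ closure φ := by
  by_cases hn : ∀ f, ψ ≠ neg f
  · exact mem_closure.2 (Or.inr ⟨ψ, mem_closureBase_of_closure h hn, rfl⟩)
  · push Not at hn
    obtain ⟨f, rfl⟩ := hn
    refine mem_closure.2 (Or.inl ?_)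
    rcases mem_closure.1 h with h | ⟨χ, hχ, h⟩
    · exact mem_closureBase_of_args h (by simp [args, negate])
    · by_cases hc : ∀ f, χ ≠ neg f
      · rw [negate_of_not_neg hc] at h
        rw [neg.injEq] at h
        exact h ▸ hχ
      · push Not at hc
        obtain ⟨g, rfl⟩ := hc
        have h1 : neg f ∈ closureBase φ := by
          rw [← h]; exact mem_closureBase_of_args hχ (by simp [args, negate])
        exact mem_closureBase_of_args h1 (by simp [args, negate])

theorem mem_closure_of_args {ψ χ : Formula (Option P)} (h : ψ ∈ closure φ) (hχ : χ ∈ ψ.args) :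
    χ ∈ closure φ := by
  by_cases hn : ∀ f, ψ ≠ neg f
  · exact mem_closure.2 (Or.inl (mem_closureBase_of_args (mem_closureBase_of_closure h hn) hχ))
  · push Not at hn
    obtain ⟨f, rfl⟩ := hn
    simp only [args, List.mem_singleton] at hχ
    subst hχ
    exact negate_mem_closure h

theorem neg_prev_mem_closure {d : Dir} {ψ : Formula (Option P)} (h : prev d ψ ∈ closure φ) :
    neg (prev d ψ) ∈ closure φ := negate_mem_closure h

theorem neg_untl_mem_closure {d : FDir} {f g : Formula (Option P)} (h : untl d f g ∈ closure φ) :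
    neg (untl d f g) ∈ closure φ := negate_mem_closure h

theorem tru_mem_closure : tru ∈ closure φ :=
  mem_closure.2 (Or.inl (mem_closureBase.2 (by simp)))

theorem next_abs_tru_mem_closure : next .abs tru ∈ closure φ :=
  mem_closure.2 (Or.inl (mem_closureBase.2 (by simp)))

theorem prev_abs_tru_mem_closure : prev .abs tru ∈ closure φ :=
  mem_closure.2 (Or.inl (mem_closureBase.2 (by simp)))

theorem map_some_mem_closure : φ.map some ∈ closure φ :=
  mem_closure.2 (Or.inl (mem_closureBase.2 (by simp [self_mem_sub])))

theorem next_untl_mem_closure {d : FDir} {f g : Formula (Option P)}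
    (h : untl d f g ∈ closure φ) : next d (untl d f g) ∈ closure φ := by
  have h1 := mem_closureBase_of_closure h (by simp)
  rw [mem_closureBase] at h1
  simp only [reduceCtorEq, exists_false, false_or] at h1
  refine mem_closure.2 (Or.inl (mem_closureBase.2 ?_))
  rcases h1 with h1 | ⟨χ, -, h2⟩
  · simp only [reduceCtorEq, exists_false, false_or]
    exact Or.inr (Or.inr ⟨_, h1, by simp [unfolding]⟩)
  · rcases mem_unfolding h2 with ⟨d, f, g, -, h⟩ | ⟨d, f, g, -, h⟩ <;> simp at h

theorem prev_since_mem_closure {d : Dir} {f g : Formula (Option P)}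
    (h : since d f g ∈ closure φ) : prev d (since d f g) ∈ closure φ := by
  have h1 := mem_closureBase_of_closure h (by simp)
  rw [mem_closureBase] at h1
  simp only [reduceCtorEq, exists_false, false_or] at h1
  refine mem_closure.2 (Or.inl (mem_closureBase.2 ?_))
  rcases h1 with h1 | ⟨χ, -, h2⟩
  · simp only [reduceCtorEq, exists_false, false_or]
    exact Or.inr (Or.inr ⟨_, h1, by simp [unfolding]⟩)
  · rcases mem_unfolding h2 with ⟨d, f, g, -, h⟩ | ⟨d, f, g, -, h⟩ <;> simp at h

/-- A formula that starts with a real-time modality is in the closure only as a subformula. -/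
theorem prevClock_mem_sub {d : Dir} {I : Interval} {f : Formula (Option P)}
    (h : prevClock d I f ∈ closure φ) : prevClock d I f ∈ (φ.map some).sub := by
  have h1 := mem_closureBase_of_closure h (by simp)
  rw [mem_closureBase] at h1
  simp only [reduceCtorEq, exists_false, false_or] at h1
  rcases h1 with h1 | ⟨χ, -, h2⟩
  · exact h1
  · rcases mem_unfolding h2 with ⟨d, f, g, -, h⟩ | ⟨d, f, g, -, h⟩ <;> simp at h

theorem nextClock_mem_sub {d : FDir} {I : Interval} {f : Formula (Option P)}
    (h : nextClock d I f ∈ closure φ) : nextClock d I f ∈ (φ.map some).sub := by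
  have h1 := mem_closureBase_of_closure h (by simp)
  rw [mem_closureBase] at h1
  simp only [reduceCtorEq, exists_false, false_or] at h1
  rcases h1 with h1 | ⟨χ, -, h2⟩
  · exact h1
  · rcases mem_unfolding h2 with ⟨d, f, g, -, h⟩ | ⟨d, f, g, -, h⟩ <;> simp at h

omit [Fintype P] in
theorem sub_map_some (f : Formula P) : (f.map some).sub = f.sub.image (Formula.map some) := by
  induction f <;>
    simp_all [sub, Formula.map, Finset.image_union, Finset.image_insert]

omit [Fintype P] in
theorem NonRecursive.of_mem_sub {f g : Formula P} (hf : f.NonRecursive) (h : g ∈ f.sub) :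
    g.NonRecursive := by
  induction f with
  | tru | prop _ =>
    simp only [sub, Finset.mem_singleton] at h
    rw [h]; trivial
  | neg a ih | next _ a ih | prev _ a ih =>
    simp only [sub, Finset.mem_insert] at h
    rcases h with rfl | h
    · exact hf
    · exact ih hf h
  | nextClock _ _ a ih | prevClock _ _ a ih =>
    simp only [sub, Finset.mem_insert] at h
    rcases h with rfl | h
    · exact hf
    · obtain ⟨p, rfl⟩ := hf
      exact ih trivial h
  | or a b iha ihb | untl _ a b iha ihb | since _ a b iha ihb =>
    simp only [sub, Finset.mem_insert, Finset.mem_union] at h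
    rcases h with rfl | h | h
    · exact hf
    · exact iha hf.1 h
    · exact ihb hf.2 h

theorem eq_prop_of_prevClock_mem {d : Dir} {I : Interval} {f : Formula (Option P)}
    (hφ : φ.NonRecursive) (h : prevClock d I f ∈ closure φ) : ∃ p, f = prop (some p) := by
  have h1 := prevClock_mem_sub h
  rw [sub_map_some, Finset.mem_image] at h1
  obtain ⟨g, hg, hgf⟩ := h1
  have h2 := NonRecursive.of_mem_sub hφ hg
  cases g <;> simp only [Formula.map, reduceCtorEq, prevClock.injEq] at hgf
  obtain ⟨p, rfl⟩ := h2
  exact ⟨p, hgf.2.2.symm⟩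

theorem eq_prop_of_nextClock_mem {d : FDir} {I : Interval} {f : Formula (Option P)}
    (hφ : φ.NonRecursive) (h : nextClock d I f ∈ closure φ) : ∃ p, f = prop (some p) := by
  have h1 := nextClock_mem_sub h
  rw [sub_map_some, Finset.mem_image] at h1
  obtain ⟨g, hg, hgf⟩ := h1
  have h2 := NonRecursive.of_mem_sub hφ hg
  cases g <;> simp only [Formula.map, reduceCtorEq, nextClock.injEq] at hgf
  obtain ⟨p, rfl⟩ := h2
  exact ⟨p, hgf.2.2.symm⟩

end Closure

/-! ### Hintikka sequences read through a labelling -/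

section Generalized
variable {P : Type} [DecidableEq P] [Fintype P] [RecProps P] {P' : Type} [RecProps P']
open Formula

/-- A labelling presents the propositions of an alphabet as formulas. -/
structure IsLabelling (lab : P' → Formula (Option P)) : Prop where
  injective : Function.Injective lab
  call_eq : lab call = prop (some call)
  ret_eq : lab ret = prop (some ret)
  intl_eq : lab intl = prop (some intl)

/-- The sequence `α` of sets of formulas satisfies the conditions on Hintikka sequences of `φ`,
where abstract paths and clock values are those of the word `w`, whose propositions `p` are read
as the formulas `lab p`. -/
structure GenHintikka (φ : Formula P) (lab : P' → Formula (Option P)) (w : TimedWord P')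
    (α : ℕ → Finset (Formula (Option P))) : Prop where
  read : ∀ i p, p ∈ w.letter i ↔ lab p ∈ α i
  atom : ∀ i, IsAtom φ (α i)
  initial : ∀ d ψ, prev d ψ ∈ closure φ → neg (prev d ψ) ∈ α 0
  global : ∀ i, NextPrev φ (α i) (α (i + 1))
  step : ∀ i, prop (some call) ∉ α i → prop (some ret) ∉ α (i + 1) →
    AbsNextPrev φ (α i) (α (i + 1)) ∧ (pInf ∈ α i ↔ pInf ∈ α (i + 1))
  beforeRet : ∀ i, prop (some call) ∉ α i → prop (some ret) ∈ α (i + 1) →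
    next .abs tru ∉ α i ∧ (prev .abs tru ∈ α (i + 1) ↔ ∃ j, Matching w.letter j (i + 1)) ∧
    (prev .abs tru ∉ α (i + 1) → pInf ∈ α i ∧ pInf ∈ α (i + 1) ∧ callerSet (α (i + 1)) = ∅)
  unmatchedCall : ∀ i, prop (some call) ∈ α i → (¬ ∃ j, AbsSucc w.letter i j) →
    next .abs tru ∉ α i ∧ pInf ∈ α i
  matchedCall : ∀ i j, prop (some call) ∈ α i → AbsSucc w.letter i j →
    AbsNextPrev φ (α i) (α j) ∧ (pInf ∈ α i ↔ pInf ∈ α j)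
  afterCall : ∀ i, prop (some call) ∈ α i → prop (some ret) ∉ α (i + 1) →
    prev .abs tru ∉ α (i + 1) ∧
    callerSet (α (i + 1)) = {χ | χ ∈ closure φ ∧ ∃ ψ, χ = prev .caller ψ ∧ ψ ∈ α i} ∧
    (next .abs tru ∈ α i ↔ pInf ∉ α (i + 1))
  past : ∀ i d I p, prevClock d I (lab p) ∈ closure φ →
    (prevClock d I (lab p) ∈ α i ↔ (Guard.within I).Sat (clockVal w i (.recorder d p)))
  future : ∀ i d I p, nextClock d I (lab p) ∈ closure φ →
    (nextClock d I (lab p) ∈ α i ↔ (Guard.within I).Sat (clockVal w i (.predictor d p)))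

/-- Fairness of a sequence of sets of formulas. -/
structure GenFair (φ : Formula P) (α : ℕ → Finset (Formula (Option P))) : Prop where
  inf : ∀ m, ∃ i, m ≤ i ∧ pInf ∈ α i
  untl_glob : ∀ f g, untl .glob f g ∈ closure φ → ∀ m, ∃ i, m ≤ i ∧
    (g ∈ α i ∨ neg (untl .glob f g) ∈ α i)
  untl_abs : ∀ f g, untl .abs f g ∈ closure φ → ∀ m, ∃ i, m ≤ i ∧ pInf ∈ α i ∧
    (g ∈ α i ∨ neg (untl .abs f g) ∈ α i)

variable {φ : Formula P} {lab : P' → Formula (Option P)} {w : TimedWord P'}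
  {α : ℕ → Finset (Formula (Option P))}

omit [DecidableEq P] [Fintype P] in
/-- The three kinds of letters, as seen by the atoms. -/
theorem isCall_iff_of_read (hl : IsLabelling lab) (hr : ∀ i p, p ∈ w.letter i ↔ lab p ∈ α i)
    (i : ℕ) : IsCall (w.letter i) ↔ prop (some call) ∈ α i := by
  rw [← hl.call_eq, ← hr]
  refine ⟨fun h => h.1, fun h => ?_⟩
  rcases w.letter_mem i with h' | h' | h'
  · exact h'
  · exact absurd h h'.2.1
  · exact absurd h h'.2.1

omit [DecidableEq P] [Fintype P] in
theorem isRet_iff_of_read (hl : IsLabelling lab) (hr : ∀ i p, p ∈ w.letter i ↔ lab p ∈ α i)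
    (i : ℕ) : IsRet (w.letter i) ↔ prop (some ret) ∈ α i := by
  rw [← hl.ret_eq, ← hr]
  refine ⟨fun h => h.1, fun h => ?_⟩
  rcases w.letter_mem i with h' | h' | h'
  · exact absurd h h'.2.1
  · exact h'
  · exact absurd h h'.2.2

namespace GenHintikka
variable (hl : IsLabelling lab) (H : GenHintikka φ lab w α)
include hl H

theorem isCall_iff (i : ℕ) : IsCall (w.letter i) ↔ prop (some call) ∈ α i :=
  isCall_iff_of_read hl H.read i

theorem isRet_iff (i : ℕ) : IsRet (w.letter i) ↔ prop (some ret) ∈ α i :=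
  isRet_iff_of_read hl H.read i

theorem absNextPrev_of_absSucc {i j : ℕ} (h : AbsSucc w.letter i j) :
    AbsNextPrev φ (α i) (α j) ∧ (pInf ∈ α i ↔ pInf ∈ α j) := by
  by_cases hc : IsCall (w.letter i)
  · exact H.matchedCall i j ((H.isCall_iff hl i).1 hc) h
  · rcases h with h | ⟨-, rfl, h2⟩
    · exact absurd h.1 hc
    · exact H.step i (fun h => hc ((H.isCall_iff hl i).2 h))
        (fun h => h2 ((H.isRet_iff hl _).2 h))

/-- The next modalities in the members of a Hintikka sequence refer to the true successors; where
there is no abstract successor, `X^a ⊤` is absent and excludes all formulas `X^a ψ`. -/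
theorem next_mem_iff {d : FDir} {ψ : Formula (Option P)} (hψ : next d ψ ∈ closure φ) (i : ℕ) :
    next d ψ ∈ α i ↔ ∃ j, IsSucc w.letter d i j ∧ ψ ∈ α j := by
  cases d with
  | glob => simp only [IsSucc, exists_eq_left]; exact (H.global i).1 ψ hψ
  | abs =>
    by_cases h : ∃ j, AbsSucc w.letter i j
    · obtain ⟨j, hj⟩ := h
      rw [(H.absNextPrev_of_absSucc hl hj).1.1.1 ψ hψ]
      exact ⟨fun h => ⟨j, hj, h⟩, fun ⟨j', hj', h⟩ => by
        rwa [AbsSucc.right_unique w.letter_mem hj hj']⟩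
    · have htop : next .abs tru ∉ α i := by
        by_cases hc : IsCall (w.letter i)
        · exact (H.unmatchedCall i ((H.isCall_iff hl i).1 hc) h).1
        · refine (H.beforeRet i (fun h => hc ((H.isCall_iff hl i).2 h)) ?_).1
          rw [← H.isRet_iff hl]
          by_contra hr
          exact h ⟨i + 1, Or.inr ⟨hc, rfl, hr⟩⟩
      have := (H.atom i).next_abs htop ψ hψ
      simp only [this, false_iff]
      exact fun ⟨j, hj, _⟩ => h ⟨j, hj⟩

omit hl in
theorem prev_not_mem_zero {d : Dir} {ψ : Formula (Option P)} (hψ : prev d ψ ∈ closure φ) :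
    prev d ψ ∉ α 0 :=
  ((H.atom 0).neg_iff _ (neg_prev_mem_closure hψ)).1 (H.initial d ψ hψ)

/-- The formulas `P^c χ` are right: they are set at the first position in the scope of a call and
passed on along abstract successors, and the caller is constant along abstract paths. -/
theorem callerSet_iff {χ : Formula (Option P)} (hχ : prev .caller χ ∈ closure φ) (i : ℕ) :
    prev .caller χ ∈ α i ↔ ∃ j, CallerOf w.letter i j ∧ χ ∈ α j := by
  have hmem : ∀ {A B : Finset (Formula (Option P))}, callerSet A = callerSet B →
      (prev .caller χ ∈ A ↔ prev .caller χ ∈ B) := by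
    intro A B h
    have := Set.ext_iff.1 h (prev .caller χ)
    simpa [callerSet] using this
  induction i using Nat.strong_induction_on with
  | _ i ih =>
    cases i with
    | zero =>
      simp only [H.prev_not_mem_zero hχ, false_iff]
      exact fun ⟨j, hj, _⟩ => not_callerOf_zero hj
    | succ i =>
      by_cases h : ∃ k, AbsSucc w.letter k (i + 1)
      · obtain ⟨k, hk⟩ := h
        rw [← hmem (H.absNextPrev_of_absSucc hl hk).1.2]
        refine (ih k hk.lt).trans ?_
        simp only [callerOf_congr w.letter_mem hk.cstk_eq]
      · by_cases hr : IsRet (w.letter (i + 1))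
        · have hm : ¬ ∃ k, Matching w.letter k (i + 1) := fun ⟨k, hk⟩ => h ⟨k, Or.inl hk⟩
          have hc : ¬ IsCall (w.letter i) := fun hc =>
            hm ⟨i, hc, by omega, hr, by simpa using WellMatched.nil⟩
          have h1 := H.beforeRet i (fun h => hc ((H.isCall_iff hl i).2 h))
            ((H.isRet_iff hl _).1 hr)
          have h2 := (h1.2.2 fun h => hm (h1.2.1.1 h)).2.2
          constructor
          · intro h3
            have : prev .caller χ ∈ callerSet (α (i + 1)) := ⟨h3, χ, rfl⟩
            simp [h2] at this
          · exact fun ⟨j, hj, _⟩ => absurd hj (not_callerOf_unmatched w.letter_mem hr hm)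
        · have hc : IsCall (w.letter i) := by
            by_contra hc
            exact h ⟨i, Or.inr ⟨hc, rfl, hr⟩⟩
          have h1 := (H.afterCall i ((H.isCall_iff hl i).1 hc)
            (fun h => hr ((H.isRet_iff hl _).2 h))).2.1
          have h2 := Set.ext_iff.1 h1 (prev .caller χ)
          simp only [callerSet, Set.mem_ofPred_eq, prev.injEq, true_and, hχ] at h2
          have h3 := callerOf_succ_call w.letter_mem hc hr
          constructor
          · intro h4
            obtain ⟨ψ, rfl, h5⟩ := h2.1 ⟨h4, _, rfl⟩
            exact ⟨i, h3, h5⟩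
          · rintro ⟨j, hj, h5⟩
            rw [hj.right_unique h3] at h5
            exact (h2.2 ⟨χ, rfl, h5⟩).1

theorem prev_mem_iff {d : Dir} {ψ : Formula (Option P)} (hψ : prev d ψ ∈ closure φ) (i : ℕ) :
    prev d ψ ∈ α i ↔ ∃ j, IsPred w.letter d i j ∧ ψ ∈ α j := by
  cases d with
  | glob =>
    cases i with
    | zero =>
      simp only [H.prev_not_mem_zero hψ, false_iff]
      rintro ⟨j, hj, -⟩
      simp [IsPred] at hj
    | succ i =>
      simp only [IsPred, Nat.succ_inj, exists_eq_left']
      exact (H.global i).2 ψ hψ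
  | abs =>
    by_cases h : ∃ j, AbsSucc w.letter j i
    · obtain ⟨j, hj⟩ := h
      rw [(H.absNextPrev_of_absSucc hl hj).1.1.2 ψ hψ]
      exact ⟨fun h => ⟨j, hj, h⟩, fun ⟨j', hj', h⟩ => by
        rwa [AbsSucc.left_unique hj hj']⟩
    · have htop : prev .abs tru ∉ α i := by
        cases i with
        | zero => exact H.prev_not_mem_zero prev_abs_tru_mem_closure
        | succ i =>
          by_cases hr : IsRet (w.letter (i + 1))
          · have hm : ¬ ∃ k, Matching w.letter k (i + 1) := fun ⟨k, hk⟩ => h ⟨k, Or.inl hk⟩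
            have hc : ¬ IsCall (w.letter i) := fun hc =>
              hm ⟨i, hc, by omega, hr, by simpa using WellMatched.nil⟩
            have h1 := H.beforeRet i (fun h => hc ((H.isCall_iff hl i).2 h))
              ((H.isRet_iff hl _).1 hr)
            exact fun h => hm (h1.2.1.1 h)
          · have hc : IsCall (w.letter i) := by
              by_contra hc
              exact h ⟨i, Or.inr ⟨hc, rfl, hr⟩⟩
            exact (H.afterCall i ((H.isCall_iff hl i).1 hc)
              (fun h => hr ((H.isRet_iff hl _).2 h))).1
      have := (H.atom i).prev_abs htop ψ hψ
      simp only [this, false_iff]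
      exact fun ⟨j, hj, _⟩ => h ⟨j, hj⟩
  | caller => exact H.callerSet_iff hl hψ i

/-- The proposition `p_∞` holds nowhere in the scope of a matched call. -/
theorem pInf_not_mem_of_enclosed {i : ℕ} (h : Enclosed w.letter i) : pInf ∉ α i := by
  obtain ⟨c, j, hm, hci, hij⟩ := h
  have htop : ∀ {k l}, Matching w.letter k l → next .abs tru ∈ α k := fun {k l} hm =>
    ((H.absNextPrev_of_absSucc hl (Or.inl hm)).1.1.1 _ next_abs_tru_mem_closure).2
      (H.atom l).tru_mem
  induction i using Nat.strong_induction_on with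
  | _ i ih =>
    obtain ⟨i, rfl⟩ : ∃ k, i = k + 1 := ⟨i - 1, by omega⟩
    have henc : Enclosed w.letter (i + 1) := ⟨c, j, hm, hci, hij⟩
    by_cases hr : IsRet (w.letter (i + 1))
    · by_cases hk : ∃ k, Matching w.letter k (i + 1)
      · obtain ⟨k, hk⟩ := hk
        rw [← (H.absNextPrev_of_absSucc hl (Or.inl hk)).2]
        have hki := hk.2.1
        refine ih k hki ?_ (by omega)
        rcases lt_trichotomy k c with h | rfl | h
        · have := hk.not_crossing w.letter_mem hm h hci; omega
        · have := hk.right_unique w.letter_mem hm; omega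
        · exact h
      · exact absurd henc (not_enclosed_unmatched_ret w.letter_mem hr hk)
    · by_cases hc : IsCall (w.letter i)
      · obtain ⟨k, hk⟩ := (enclosed_succ_call w.letter_mem hc hr).1 henc
        exact (H.afterCall i ((H.isCall_iff hl i).1 hc)
          (fun h => hr ((H.isRet_iff hl _).2 h))).2.2.1 (htop hk)
      · rw [← (H.absNextPrev_of_absSucc hl (Or.inr ⟨hc, rfl, hr⟩)).2]
        refine ih i (by omega) (lt_of_le_of_ne (by omega) ?_) (by omega)
        rintro rfl; exact hc hm.1

end GenHintikka

/-- If the path from `i` never ends, it visits all later positions (for the abstract path: all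
that lie in the scope of no matched call). -/
theorem reach_of_forall_exists_succ {σ : ℕ → Finset P'} {d : FDir}
    {i : ℕ} (h : ∀ j, Relation.ReflTransGen (IsSucc σ d) i j → ∃ j', IsSucc σ d j j') {k : ℕ}
    (hik : i ≤ k) (hk : d = .abs → ¬ Enclosed σ k) : Relation.ReflTransGen (IsSucc σ d) i k := by
  -- Some step of the path leads from a position `j ≤ k` to a position `j' > k`; unless `j = k`, the
  -- step skips `k`, which then lies between a call and its matching return.
  have key : ∃ j j', j ≤ k ∧ Relation.ReflTransGen (IsSucc σ d) i j ∧ IsSucc σ d j j' ∧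
      k < j' := by
    clear hk
    induction k, hik using Nat.le_induction with
    | base =>
      obtain ⟨j', hj'⟩ := h i .refl
      exact ⟨i, j', le_rfl, .refl, hj', hj'.lt⟩
    | succ k _ ih =>
      obtain ⟨j, j', h1, h2, h3, h4⟩ := ih
      rcases (show k + 1 ≤ j' by omega).lt_or_eq with h5 | rfl
      · exact ⟨j, j', by omega, h2, h3, h5⟩
      · obtain ⟨l, hl⟩ := h _ (h2.tail h3)
        exact ⟨k + 1, l, le_rfl, h2.tail h3, hl, hl.lt⟩
  obtain ⟨j, j', h1, h2, h3, h4⟩ := key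
  rcases h1.lt_or_eq with h5 | rfl
  swap
  · exact h2
  exfalso
  cases d with
  | glob => simp only [IsSucc] at h3; omega
  | abs =>
    rcases h3 with h3 | ⟨-, h3, -⟩
    · exact hk rfl ⟨j, j', h3, h5, h4⟩
    · omega

end Generalized

/-! ### Models and Hintikka sequences -/

section Models
variable {P : Type} [RecProps P]
open Formula

instance optionRecProps : RecProps (Option P) where
  call := some call
  ret := some ret
  intl := some intl
  call_ne_ret := by simpa using call_ne_ret
  call_ne_intl := by simpa using call_ne_intl
  ret_ne_intl := by simpa using ret_ne_intl

open Classical in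
/-- The word `w` with the additional proposition `none` at the positions in `q`. -/
noncomputable def extLetter (w : TimedWord P) (q : ℕ → Prop) (i : ℕ) : Finset (Option P) :=
  (w.letter i).map Function.Embedding.some ∪ if q i then {none} else ∅

theorem some_mem_extLetter {w : TimedWord P} {q : ℕ → Prop} {i : ℕ} {p : P} :
    some p ∈ extLetter w q i ↔ p ∈ w.letter i := by
  unfold extLetter
  split_ifs <;> simp

theorem none_mem_extLetter {w : TimedWord P} {q : ℕ → Prop} {i : ℕ} :
    none ∈ extLetter w q i ↔ q i := by
  unfold extLetter
  split_ifs with h <;> simp [h]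

theorem isCall_extLetter {w : TimedWord P} {q : ℕ → Prop} {i : ℕ} :
    IsCall (extLetter w q i) ↔ IsCall (w.letter i) := by
  change some call ∈ _ ∧ some ret ∉ _ ∧ some intl ∉ _ ↔ _
  simp only [IsCall, some_mem_extLetter]

theorem isRet_extLetter {w : TimedWord P} {q : ℕ → Prop} {i : ℕ} :
    IsRet (extLetter w q i) ↔ IsRet (w.letter i) := by
  change some ret ∈ _ ∧ some call ∉ _ ∧ some intl ∉ _ ↔ _
  simp only [IsRet, some_mem_extLetter]

theorem isInt_extLetter {w : TimedWord P} {q : ℕ → Prop} {i : ℕ} :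
    IsInt (extLetter w q i) ↔ IsInt (w.letter i) := by
  change some intl ∈ _ ∧ some call ∉ _ ∧ some ret ∉ _ ↔ _
  simp only [IsInt, some_mem_extLetter]

/-- The word `w` with the additional proposition `none` at the positions in `q`. -/
noncomputable def extWord (w : TimedWord P) (q : ℕ → Prop) : TimedWord (Option P) where
  letter := extLetter w q
  time := w.time
  letter_mem i := by
    simpa only [isCall_extLetter, isRet_extLetter, isInt_extLetter] using w.letter_mem i
  time_nonneg := w.time_nonneg
  time_mono := w.time_mono
  time_diverges := w.time_diverges

theorem extWord_paths (w : TimedWord P) (q : ℕ → Prop) :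
    AbsSucc (extWord w q).letter = AbsSucc w.letter ∧
    CallerOf (extWord w q).letter = CallerOf w.letter ∧
    Matching (extWord w q).letter = Matching w.letter ∧
    Pos (extWord w q).letter = Pos w.letter :=
  matching_congr (extWord w q).letter_mem w.letter_mem (fun _ => isCall_extLetter)
    (fun _ => isRet_extLetter)

theorem extWord_isSucc (w : TimedWord P) (q : ℕ → Prop) :
    IsSucc (extWord w q).letter = IsSucc w.letter := by
  funext d i j
  cases d <;> simp only [IsSucc, extWord_paths]

theorem extWord_isPred (w : TimedWord P) (q : ℕ → Prop) :
    IsPred (extWord w q).letter = IsPred w.letter := by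
  funext d i j
  cases d <;> simp only [IsPred, extWord_paths]

theorem sat_map_some (w : TimedWord P) (q : ℕ → Prop) (f : Formula P) :
    ∀ i, (f.map some).Sat (extWord w q) i ↔ f.Sat w i := by
  have ht : (extWord w q).time = w.time := rfl
  induction f with
  | prop p => intro i; exact some_mem_extLetter
  | tru => intro i; rfl
  | _ => simp_all only [Formula.map, Formula.Sat, extWord_isSucc, extWord_isPred, extWord_paths,
      implies_true]

theorem within_recorder_iff (w : TimedWord P) (i : ℕ) (d : Dir) (I : Interval) (p : P) :
    (Guard.within I).Sat (clockVal w i (.recorder d p)) ↔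
      ∃ j, LastOcc w d p i j ∧ w.time i - w.time j ∈ I.toSet := by
  have hu : ∀ {j j'}, LastOcc w d p i j → LastOcc w d p i j' → j = j' := by
    rintro j j' ⟨h1, h2, h3, h4⟩ ⟨h1', h2', h3', h4'⟩
    rcases lt_trichotomy j j' with h | h | h
    · exact absurd h2' (h4 _ h h1' h3')
    · exact h
    · exact absurd h2 (h4' _ h h1 h3)
  simp only [Guard.Sat, clockVal]
  by_cases h : ∃ j, LastOcc w d p i j
  · rw [dif_pos h]
    constructor
    · rintro ⟨t, ht, htI⟩
      rw [Option.some.injEq] at ht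
      exact ⟨_, h.choose_spec, ht ▸ htI⟩
    · rintro ⟨j, hj, hI⟩
      exact ⟨_, rfl, by rwa [hu h.choose_spec hj]⟩
  · rw [dif_neg h]
    constructor
    · rintro ⟨t, ht, -⟩; simp at ht
    · rintro ⟨j, hj, -⟩; exact absurd ⟨j, hj⟩ h

theorem within_predictor_iff (w : TimedWord P) (i : ℕ) (d : FDir) (I : Interval) (p : P) :
    (Guard.within I).Sat (clockVal w i (.predictor d p)) ↔
      ∃ j, NextOcc w d p i j ∧ w.time j - w.time i ∈ I.toSet := by
  have hu : ∀ {j j'}, NextOcc w d p i j → NextOcc w d p i j' → j = j' := by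
    rintro j j' ⟨h1, h2, h3, h4⟩ ⟨h1', h2', h3', h4'⟩
    rcases lt_trichotomy j j' with h | h | h
    · exact absurd h2 (h4' _ h1 h h3)
    · exact h
    · exact absurd h2' (h4 _ h1' h h3')
  simp only [Guard.Sat, clockVal]
  by_cases h : ∃ j, NextOcc w d p i j
  · rw [dif_pos h]
    constructor
    · rintro ⟨t, ht, htI⟩
      rw [Option.some.injEq] at ht
      exact ⟨_, h.choose_spec, ht ▸ htI⟩
    · rintro ⟨j, hj, hI⟩
      exact ⟨_, rfl, by rwa [hu h.choose_spec hj]⟩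
  · rw [dif_neg h]
    constructor
    · rintro ⟨t, ht, -⟩; simp at ht
    · rintro ⟨j, hj, -⟩; exact absurd ⟨j, hj⟩ h

theorem sat_prevClock_prop (w : TimedWord P) (q : ℕ → Prop) (d : Dir) (I : Interval) (p : P)
    (i : ℕ) : (prevClock d I (prop (some p))).Sat (extWord w q) i ↔
      (Guard.within I).Sat (clockVal w i (.recorder d p)) := by
  rw [within_recorder_iff]
  have := sat_map_some w q (.prevClock d I (.prop p)) i
  refine this.trans (exists_congr fun j => ?_)
  simp only [Formula.Sat, LastOcc]
  tauto

theorem sat_nextClock_prop (w : TimedWord P) (q : ℕ → Prop) (d : FDir) (I : Interval) (p : P)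
    (i : ℕ) : (nextClock d I (prop (some p))).Sat (extWord w q) i ↔
      (Guard.within I).Sat (clockVal w i (.predictor d p)) := by
  rw [within_predictor_iff]
  have := sat_map_some w q (.nextClock d I (.prop p)) i
  refine this.trans (exists_congr fun j => ?_)
  simp only [Formula.Sat, NextOcc]
  tauto

variable [DecidableEq P] [Fintype P] {φ : Formula P}

omit [DecidableEq P] [Fintype P] in
theorem isLabelling_prop : IsLabelling (fun p : P => (prop (some p) : Formula (Option P))) :=
  ⟨fun p q h => by simpa using h, rfl, rfl, rfl⟩

/-- In a fair Hintikka sequence of a non-recursive formula, the members of an atom are the formulas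
of the closure that hold at its position. For an until the atoms only guarantee the expansion law;
fairness provides a position on the path at which the until is fulfilled or fails, since a position
with `p_∞` lies in the scope of no matched call and hence on every endless abstract path. -/
theorem GenHintikka.truth (hφ : φ.NonRecursive) {w : TimedWord P}
    {α : ℕ → Finset (Formula (Option P))} (H : GenHintikka φ (fun p => prop (some p)) w α)
    (hfair : GenFair φ α) (ψ : Formula (Option P)) : ψ ∈ closure φ →
    ∀ i, ψ ∈ α i ↔ ψ.Sat (extWord w fun i => pInf ∈ α i) i := by
  have hl := isLabelling_prop (P := P)
  set w' := extWord w fun i => pInf ∈ α i with hw'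
  have hS : IsSucc w'.letter = IsSucc w.letter := extWord_isSucc _ _
  have hP : IsPred w'.letter = IsPred w.letter := extWord_isPred _ _
  induction ψ with
  | tru => intro _ i; simp only [(H.atom i).tru_mem, Formula.Sat]
  | prop p =>
    intro _ i
    simp only [Formula.Sat]
    cases p with
    | none => exact (none_mem_extLetter (w := w) (q := fun i => pInf ∈ α i)).symm
    | some p =>
      exact (H.read i p).symm.trans (some_mem_extLetter (q := fun i => pInf ∈ α i)).symm
  | or f g ihf ihg =>
    intro h i
    rw [(H.atom i).or_iff f g h, ihf (mem_closure_of_args h (by simp [args])),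
      ihg (mem_closure_of_args h (by simp [args]))]
    rfl
  | neg f ih =>
    intro h i
    rw [(H.atom i).neg_iff _ h]
    exact not_congr (ih (mem_closure_of_args h (by simp [args])) i)
  | next d f ih =>
    intro h i
    simp only [H.next_mem_iff hl h, ih (mem_closure_of_args h (by simp [args])), Formula.Sat, hS]
    exact exists_congr fun j => ⟨fun h => ⟨h.1.lt, h⟩, fun h => h.2⟩
  | prev d f ih =>
    intro h i
    simp only [H.prev_mem_iff hl h, ih (mem_closure_of_args h (by simp [args])), Formula.Sat, hP]
    exact exists_congr fun j => ⟨fun h => ⟨h.1.lt, h⟩, fun h => h.2⟩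
  | since d f g ihf ihg =>
    intro h i
    have ihf := ihf (mem_closure_of_args h (by simp [args]))
    have ihg := ihg (mem_closure_of_args h (by simp [args]))
    induction i using Nat.strong_induction_on with
    | _ i ih =>
      rw [(H.atom i).since_iff d f g h, sat_since_iff, ihf, ihg,
        H.prev_mem_iff hl (prev_since_mem_closure h)]
      refine or_congr Iff.rfl (and_congr Iff.rfl ?_)
      simp only [Formula.Sat, hP]
      refine exists_congr fun j => ?_
      constructor
      · rintro ⟨h1, h2⟩; exact ⟨h1.lt, h1, (ih j h1.lt).1 h2⟩
      · rintro ⟨h1, h2, h3⟩; exact ⟨h2, (ih j h1).2 h3⟩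
  | untl d f g ihf ihg =>
    intro h i
    have ihf := ihf (mem_closure_of_args h (by simp [args]))
    have ihg := ihg (mem_closure_of_args h (by simp [args]))
    have hunf : ∀ i, untl d f g ∈ α i ↔ g.Sat w' i ∨ (f.Sat w' i ∧
        ∃ j, IsSucc w.letter d i j ∧ untl d f g ∈ α j) := fun i => by
      rw [(H.atom i).untl_iff d f g h, ihf, ihg, H.next_mem_iff hl (next_untl_mem_closure h)]
    constructor
    · intro hU
      by_contra hns
      -- an until that is never fulfilled is postponed forever along an infinite path
      have hall : ∀ j, Relation.ReflTransGen (IsSucc w.letter d) i j →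
          untl d f g ∈ α j ∧ ¬ (untl d f g).Sat w' j := by
        intro j hj
        induction hj with
        | refl => exact ⟨hU, hns⟩
        | @tail j k _ hjk ih =>
          obtain ⟨h1, h2⟩ := ih
          rw [sat_untl_iff] at h2
          push Not at h2
          rcases (hunf j).1 h1 with h3 | ⟨h3, k', h4, h5⟩
          · exact absurd h3 h2.1
          · obtain rfl := IsSucc.right_unique w.letter_mem hjk h4
            refine ⟨h5, fun h6 => h2.2 h3 ⟨k, hjk.lt, ?_, h6⟩⟩
            rwa [hS]
      have hnext : ∀ j, Relation.ReflTransGen (IsSucc w.letter d) i j →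
          ∃ j', IsSucc w.letter d j j' := by
        intro j hj
        obtain ⟨h1, h2⟩ := hall j hj
        rcases (hunf j).1 h1 with h3 | ⟨_, k', h4, _⟩
        · exact absurd ((sat_untl_iff _ _ _ _ _).2 (Or.inl h3)) h2
        · exact ⟨k', h4⟩
      have hk : ∃ k, i ≤ k ∧ (d = .abs → pInf ∈ α k) ∧ (g ∈ α k ∨ neg (untl d f g) ∈ α k) := by
        cases d with
        | glob =>
          obtain ⟨k, h1, h2⟩ := hfair.untl_glob f g h i
          exact ⟨k, h1, by simp, h2⟩
        | abs =>
          obtain ⟨k, h1, h2, h3⟩ := hfair.untl_abs f g h i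
          exact ⟨k, h1, fun _ => h2, h3⟩
      obtain ⟨k, h1, h2, h3⟩ := hk
      have h4 := hall k (reach_of_forall_exists_succ hnext h1 fun hd he =>
        H.pInf_not_mem_of_enclosed hl he (h2 hd))
      rcases h3 with h3 | h3
      · exact h4.2 ((sat_untl_iff _ _ _ _ _).2 (Or.inl ((ihg k).1 h3)))
      · exact ((H.atom k).neg_iff _ (neg_untl_mem_closure h)).1 h3 h4.1
    · rw [sat_untl_iff_path, hS]
      rintro ⟨j, hj, hg, hf⟩
      induction hj using Relation.ReflTransGen.head_induction_on with
      | refl => exact (hunf j).2 (Or.inl hg)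
      | @head i k hik hkj ih =>
        refine (hunf i).2 (Or.inr ⟨hf i ?_ .refl, k, hik, ih fun l hl h => hf l hl (h.head hik)⟩)
        exact hik.lt.trans_le (reflTransGen_le (fun _ _ => IsSucc.lt) hkj)
  | nextClock d I f _ =>
    intro h i
    obtain ⟨p, rfl⟩ := eq_prop_of_nextClock_mem hφ h
    rw [sat_nextClock_prop]
    exact H.future i d I p h
  | prevClock d I f _ =>
    intro h i
    obtain ⟨p, rfl⟩ := eq_prop_of_prevClock_mem hφ h
    rw [sat_prevClock_prop]
    exact H.past i d I p h

open Classical in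
/-- The formulas of the closure that hold at position `i` of `w`, where `p_∞` holds at the
positions in the scope of no matched call. -/
noncomputable def truthSet (φ : Formula P) (w : TimedWord P) (i : ℕ) :
    Finset (Formula (Option P)) :=
  (closure φ).filter fun ψ => ψ.Sat (extWord w fun i => ¬ Enclosed w.letter i) i

theorem mem_truthSet {w : TimedWord P} {i : ℕ} {ψ : Formula (Option P)} :
    ψ ∈ truthSet φ w i ↔
      ψ ∈ closure φ ∧ ψ.Sat (extWord w fun i => ¬ Enclosed w.letter i) i := by
  simp [truthSet]

theorem pInf_mem_truthSet {w : TimedWord P} {i : ℕ} :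
    pInf ∈ truthSet φ w i ↔ ¬ Enclosed w.letter i := by
  rw [mem_truthSet]
  simp only [prop_mem_closure, true_and]
  exact none_mem_extLetter

theorem some_mem_truthSet {w : TimedWord P} {i : ℕ} {p : P} :
    prop (some p) ∈ truthSet φ w i ↔ p ∈ w.letter i := by
  rw [mem_truthSet]
  simp only [prop_mem_closure, true_and]
  exact some_mem_extLetter

theorem next_mem_truthSet {w : TimedWord P} {i : ℕ} {d : FDir} {ψ : Formula (Option P)}
    (h : next d ψ ∈ closure φ) :
    next d ψ ∈ truthSet φ w i ↔ ∃ j, IsSucc w.letter d i j ∧ ψ ∈ truthSet φ w j := by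
  have hψ : ψ ∈ closure φ := mem_closure_of_args h (by simp [args])
  simp only [mem_truthSet, h, hψ, true_and, Formula.Sat, extWord_isSucc]
  exact exists_congr fun j => ⟨fun h => h.2, fun h => ⟨h.1.lt, h⟩⟩

theorem prev_mem_truthSet {w : TimedWord P} {i : ℕ} {d : Dir} {ψ : Formula (Option P)}
    (h : prev d ψ ∈ closure φ) :
    prev d ψ ∈ truthSet φ w i ↔ ∃ j, IsPred w.letter d i j ∧ ψ ∈ truthSet φ w j := by
  have hψ : ψ ∈ closure φ := mem_closure_of_args h (by simp [args])
  simp only [mem_truthSet, h, hψ, true_and, Formula.Sat, extWord_isPred]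
  exact exists_congr fun j => ⟨fun h => h.2, fun h => ⟨h.1.lt, h⟩⟩

theorem tru_mem_truthSet {w : TimedWord P} {i : ℕ} : tru ∈ truthSet φ w i :=
  mem_truthSet.2 ⟨tru_mem_closure, trivial⟩

theorem isAtom_truthSet (w : TimedWord P) (i : ℕ) : IsAtom φ (truthSet φ w i) where
  sub := fun ψ h => (mem_truthSet.1 h).1
  tru_mem := tru_mem_truthSet
  neg_iff ψ h := by
    simp only [mem_truthSet, h, negate_mem_closure h, true_and]
    by_cases hn : ∀ f, ψ ≠ neg f
    · rw [negate_of_not_neg hn]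
      exact not_not.symm
    · push Not at hn
      obtain ⟨f, rfl⟩ := hn
      rfl
  or_iff f g h := by
    have hf : f ∈ closure φ := mem_closure_of_args h (by simp [args])
    have hg : g ∈ closure φ := mem_closure_of_args h (by simp [args])
    simp only [mem_truthSet, h, hf, hg, true_and, Formula.Sat]
  exactly_one := by
    simp only [some_mem_truthSet]
    exact w.letter_mem i
  untl_iff d f g h := by
    have hf : f ∈ closure φ := mem_closure_of_args h (by simp [args])
    have hg : g ∈ closure φ := mem_closure_of_args h (by simp [args])
    simp only [mem_truthSet, h, hf, hg, next_untl_mem_closure h, true_and]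
    exact sat_untl_iff _ _ _ _ _
  since_iff d f g h := by
    have hf : f ∈ closure φ := mem_closure_of_args h (by simp [args])
    have hg : g ∈ closure φ := mem_closure_of_args h (by simp [args])
    simp only [mem_truthSet, h, hf, hg, prev_since_mem_closure h, true_and]
    exact sat_since_iff _ _ _ _ _
  next_abs h ψ hψ h' := by
    rw [next_mem_truthSet hψ] at h'
    obtain ⟨j, hj, -⟩ := h'
    exact h ((next_mem_truthSet next_abs_tru_mem_closure).2 ⟨j, hj, tru_mem_truthSet⟩)
  prev_abs h ψ hψ h' := by
    rw [prev_mem_truthSet hψ] at h'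
    obtain ⟨j, hj, -⟩ := h'
    exact h ((prev_mem_truthSet prev_abs_tru_mem_closure).2 ⟨j, hj, tru_mem_truthSet⟩)

theorem callerSet_truthSet (w : TimedWord P) (i : ℕ) : callerSet (truthSet φ w i) =
    {χ | χ ∈ closure φ ∧ ∃ ψ, χ = prev .caller ψ ∧ ∃ j, CallerOf w.letter i j ∧
      ψ ∈ truthSet φ w j} := by
  ext χ
  simp only [callerSet, Set.mem_ofPred_eq]
  constructor
  · rintro ⟨h, ψ, rfl⟩
    have h1 := (mem_truthSet.1 h).1
    exact ⟨h1, ψ, rfl, (prev_mem_truthSet h1).1 h⟩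
  · rintro ⟨h, ψ, rfl, h1⟩
    exact ⟨(prev_mem_truthSet h).2 h1, ψ, rfl⟩

theorem absNextPrev_truthSet {w : TimedWord P} {i j : ℕ} (h : AbsSucc w.letter i j) :
    AbsNextPrev φ (truthSet φ w i) (truthSet φ w j) ∧
      (pInf ∈ truthSet φ w i ↔ pInf ∈ truthSet φ w j) := by
  refine ⟨⟨⟨fun ψ hψ => ?_, fun ψ hψ => ?_⟩, ?_⟩, ?_⟩
  · rw [next_mem_truthSet hψ]
    exact ⟨fun ⟨j', h1, h2⟩ => by rwa [AbsSucc.right_unique w.letter_mem h h1],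
      fun h1 => ⟨j, h, h1⟩⟩
  · rw [prev_mem_truthSet hψ]
    exact ⟨fun ⟨j', h1, h2⟩ => by rwa [AbsSucc.left_unique h h1],
      fun h1 => ⟨i, h, h1⟩⟩
  · simp only [callerSet_truthSet, callerOf_congr w.letter_mem h.cstk_eq]
  · rw [pInf_mem_truthSet, pInf_mem_truthSet, enclosed_congr_abs w.letter_mem h]

theorem genHintikka_truthSet (w : TimedWord P) :
    GenHintikka φ (fun p => prop (some p)) w (truthSet φ w) where
  read i p := some_mem_truthSet.symm
  atom := isAtom_truthSet w
  initial d ψ h := by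
    refine mem_truthSet.2 ⟨neg_prev_mem_closure h, ?_⟩
    rintro ⟨j, hj, -⟩
    omega
  global i := by
    refine ⟨fun ψ hψ => ?_, fun ψ hψ => ?_⟩
    · simp [next_mem_truthSet hψ, IsSucc]
    · simp [prev_mem_truthSet hψ, IsPred]
  step i h1 h2 := by
    rw [← isCall_iff_of_read isLabelling_prop (fun i p => some_mem_truthSet.symm)] at h1
    rw [← isRet_iff_of_read isLabelling_prop (fun i p => some_mem_truthSet.symm)] at h2
    exact absNextPrev_truthSet (Or.inr ⟨h1, rfl, h2⟩)
  beforeRet i h1 h2 := by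
    rw [← isCall_iff_of_read isLabelling_prop (fun i p => some_mem_truthSet.symm)] at h1
    rw [← isRet_iff_of_read isLabelling_prop (fun i p => some_mem_truthSet.symm)] at h2
    have h3 : prev .abs tru ∈ truthSet φ w (i + 1) ↔ ∃ j, Matching w.letter j (i + 1) := by
      simp only [prev_mem_truthSet prev_abs_tru_mem_closure, IsPred, absSucc_ret_iff h2,
        tru_mem_truthSet, and_true]
    refine ⟨fun h => ?_, h3, fun h => ?_⟩
    · obtain ⟨j, hj, -⟩ := (next_mem_truthSet next_abs_tru_mem_closure).1 h
      rcases hj with hj | ⟨-, rfl, hj⟩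
      · exact h1 hj.1
      · exact hj h2
    · rw [h3] at h
      have h4 := not_enclosed_unmatched_ret w.letter_mem h2 h
      refine ⟨?_, pInf_mem_truthSet.2 h4, ?_⟩
      · rw [pInf_mem_truthSet]
        rintro ⟨c, d, hm, h5, h6⟩
        rcases (show i + 1 ≤ d by omega).lt_or_eq with h7 | rfl
        · exact h4 ⟨c, d, hm, by omega, h7⟩
        · exact h ⟨c, hm⟩
      · rw [callerSet_truthSet, Set.eq_empty_iff_forall_notMem]
        rintro χ ⟨-, ψ, -, j, hj, -⟩
        exact not_callerOf_unmatched w.letter_mem h2 h hj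
  unmatchedCall i h1 h2 := by
    rw [← isCall_iff_of_read isLabelling_prop (fun i p => some_mem_truthSet.symm)] at h1
    refine ⟨fun h => ?_, ?_⟩
    · obtain ⟨j, hj, -⟩ := (next_mem_truthSet next_abs_tru_mem_closure).1 h
      exact h2 ⟨j, hj⟩
    · exact pInf_mem_truthSet.2 (not_enclosed_unmatched_call w.letter_mem h1
        fun ⟨k, hk⟩ => h2 ⟨k, Or.inl hk⟩)
  matchedCall i j _ h := absNextPrev_truthSet h
  afterCall i h1 h2 := by
    rw [← isCall_iff_of_read isLabelling_prop (fun i p => some_mem_truthSet.symm)] at h1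
    rw [← isRet_iff_of_read isLabelling_prop (fun i p => some_mem_truthSet.symm)] at h2
    refine ⟨fun h => ?_, ?_, ?_⟩
    · obtain ⟨j, hj, -⟩ := (prev_mem_truthSet prev_abs_tru_mem_closure).1 h
      rcases hj with hj | ⟨hj, hij, -⟩
      · exact h2 hj.2.2.1
      · obtain rfl : i = j := by omega
        exact hj h1
    · rw [callerSet_truthSet]
      have h3 := callerOf_succ_call w.letter_mem h1 h2
      ext χ
      simp only [Set.mem_ofPred_eq]
      refine and_congr Iff.rfl (exists_congr fun ψ => and_congr Iff.rfl ?_)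
      exact ⟨fun ⟨j, hj, h⟩ => by rwa [h3.right_unique hj], fun h => ⟨i, h3, h⟩⟩
    · rw [pInf_mem_truthSet, not_not, enclosed_succ_call w.letter_mem h1 h2,
        next_mem_truthSet next_abs_tru_mem_closure]
      simp only [IsSucc, absSucc_call_iff h1, tru_mem_truthSet, and_true]
  past i d I p h := by
    rw [mem_truthSet, sat_prevClock_prop]
    simp only [h, true_and]
  future i d I p h := by
    rw [mem_truthSet, sat_nextClock_prop]
    simp only [h, true_and]

theorem genFair_truthSet (w : TimedWord P) : GenFair φ (truthSet φ w) where
  inf m := by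
    obtain ⟨i, h1, h2⟩ := exists_not_enclosed w.letter_mem m
    exact ⟨i, h1, pInf_mem_truthSet.2 h2⟩
  untl_glob f g h m := by
    by_cases hU : (untl .glob f g).Sat (extWord w fun i => ¬ Enclosed w.letter i) m
    · obtain ⟨j, h1, -, h3, -⟩ := hU
      exact ⟨j, h1, Or.inl (mem_truthSet.2 ⟨mem_closure_of_args h (by simp [args]), h3⟩)⟩
    · exact ⟨m, le_rfl, Or.inr (mem_truthSet.2 ⟨neg_untl_mem_closure h, hU⟩)⟩
  untl_abs f g h m := by
    obtain ⟨i, h1, h2⟩ := exists_not_enclosed w.letter_mem m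
    by_cases hU : (untl .abs f g).Sat (extWord w fun i => ¬ Enclosed w.letter i) i
    · -- the scope of matched calls is constant along an abstract path
      obtain ⟨j, hj, h3, -⟩ := (sat_untl_iff_path _ _ _ _ _).1 hU
      rw [extWord_isSucc] at hj
      refine ⟨j, h1.trans (reflTransGen_le (fun _ _ => IsSucc.lt) hj), ?_,
        Or.inl (mem_truthSet.2 ⟨mem_closure_of_args h (by simp [args]), h3⟩)⟩
      rw [pInf_mem_truthSet]
      clear h3 hU h1
      induction hj with
      | refl => exact h2
      | tail _ h ih => rwa [← enclosed_congr_abs w.letter_mem h]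
    · exact ⟨i, h1, pInf_mem_truthSet.2 h2,
        Or.inr (mem_truthSet.2 ⟨neg_untl_mem_closure h, hU⟩)⟩

/-- The models of a non-recursive formula are the words that carry an initialized fair Hintikka
sequence. -/
theorem exists_genHintikka_iff (hφ : φ.NonRecursive) (w : TimedWord P) :
    (∃ α, GenHintikka φ (fun p => prop (some p)) w α ∧ GenFair φ α ∧ φ.map some ∈ α 0) ↔
      φ.IsModel w := by
  constructor
  · rintro ⟨α, H, hf, h0⟩
    have := (H.truth hφ hf _ map_some_mem_closure 0).1 h0
    exact (sat_map_some _ _ _ _).1 this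
  · intro h
    exact ⟨truthSet φ w, genHintikka_truthSet w, genFair_truthSet w,
      mem_truthSet.2 ⟨map_some_mem_closure, (sat_map_some _ _ _ _).2 h⟩⟩

end Models

section Original
variable {P : Type} [DecidableEq P] [Fintype P] [RecProps P] {φ : Formula P}
open Formula

omit [RecProps P] in
theorem mem_fset {a : Finset (ClProp φ)} {p : ClProp φ} : p.1 ∈ fset a ↔ p ∈ a := by
  simp [fset]

theorem isLabelling_val : IsLabelling (Subtype.val : ClProp φ → Formula (Option P)) :=
  ⟨Subtype.val_injective, rfl, rfl, rfl⟩

/-- Over the alphabet of the closure, the sequence of atoms is the word itself. -/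
theorem exists_genHintikka_val_iff (w : TimedWord (ClProp φ)) :
    (∃ α, GenHintikka φ Subtype.val w α ∧ GenFair φ α ∧ φ.map some ∈ α 0) ↔
      IsInitFairHintikka φ w := by
  constructor
  · rintro ⟨α, H, hf, h0⟩
    obtain rfl : α = fun i => fset (w.letter i) := by
      funext i
      ext ψ
      constructor
      · intro h
        have hψ := (H.atom i).sub h
        exact mem_fset.2 ((H.read i ⟨ψ, hψ⟩).2 h)
      · intro h
        obtain ⟨p, hp, rfl⟩ := Finset.mem_map.1 h
        exact (H.read i p).1 hp
    exact ⟨⟨H.atom, H.initial, H.global, H.step, H.beforeRet, H.unmatchedCall, H.matchedCall,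
      H.afterCall, H.past, H.future⟩, ⟨hf.inf, hf.untl_glob, hf.untl_abs⟩, h0⟩
  · rintro ⟨H, hf, h0⟩
    exact ⟨fun i => fset (w.letter i), ⟨fun i p => mem_fset.symm, H.atom, H.initial, H.global,
      H.step, H.beforeRet, H.unmatchedCall, H.matchedCall, H.afterCall, H.past, H.future⟩,
      ⟨hf.inf, hf.untl_glob, hf.untl_abs⟩, h0⟩

end Original
end ECNTL
namespace ECNTL
open RecProps

/-! ### Hintikka sequences by local conditions -/

section Local
variable {P : Type} [DecidableEq P] [Fintype P] [RecProps P] {P' : Type} [RecProps P']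
open Formula

/-- The conditions on consecutive members of a Hintikka sequence that do not refer to matching
pairs. -/
structure LocalStep (φ : Formula P) (A B : Finset (Formula (Option P))) : Prop where
  atom : IsAtom φ A
  global : NextPrev φ A B
  step : prop (some call) ∉ A → prop (some ret) ∉ B → AbsNextPrev φ A B ∧ (pInf ∈ A ↔ pInf ∈ B)
  beforeRet : prop (some call) ∉ A → prop (some ret) ∈ B → next .abs tru ∉ A ∧
    (prev .abs tru ∉ B → pInf ∈ A ∧ pInf ∈ B ∧ callerSet B = ∅)
  unmatchedCall : prop (some call) ∈ A → next .abs tru ∉ A → pInf ∈ A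
  afterCall : prop (some call) ∈ A → prop (some ret) ∉ B →
    prev .abs tru ∉ B ∧
    callerSet B = {χ | χ ∈ closure φ ∧ ∃ ψ, χ = prev .caller ψ ∧ ψ ∈ A} ∧
    (next .abs tru ∈ A ↔ pInf ∉ B)

/-- The condition on the members of a Hintikka sequence at a call and at its matching return. -/
def LocalPop (φ : Formula P) (A B : Finset (Formula (Option P))) : Prop :=
  AbsNextPrev φ A B ∧ (pInf ∈ A ↔ pInf ∈ B)

/-- The real-time formulas in `A` are those that hold at position `i`, where the formulas to which
the modalities are applied are read off the letters. -/
def ClocksAgree (φ : Formula P) (lab : P' → Formula (Option P)) (w : TimedWord P') (i : ℕ)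
    (A : Finset (Formula (Option P))) : Prop :=
  (∀ d I p, prevClock d I (lab p) ∈ closure φ →
    (prevClock d I (lab p) ∈ A ↔ (Guard.within I).Sat (clockVal w i (.recorder d p)))) ∧
  ∀ d I p, nextClock d I (lab p) ∈ closure φ →
    (nextClock d I (lab p) ∈ A ↔ (Guard.within I).Sat (clockVal w i (.predictor d p)))

variable {φ : Formula P} {lab : P' → Formula (Option P)} {w : TimedWord P'}
  {α : ℕ → Finset (Formula (Option P))}

/-- After an unmatched call whose atom promises a matching return, `p_∞` never holds: the promise
makes `p_∞` fail at the next position, and the failure is inherited along abstract successors and,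
because calls without `p_∞` promise a matching return too, at the first positions in the scope of
calls. -/
theorem pInf_not_mem_of_unmatched (hl : IsLabelling lab)
    (read : ∀ i p, p ∈ w.letter i ↔ lab p ∈ α i)
    (hstep : ∀ i, LocalStep φ (α i) (α (i + 1)))
    (hpop : ∀ i j, Matching w.letter i j → LocalPop φ (α i) (α j)) {i : ℕ}
    (hc : IsCall (w.letter i)) (hm : ¬ ∃ j, Matching w.letter i j)
    (htop : next .abs tru ∈ α i) (k : ℕ) (hik : i < k) : pInf ∉ α k := by
  have hcall := isCall_iff_of_read hl read
  have hret := isRet_iff_of_read hl read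
  induction k using Nat.strong_induction_on with
  | _ k ih =>
    obtain ⟨k, rfl⟩ : ∃ l, k = l + 1 := ⟨k - 1, by omega⟩
    by_cases hr : IsRet (w.letter (k + 1))
    · have hi : i ∈ pstk w.letter (k + 1) :=
        (mem_pstk_iff w.letter_mem hc hik).2 fun ⟨j, _, hj⟩ => hm ⟨j, hj⟩
      cases hst : pstk w.letter (k + 1) with
      | nil => simp [hst] at hi
      | cons a l =>
        have ha := matching_of_pstk w.letter_mem hr hst
        have hia := le_head_of_mem_pstk w.letter_mem hst hi
        rcases hia.lt_or_eq with h | rfl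
        · rw [← (hpop a _ ha).2]
          exact ih a ha.2.1 h
        · exact absurd ⟨_, ha⟩ hm
    · have hr' := fun h => hr ((hret _).2 h)
      by_cases hk : IsCall (w.letter k)
      · refine ((hstep k).afterCall ((hcall k).1 hk) hr').2.2.1 ?_
        rcases (show i ≤ k by omega).lt_or_eq with h | rfl
        · by_contra hn
          exact ih k (by omega) h ((hstep k).unmatchedCall ((hcall k).1 hk) hn)
        · exact htop
      · rw [← ((hstep k).step (fun h => hk ((hcall k).2 h)) hr').2]
        refine ih k (by omega) (lt_of_le_of_ne (by omega) ?_)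
        rintro rfl; exact hk hc

/-- Given fairness, the conditions on Hintikka sequences are local: they relate consecutive
positions, and a call to its matching return. That a call without matching return does not contain
`X^a ⊤` is not local; it follows because otherwise `p_∞` would fail from there on. -/
theorem genHintikka_iff_local (hl : IsLabelling lab) (hinf : ∀ m, ∃ i, m ≤ i ∧ pInf ∈ α i) :
    GenHintikka φ lab w α ↔
      (∀ i p, p ∈ w.letter i ↔ lab p ∈ α i) ∧
      (∀ d ψ, prev d ψ ∈ closure φ → neg (prev d ψ) ∈ α 0) ∧
      (∀ i, LocalStep φ (α i) (α (i + 1))) ∧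
      (∀ i j, Matching w.letter i j → LocalPop φ (α i) (α j)) ∧
      (∀ i, IsRet (w.letter i) → (¬ ∃ k, Matching w.letter k i) → prev .abs tru ∉ α i) ∧
      ∀ i, ClocksAgree φ lab w i (α i) := by
  constructor
  · intro H
    refine ⟨H.read, H.initial, fun i => ⟨H.atom i, H.global i, H.step i, fun h1 h2 => ?_,
      fun h1 h2 => ?_, H.afterCall i⟩, fun i j h => H.absNextPrev_of_absSucc hl (Or.inl h),
      fun i hi hm => ?_, fun i => ⟨H.past i, H.future i⟩⟩
    · obtain ⟨h3, -, h4⟩ := H.beforeRet i h1 h2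
      exact ⟨h3, h4⟩
    · refine (H.unmatchedCall i h1 fun ⟨j, hj⟩ => h2 ?_).2
      exact ((H.absNextPrev_of_absSucc hl hj).1.1.1 _ next_abs_tru_mem_closure).2
        (H.atom j).tru_mem
    · intro h
      obtain ⟨j, hj, -⟩ := (H.prev_mem_iff hl prev_abs_tru_mem_closure i).1 h
      exact hm ⟨j, (absSucc_ret_iff hi).1 hj⟩
  · rintro ⟨read, hinit, hstep, hpop, hbot, hclk⟩
    have hcall := isCall_iff_of_read hl read
    have hret := isRet_iff_of_read hl read
    refine ⟨read, fun i => (hstep i).atom, hinit, fun i => (hstep i).global,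
      fun i => (hstep i).step, fun i h1 h2 => ?_, fun i h1 h2 => ?_, fun i j h1 h2 => ?_,
      fun i => (hstep i).afterCall, fun i => (hclk i).1, fun i => (hclk i).2⟩
    · obtain ⟨h3, h4⟩ := (hstep i).beforeRet h1 h2
      refine ⟨h3, ⟨fun h => ?_, fun ⟨j, hj⟩ => ?_⟩, h4⟩
      · by_contra hn
        exact hbot _ ((hret _).2 h2) hn h
      · exact ((hpop j _ hj).1.1.2 _ prev_abs_tru_mem_closure).2 (hstep j).atom.tru_mem
    · have hc := (hcall i).2 h1
      have hm : ¬ ∃ j, Matching w.letter i j := fun ⟨j, hj⟩ => h2 ⟨j, Or.inl hj⟩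
      have htop : next .abs tru ∉ α i := by
        intro h
        obtain ⟨k, h3, h4⟩ := hinf (i + 1)
        exact pInf_not_mem_of_unmatched hl read hstep hpop hc hm h k (by omega) h4
      exact ⟨htop, (hstep i).unmatchedCall h1 htop⟩
    · exact hpop i j ((absSucc_call_iff ((hcall i).2 h1)).1 h2)

end Local

/-! ### Clock constraints for real-time formulas -/

/-- The values below the interval `I`. -/
def Interval.below (I : Interval) : Interval := ⟨0, true, some (I.lo, !I.loClosed)⟩

/-- The guard for the values above the interval `I`. If there are none, the guard is one that
excludes `I` anyway. -/
def Interval.above (I : Interval) : Guard :=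
  match I.hi with
  | none => .undef
  | some (b, c) => .within ⟨b, !c, none⟩

/-- The complement of an interval is covered by three atomic constraints. -/
theorem not_within_iff (I : Interval) {v : Option ℝ} (hv : ∀ t, v = some t → 0 ≤ t) :
    ¬ (Guard.within I).Sat v ↔
      (Guard.within I.below).Sat v ∨ I.above.Sat v ∨ Guard.undef.Sat v := by
  obtain ⟨lo, lc, hi⟩ := I
  rcases v with _ | t
  · simp [Guard.Sat]
  · have ht := hv t rfl
    rcases hi with _ | ⟨b, c⟩
    · cases lc <;> simp [Guard.Sat, Interval.below, Interval.above, Interval.toSet, ht]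
    · cases lc <;> cases c <;>
        simp [Guard.Sat, Interval.below, Interval.above, Interval.toSet, ht] <;>
        grind

/-- The guards used for a real-time formula with interval `I`. -/
def Interval.guards (I : Interval) : Finset Guard :=
  {.within I, .within I.below, I.above, .undef}

theorem Interval.guards_consts {I : Interval} {g : Guard} (hg : g ∈ I.guards) :
    g.consts ⊆ insert 0 I.consts := by
  obtain ⟨lo, lc, hi⟩ := I
  simp only [Interval.guards, Finset.mem_insert, Finset.mem_singleton] at hg
  rcases hg with rfl | rfl | rfl | rfl
  · exact Finset.subset_insert _ _
  · rcases hi with _ | ⟨b, c⟩ <;>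
      simp [Guard.consts, Interval.consts, Interval.below, Finset.insert_subset_iff]
  · rcases hi with _ | ⟨b, c⟩ <;>
      simp [Guard.consts, Interval.consts, Interval.above]
  · simp [Guard.consts]

theorem clockVal_nonneg {P' : Type} [RecProps P'] (w : TimedWord P') (i : ℕ) (z : Clock P')
    {t : ℝ} (h : clockVal w i z = some t) : 0 ≤ t := by
  cases z with
  | recorder d p =>
    simp only [clockVal] at h
    split_ifs at h with h1
    rw [Option.some.injEq] at h
    rw [← h, sub_nonneg]
    exact w.time_mono h1.choose_spec.1.le
  | predictor d p =>
    simp only [clockVal] at h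
    split_ifs at h with h1
    rw [Option.some.injEq] at h
    rw [← h, sub_nonneg]
    exact w.time_mono h1.choose_spec.1.le

section Guards
variable {P : Type} [DecidableEq P] [Fintype P] [RecProps P]
  {P' : Type} [RecProps P'] [Fintype P'] [DecidableEq P']
open Formula

/-- The atomic constraints used for the formula `χ`. -/
def guardPairs (lab : P' → Formula (Option P)) : Formula (Option P) → Finset (Clock P' × Guard)
  | prevClock d I f => (Finset.univ.filter fun p => lab p = f).biUnion fun p =>
      I.guards.image fun g => (Clock.recorder d p, g)
  | nextClock d I f => (Finset.univ.filter fun p => lab p = f).biUnion fun p =>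
      I.guards.image fun g => (Clock.predictor d p, g)
  | _ => ∅

/-- The atomic constraints used for the real-time formulas in the closure of `φ`. -/
def guardSet (φ : Formula P) (lab : P' → Formula (Option P)) : Finset (Clock P' × Guard) :=
  (closure φ).biUnion (guardPairs lab)

/-- The constraint `θ` contains, for each real-time formula, an atomic constraint for its truth or
falsity according to its membership in `A`. -/
def GuardsFor (φ : Formula P) (lab : P' → Formula (Option P)) (A : Finset (Formula (Option P)))
    (θ : Constraint P') : Prop :=
  (∀ d I p, prevClock d I (lab p) ∈ closure φ →
    (prevClock d I (lab p) ∈ A → (Clock.recorder d p, Guard.within I) ∈ θ) ∧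
    (prevClock d I (lab p) ∉ A → (Clock.recorder d p, Guard.within I.below) ∈ θ ∨
      (Clock.recorder d p, I.above) ∈ θ ∨ (Clock.recorder d p, Guard.undef) ∈ θ)) ∧
  ∀ d I p, nextClock d I (lab p) ∈ closure φ →
    (nextClock d I (lab p) ∈ A → (Clock.predictor d p, Guard.within I) ∈ θ) ∧
    (nextClock d I (lab p) ∉ A → (Clock.predictor d p, Guard.within I.below) ∈ θ ∨
      (Clock.predictor d p, I.above) ∈ θ ∨ (Clock.predictor d p, Guard.undef) ∈ θ)

variable {φ : Formula P} {lab : P' → Formula (Option P)} {w : TimedWord P'}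

omit [RecProps P] [RecProps P'] in
theorem recorder_mem_guardSet {d : Dir} {I : Interval} {p : P'} {g : Guard}
    (h : prevClock d I (lab p) ∈ closure φ) (hg : g ∈ I.guards) :
    (Clock.recorder d p, g) ∈ guardSet φ lab := by
  refine Finset.mem_biUnion.2 ⟨_, h, ?_⟩
  simp [guardPairs, hg]

omit [RecProps P] [RecProps P'] in
theorem predictor_mem_guardSet {d : FDir} {I : Interval} {p : P'} {g : Guard}
    (h : nextClock d I (lab p) ∈ closure φ) (hg : g ∈ I.guards) :
    (Clock.predictor d p, g) ∈ guardSet φ lab := by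
  refine Finset.mem_biUnion.2 ⟨_, h, ?_⟩
  simp [guardPairs, hg]

omit [RecProps P] in
/-- The real-time formulas at a position are right iff some constraint that asserts them is
satisfied. -/
theorem clocksAgree_iff (i : ℕ) (A : Finset (Formula (Option P))) :
    ClocksAgree φ lab w i A ↔
      ∃ θ ⊆ guardSet φ lab, GuardsFor φ lab A θ ∧ Constraint.Sat θ w i := by
  classical
  have hI : ∀ I : Interval, Guard.within I ∈ I.guards ∧ Guard.within I.below ∈ I.guards ∧
      I.above ∈ I.guards ∧ Guard.undef ∈ I.guards := by simp [Interval.guards]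
  have hn : ∀ (I : Interval) (z : Clock P'), ¬ (Guard.within I).Sat (clockVal w i z) ↔ _ :=
    fun I z => not_within_iff I fun t ht => clockVal_nonneg w i z ht
  constructor
  · intro h
    -- The constraint consists of all the available atomic constraints that are true.
    refine ⟨(guardSet φ lab).filter fun c => c.2.Sat (clockVal w i c.1), Finset.filter_subset _ _,
      ⟨fun d I p hp => ?_, fun d I p hp => ?_⟩, fun c hc => (Finset.mem_filter.1 hc).2⟩
    · simp only [Finset.mem_filter, recorder_mem_guardSet hp, hI, true_and]
      exact ⟨(h.1 d I p hp).1, fun h' => (hn I _).1 fun h'' => h' ((h.1 d I p hp).2 h'')⟩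
    · simp only [Finset.mem_filter, predictor_mem_guardSet hp, hI, true_and]
      exact ⟨(h.2 d I p hp).1, fun h' => (hn I _).1 fun h'' => h' ((h.2 d I p hp).2 h'')⟩
  · rintro ⟨θ, -, hθ, hs⟩
    refine ⟨fun d I p hp => ⟨fun h => hs _ ((hθ.1 d I p hp).1 h), fun h => ?_⟩,
      fun d I p hp => ⟨fun h => hs _ ((hθ.2 d I p hp).1 h), fun h => ?_⟩⟩
    · by_contra hc
      refine (hn I _).2 ?_ h
      rcases (hθ.1 d I p hp).2 hc with h' | h' | h'
      · exact Or.inl (hs _ h')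
      · exact Or.inr (Or.inl (hs _ h'))
      · exact Or.inr (Or.inr (hs _ h'))
    · by_contra hc
      refine (hn I _).2 ?_ h
      rcases (hθ.2 d I p hp).2 hc with h' | h' | h'
      · exact Or.inl (hs _ h')
      · exact Or.inr (Or.inl (hs _ h'))
      · exact Or.inr (Or.inr (hs _ h'))

end Guards
end ECNTL
namespace ECNTL
open RecProps Data

/-! ### Codes of formulas -/

section Codes

theorem tag_inj {k l : ℕ} : tag k = tag l ↔ k = l := by
  refine ⟨fun h => ?_, fun h => h ▸ rfl⟩
  have := congrArg Data.size h
  simp only [size_tag] at this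
  omega

theorem listCode_injective : Function.Injective listCode := fun l m h => by
  simpa using congrArg Data.toList h

theorem code_bool_injective : Function.Injective (Enc.code : Bool → Data) := by
  intro a b
  cases a <;> cases b <;> simp [Enc.code, tag_inj]

theorem code_nat_injective : Function.Injective (Enc.code : ℕ → Data) := by
  have key : ∀ k : ℕ, k.bits.foldr Nat.bit 0 = k := by
    intro k
    induction k using Nat.binaryRec' with
    | zero => simp
    | bit b k h ih => rw [Nat.bits_append_bit _ _ h, List.foldr_cons, ih]
  intro a b h
  have h1 : a.bits = b.bits := List.map_injective_iff.2 code_bool_injective (listCode_injective h)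
  rw [← key a, ← key b, h1]

theorem code_fin_injective {m : ℕ} : Function.Injective (Enc.code : Fin m → Data) :=
  code_nat_injective.comp Fin.val_injective

theorem code_option_injective {α : Type} [Enc α] (h : Function.Injective (Enc.code : α → Data)) :
    Function.Injective (Enc.code : Option α → Data) := by
  intro a b
  cases a <;> cases b <;> simp only [Enc.code, reduceCtorEq, imp_self,
    Data.cons.injEq, true_and, Option.some.injEq]
  exact fun h' => h h'

theorem code_dir_injective : Function.Injective (Enc.code : Dir → Data) := by
  intro a b
  cases a <;> cases b <;> simp [Enc.code, tag_inj]

theorem code_fDir_injective : Function.Injective (Enc.code : FDir → Data) := by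
  intro a b
  cases a <;> cases b <;> simp [Enc.code, tag_inj, FDir.toDir]

theorem code_interval_injective : Function.Injective (Enc.code : Interval → Data) := by
  rintro ⟨lo, lc, hi⟩ ⟨lo', lc', hi'⟩ h
  simp only [Enc.code, Data.cons.injEq] at h
  obtain ⟨h1, h2, h3⟩ := h
  obtain rfl := code_nat_injective h1
  obtain rfl := code_bool_injective h2
  rcases hi with _ | ⟨b, c⟩ <;> rcases hi' with _ | ⟨b', c'⟩ <;>
    simp only [reduceCtorEq, Data.cons.injEq] at h3
  · rfl
  · rw [code_nat_injective h3.1, code_bool_injective h3.2]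

theorem code_guard_injective : Function.Injective (Enc.code : Guard → Data) := by
  rintro (I | _) (J | _) h
  · rw [code_interval_injective (Data.cons.inj h).2]
  · cases h
  · cases h
  · rfl

theorem code_clock_injective {α : Type} [Enc α] (h : Function.Injective (Enc.code : α → Data)) :
    Function.Injective (Enc.code : Clock α → Data) := by
  rintro (⟨d, p⟩ | ⟨d, p⟩) (⟨d', p'⟩ | ⟨d', p'⟩) h' <;>
    simp only [Enc.code, Data.cons.injEq, tag_inj] at h'
  · rw [code_dir_injective h'.2.1, h h'.2.2]
  · simp at h'
  · simp at h'
  · rw [code_fDir_injective h'.2.1, h h'.2.2]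

theorem code_formula_injective {α : Type} [Enc α] (h : Function.Injective (Enc.code : α → Data)) :
    Function.Injective (Formula.code : Formula α → Data) := by
  intro f
  induction f with
  | tru => intro g hg; cases g <;> simp [Formula.code, tag_inj] at hg ⊢
  | prop p =>
    intro g hg
    cases g <;> simp [Formula.code, tag_inj] at hg ⊢
    exact h hg
  | or a b iha ihb =>
    intro g hg
    cases g <;> simp [Formula.code, tag_inj] at hg ⊢
    exact ⟨iha hg.1, ihb hg.2⟩
  | neg a ih =>
    intro g hg
    cases g <;> simp [Formula.code, tag_inj] at hg ⊢
    exact ih hg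
  | next d a ih =>
    intro g hg
    cases g <;> simp [Formula.code, tag_inj] at hg ⊢
    exact ⟨code_fDir_injective hg.1, ih hg.2⟩
  | prev d a ih =>
    intro g hg
    cases g <;> simp [Formula.code, tag_inj] at hg ⊢
    exact ⟨code_dir_injective hg.1, ih hg.2⟩
  | untl d a b iha ihb =>
    intro g hg
    cases g <;> simp [Formula.code, tag_inj] at hg ⊢
    exact ⟨code_fDir_injective hg.1, iha hg.2.1, ihb hg.2.2⟩
  | since d a b iha ihb =>
    intro g hg
    cases g <;> simp [Formula.code, tag_inj] at hg ⊢
    exact ⟨code_dir_injective hg.1, iha hg.2.1, ihb hg.2.2⟩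
  | nextClock d I a ih =>
    intro g hg
    cases g <;> simp [Formula.code, tag_inj] at hg ⊢
    exact ⟨code_fDir_injective hg.1, code_interval_injective hg.2.1, ih hg.2.2⟩
  | prevClock d I a ih =>
    intro g hg
    cases g <;> simp [Formula.code, tag_inj] at hg ⊢
    exact ⟨code_dir_injective hg.1, code_interval_injective hg.2.1, ih hg.2.2⟩

variable {α : Type} [Enc α] {ψ : Formula α}

theorem exists_eq_or (h : ψ.code.hd = tag 2) : ∃ f g, ψ = .or f g := by
  cases ψ <;> simp [Formula.code, tag_inj] at h ⊢

theorem exists_eq_next (h : ψ.code.hd = tag 4) : ∃ d f, ψ = .next d f := by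
  cases ψ <;> simp [Formula.code, tag_inj] at h ⊢

theorem exists_eq_prev (h : ψ.code.hd = tag 5) : ∃ d f, ψ = .prev d f := by
  cases ψ <;> simp [Formula.code, tag_inj] at h ⊢

theorem exists_eq_untl (h : ψ.code.hd = tag 6) : ∃ d f g, ψ = .untl d f g := by
  cases ψ <;> simp [Formula.code, tag_inj] at h ⊢

theorem exists_eq_since (h : ψ.code.hd = tag 7) : ∃ d f g, ψ = .since d f g := by
  cases ψ <;> simp [Formula.code, tag_inj] at h ⊢

theorem exists_eq_nextClock (h : ψ.code.hd = tag 8) : ∃ d I f, ψ = .nextClock d I f := by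
  cases ψ <;> simp [Formula.code, tag_inj] at h ⊢

theorem exists_eq_prevClock (h : ψ.code.hd = tag 9) : ∃ d I f, ψ = .prevClock d I f := by
  cases ψ <;> simp [Formula.code, tag_inj] at h ⊢

theorem code_negate (ψ : Formula α) :
    ψ.negate.code = if ψ.code.hd = tag 3 then ψ.code.tl else .cons (tag 3) ψ.code := by
  cases ψ <;> simp [Formula.negate, Formula.code, tag_inj]

end Codes

/-! ### The local conditions on trees -/

/-- The code of the formula `⊤`. -/
def truCode : Data := .cons (tag 0) .nil
/-- The code of the formula `X^a ⊤`. -/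
def nextTopCode : Data := .cons (tag 4) (.cons (tag 1) truCode)
/-- The code of the formula `P^a ⊤`. -/
def prevTopCode : Data := .cons (tag 5) (.cons (tag 1) truCode)
/-- The code of the proposition `p_∞`. -/
def pInfCode : Data := .cons (tag 1) .nil
/-- The code of the proposition `call`. -/
def callCode : Data := .cons (tag 1) (.cons .nil .nil)
/-- The code of the proposition `ret`. -/
def retCode : Data := .cons (tag 1) (.cons .nil (.cons (tag 1) .nil))
/-- The code of the proposition `int`. -/
def intCode : Data := .cons (tag 1) (.cons .nil (.cons .nil (.cons (tag 1) .nil)))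

/-- The condition `Linked` for the direction with code `d`, on the codes of atoms. -/
def LinkD (L d s t : Data) : Prop :=
  ∀ χ ∈ L.toList,
    (χ.hd = tag 4 → χ.tl.hd = d → (χ ∈ s.toList ↔ χ.tl.tl ∈ t.toList)) ∧
    (χ.hd = tag 5 → χ.tl.hd = d → (χ ∈ t.toList ↔ χ.tl.tl ∈ s.toList))

/-- The condition `LocalPop` on the codes of atoms. -/
def PopD (L s t : Data) : Prop :=
  (LinkD L (tag 1) s t ∧
    ∀ χ ∈ L.toList, χ.hd = tag 5 → χ.tl.hd = tag 2 → (χ ∈ s.toList ↔ χ ∈ t.toList)) ∧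
  (pInfCode ∈ s.toList ↔ pInfCode ∈ t.toList)

/-- The conditions on atoms, on codes. -/
def AtomD (L s : Data) : Prop :=
  truCode ∈ s.toList ∧
  ((callCode ∈ s.toList ∧ retCode ∉ s.toList ∧ intCode ∉ s.toList) ∨
    (retCode ∈ s.toList ∧ callCode ∉ s.toList ∧ intCode ∉ s.toList) ∨
    (intCode ∈ s.toList ∧ callCode ∉ s.toList ∧ retCode ∉ s.toList)) ∧
  ∀ χ ∈ L.toList,
    (χ.hd = tag 3 → (χ ∈ s.toList ↔ χ.tl ∉ s.toList)) ∧
    (¬ χ.hd = tag 3 → (χ ∈ s.toList ↔ Data.cons (tag 3) χ ∉ s.toList)) ∧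
    (χ.hd = tag 2 → (χ ∈ s.toList ↔ χ.tl.hd ∈ s.toList ∨ χ.tl.tl ∈ s.toList)) ∧
    (χ.hd = tag 6 → (χ ∈ s.toList ↔ χ.tl.tl.tl ∈ s.toList ∨
      (χ.tl.tl.hd ∈ s.toList ∧ Data.cons (tag 4) (.cons χ.tl.hd χ) ∈ s.toList))) ∧
    (χ.hd = tag 7 → (χ ∈ s.toList ↔ χ.tl.tl.tl ∈ s.toList ∨
      (χ.tl.tl.hd ∈ s.toList ∧ Data.cons (tag 5) (.cons χ.tl.hd χ) ∈ s.toList))) ∧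
    (nextTopCode ∉ s.toList → χ.hd = tag 4 → χ.tl.hd = tag 1 → χ ∉ s.toList) ∧
    (prevTopCode ∉ s.toList → χ.hd = tag 5 → χ.tl.hd = tag 1 → χ ∉ s.toList)

/-- The condition `LocalStep` on the codes of atoms. -/
def StepD (L s t : Data) : Prop :=
  AtomD L s ∧ LinkD L (tag 0) s t ∧
  (callCode ∉ s.toList → retCode ∉ t.toList → PopD L s t) ∧
  (callCode ∉ s.toList → retCode ∈ t.toList → nextTopCode ∉ s.toList ∧
    (prevTopCode ∉ t.toList → pInfCode ∈ s.toList ∧ pInfCode ∈ t.toList ∧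
      ∀ χ ∈ L.toList, χ.hd = tag 5 → χ.tl.hd = tag 2 → χ ∉ t.toList)) ∧
  (callCode ∈ s.toList → nextTopCode ∉ s.toList → pInfCode ∈ s.toList) ∧
  (callCode ∈ s.toList → retCode ∉ t.toList → prevTopCode ∉ t.toList ∧
    (∀ χ ∈ L.toList, χ.hd = tag 5 → χ.tl.hd = tag 2 →
      (χ ∈ t.toList ↔ χ.tl.tl ∈ s.toList)) ∧
    (nextTopCode ∈ s.toList ↔ pInfCode ∉ t.toList))

/-- The initial condition on codes of atoms; `F` is the code of the formula. -/
def InitD (F L s : Data) : Prop :=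
  F ∈ s.toList ∧ ∀ χ ∈ L.toList, χ.hd = tag 5 → Data.cons (tag 3) χ ∈ s.toList

/-- The acceptance set given by the formula with code `χ`: the one of an until formula asks for
its fulfilment, at a position with `p_∞` in the abstract case. All others ask for `p_∞`. -/
def AccD (χ s : Data) : Prop :=
  (χ.hd = tag 6 → χ.tl.tl.tl ∈ s.toList ∨ Data.cons (tag 3) χ ∈ s.toList) ∧
  ((χ.hd = tag 6 ∧ χ.tl.hd = tag 0) ∨ pInfCode ∈ s.toList)

/-- The code of the negation of the Boolean value with code `b`. -/
def notCode (b : Data) : Data := if b = .nil then tag 1 else .nil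

/-- The code of the guard for the values below the interval with code `I`. -/
def belowCode (I : Data) : Data :=
  .cons .nil (.cons .nil (.cons (tag 1) (.cons I.hd (notCode I.tl.hd))))

/-- The code of the guard for the values above the interval with code `I`. -/
def aboveCode (I : Data) : Data :=
  if I.tl.tl = .nil then .nil else
    .cons .nil (.cons I.tl.tl.hd (.cons (notCode I.tl.tl.tl) .nil))

/-- The constraint with code `θ` treats the clock with code `z` as the real-time formula with code
`χ` requires. -/
def ClockD (s θ χ z : Data) : Prop :=
  (χ ∈ s.toList → Data.cons z (.cons .nil χ.tl.tl.hd) ∈ θ.toList) ∧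
  (χ ∉ s.toList → Data.cons z (belowCode χ.tl.tl.hd) ∈ θ.toList ∨
    Data.cons z (aboveCode χ.tl.tl.hd) ∈ θ.toList ∨ Data.cons z .nil ∈ θ.toList)

/-- The condition `GuardsFor` on codes. The list `K` describes the labelling. -/
def GuardD (L K s θ : Data) : Prop :=
  ∀ χ ∈ L.toList, ∀ e ∈ K.toList, e.tl = χ.tl.tl.tl →
    (χ.hd = tag 9 → ClockD s θ χ (.cons (tag 0) (.cons χ.tl.hd e.hd))) ∧
    (χ.hd = tag 8 → ClockD s θ χ (.cons (tag 1) (.cons χ.tl.hd e.hd)))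

theorem PT.notCode {F : Data → Data} (hF : PT F) : PT fun x => notCode (F x) := by
  classical
  exact PTP.ite (PTP.eq_nil hF) (.const _) .nil

theorem PT.belowCode {F : Data → Data} (hF : PT F) : PT fun x => belowCode (F x) :=
  .pair .nil (.pair .nil (.pair (.const _) (.pair (.hd hF) (PT.notCode (.hd (.tl hF))))))

theorem PT.aboveCode {F : Data → Data} (hF : PT F) : PT fun x => aboveCode (F x) := by
  classical
  exact PTP.ite (PTP.eq_nil (.tl (.tl hF))) .nil
    (.pair .nil (.pair (.hd (.tl (.tl hF))) (.pair (PT.notCode (.tl (.tl (.tl hF)))) .nil)))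

theorem PTP.linkD {FL Fd Fs Ft : Data → Data} (hL : PT FL) (hd : PT Fd) (hs : PT Fs) (ht : PT Ft) :
    PTP fun x => LinkD (FL x) (Fd x) (Fs x) (Ft x) := by
  have h : PTP fun y => LinkD y.hd y.tl.hd y.tl.tl.hd y.tl.tl.tl := by
    unfold LinkD
    repeat' first
      | exact PT.const _ | exact PT.id | apply PTP.ball | apply PTP.and | apply PTP.iff
      | apply PTP.imp | apply PTP.mem | apply PTP.eq | apply PT.hd | apply PT.tl
  exact PT.comp h (.pair hL (.pair hd (.pair hs ht)))

theorem PTP.popD {FL Fs Ft : Data → Data} (hL : PT FL) (hs : PT Fs) (ht : PT Ft) :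
    PTP fun x => PopD (FL x) (Fs x) (Ft x) := by
  have h : PTP fun y => PopD y.hd y.tl.hd y.tl.tl := by
    unfold PopD
    repeat' first
      | exact PT.const _ | exact PT.id | apply PTP.linkD | apply PTP.ball | apply PTP.and
      | apply PTP.iff | apply PTP.imp | apply PTP.mem | apply PTP.eq | apply PT.hd | apply PT.tl
  exact PT.comp h (.pair hL (.pair hs ht))

theorem PTP.atomD {FL Fs : Data → Data} (hL : PT FL) (hs : PT Fs) :
    PTP fun x => AtomD (FL x) (Fs x) := by
  have h : PTP fun y => AtomD y.hd y.tl := by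
    unfold AtomD
    repeat' first
      | exact PT.const _ | exact PT.id | apply PTP.not | apply PTP.ball | apply PTP.and
      | apply PTP.or | apply PTP.iff | apply PTP.imp | apply PTP.mem | apply PTP.eq
      | apply PT.pair | apply PT.hd | apply PT.tl
  exact PT.comp h (.pair hL hs)

theorem PTP.stepD {FL Fs Ft : Data → Data} (hL : PT FL) (hs : PT Fs) (ht : PT Ft) :
    PTP fun x => StepD (FL x) (Fs x) (Ft x) := by
  have h : PTP fun y => StepD y.hd y.tl.hd y.tl.tl := by
    unfold StepD
    repeat' first
      | exact PT.const _ | exact PT.id | apply PTP.atomD | apply PTP.linkD | apply PTP.popD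
      | apply PTP.not | apply PTP.ball | apply PTP.and | apply PTP.iff | apply PTP.imp
      | apply PTP.mem | apply PTP.eq | apply PT.hd | apply PT.tl
  exact PT.comp h (.pair hL (.pair hs ht))

theorem PTP.initD {FF FL Fs : Data → Data} (hF : PT FF) (hL : PT FL) (hs : PT Fs) :
    PTP fun x => InitD (FF x) (FL x) (Fs x) := by
  have h : PTP fun y => InitD y.hd y.tl.hd y.tl.tl := by
    unfold InitD
    repeat' first
      | exact PT.const _ | exact PT.id | apply PTP.ball | apply PTP.and | apply PTP.imp
      | apply PTP.mem | apply PTP.eq | apply PT.pair | apply PT.hd | apply PT.tl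
  exact PT.comp h (.pair hF (.pair hL hs))

theorem PTP.accD {Fc Fs : Data → Data} (hc : PT Fc) (hs : PT Fs) :
    PTP fun x => AccD (Fc x) (Fs x) := by
  unfold AccD
  repeat' first
    | exact PT.const _ | assumption | apply PTP.and | apply PTP.or | apply PTP.imp
    | apply PTP.mem | apply PTP.eq | apply PT.pair | apply PT.hd | apply PT.tl

theorem PTP.clockD {Fs Ft Fc Fz : Data → Data} (hs : PT Fs) (ht : PT Ft) (hc : PT Fc)
    (hz : PT Fz) : PTP fun x => ClockD (Fs x) (Ft x) (Fc x) (Fz x) := by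
  unfold ClockD
  repeat' first
    | exact PT.const _ | assumption | apply PT.belowCode | apply PT.aboveCode | apply PTP.not
    | apply PTP.and | apply PTP.or | apply PTP.imp | apply PTP.mem | apply PTP.eq | apply PT.pair
    | apply PT.hd | apply PT.tl

theorem PTP.guardD {FL FK Fs Ft : Data → Data} (hL : PT FL) (hK : PT FK) (hs : PT Fs)
    (ht : PT Ft) : PTP fun x => GuardD (FL x) (FK x) (Fs x) (Ft x) := by
  have h : PTP fun y => GuardD y.hd y.tl.hd y.tl.tl.hd y.tl.tl.tl := by
    unfold GuardD
    repeat' first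
      | exact PT.const _ | exact PT.id | apply PTP.clockD | apply PTP.ball | apply PTP.and
      | apply PTP.imp | apply PTP.eq | apply PT.pair | apply PT.hd | apply PT.tl
  exact PT.comp h (.pair hL (.pair hK (.pair hs ht)))

end ECNTL
namespace ECNTL
open RecProps Data Formula

/-! ### Trees as sets of formulas -/

section AbsSet
variable {n : ℕ} {φ : Formula (Fin (n + 3))}

/-- Different formulas over `Prop ∪ {p_∞}` have different codes. -/
theorem code_injective :
    Function.Injective (Formula.code : Formula (Option (Fin (n + 3))) → Data) :=
  code_formula_injective (code_option_injective code_fin_injective)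

/-- The set of the formulas of the closure whose codes are in the list `s`. -/
def absSet (φ : Formula (Fin (n + 3))) (s : Data) : Finset (Formula (Option (Fin (n + 3)))) :=
  (closure φ).filter fun ψ => ψ.code ∈ s.toList

theorem mem_absSet {s : Data} {ψ : Formula (Option (Fin (n + 3)))} (h : ψ ∈ closure φ) :
    ψ ∈ absSet φ s ↔ ψ.code ∈ s.toList := by
  simp [absSet, h]

theorem absSet_subset (s : Data) : absSet φ s ⊆ closure φ := Finset.filter_subset _ _

theorem truCode_mem {s : Data} : truCode ∈ s.toList ↔ tru ∈ absSet φ s :=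
  (mem_absSet tru_mem_closure).symm

theorem nextTopCode_mem {s : Data} : nextTopCode ∈ s.toList ↔ next .abs tru ∈ absSet φ s :=
  (mem_absSet next_abs_tru_mem_closure).symm

theorem prevTopCode_mem {s : Data} : prevTopCode ∈ s.toList ↔ prev .abs tru ∈ absSet φ s :=
  (mem_absSet prev_abs_tru_mem_closure).symm

theorem pInfCode_mem {s : Data} : pInfCode ∈ s.toList ↔ pInf ∈ absSet φ s :=
  (mem_absSet (prop_mem_closure φ none)).symm

theorem callCode_mem {s : Data} : callCode ∈ s.toList ↔ prop (some call) ∈ absSet φ s := by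
  rw [mem_absSet (prop_mem_closure φ _)]
  have : (prop (some call) : Formula (Option (Fin (n + 3)))).code = callCode := by
    change Data.cons (tag 1) (.cons .nil (listCode ((0 : ℕ).bits.map Enc.code))) = _
    simp [callCode, listCode]
  rw [this]

theorem retCode_mem {s : Data} : retCode ∈ s.toList ↔ prop (some ret) ∈ absSet φ s := by
  rw [mem_absSet (prop_mem_closure φ _)]
  have : (prop (some ret) : Formula (Option (Fin (n + 3)))).code = retCode := by
    change Data.cons (tag 1) (.cons .nil (listCode ((1 : ℕ).bits.map Enc.code))) = _
    simp [retCode, listCode, Enc.code]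
  rw [this]

theorem intCode_mem {s : Data} : intCode ∈ s.toList ↔ prop (some intl) ∈ absSet φ s := by
  rw [mem_absSet (prop_mem_closure φ _)]
  have : (prop (some intl) : Formula (Option (Fin (n + 3)))).code = intCode := by
    change Data.cons (tag 1) (.cons .nil (listCode ((2 : ℕ).bits.map Enc.code))) = _
    have h2 : (2 : ℕ).bits = [false, true] := by
      have := Nat.bit0_bits 1 (by simp)
      simpa using this
    simp [intCode, listCode, Enc.code, h2, tag]
  rw [this]

/-- The list `L` consists of the codes of the formulas of the closure. -/
def ListsClosure (φ : Formula (Fin (n + 3))) (L : Data) : Prop :=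
  ∀ d, d ∈ L.toList ↔ ∃ ψ ∈ closure φ, ψ.code = d

variable {L : Data} (hL : ListsClosure φ L)
include hL

theorem ListsClosure.forall_iff {p : Data → Prop} :
    (∀ χ ∈ L.toList, p χ) ↔ ∀ ψ ∈ closure φ, p ψ.code := by
  constructor
  · exact fun h ψ hψ => h _ ((hL _).2 ⟨ψ, hψ, rfl⟩)
  · rintro h χ hχ
    obtain ⟨ψ, hψ, rfl⟩ := (hL χ).1 hχ
    exact h ψ hψ

theorem linkD_iff (d : FDir) (s t : Data) :
    LinkD L (Enc.code d) s t ↔ Linked φ d d.toDir (absSet φ s) (absSet φ t) := by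
  unfold LinkD
  rw [hL.forall_iff]
  constructor
  · intro h
    refine ⟨fun ψ hψ => ?_, fun ψ hψ => ?_⟩
    · rw [mem_absSet hψ, mem_absSet (mem_closure_of_args hψ (by simp [args]))]
      exact (h _ hψ).1 rfl rfl
    · rw [mem_absSet hψ, mem_absSet (mem_closure_of_args hψ (by simp [args]))]
      exact (h _ hψ).2 rfl rfl
  · rintro ⟨h1, h2⟩ ψ hψ
    refine ⟨fun h3 h4 => ?_, fun h3 h4 => ?_⟩
    · obtain ⟨d', f, rfl⟩ := exists_eq_next h3
      obtain rfl : d' = d := code_fDir_injective h4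
      have := h1 f hψ
      rwa [mem_absSet hψ, mem_absSet (mem_closure_of_args hψ (by simp [args]))] at this
    · obtain ⟨d', f, rfl⟩ := exists_eq_prev h3
      obtain rfl : d' = d.toDir := code_dir_injective h4
      have := h2 f hψ
      rwa [mem_absSet hψ, mem_absSet (mem_closure_of_args hψ (by simp [args]))] at this

/-- Conditions on the caller formulas, on codes. -/
theorem forall_caller_iff {p : Data → Prop} :
    (∀ χ ∈ L.toList, χ.hd = tag 5 → χ.tl.hd = tag 2 → p χ) ↔
      ∀ ψ, prev .caller ψ ∈ closure φ → p (prev .caller ψ).code := by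
  rw [hL.forall_iff]
  constructor
  · exact fun h ψ hψ => h _ hψ rfl rfl
  · intro h ψ hψ h1 h2
    obtain ⟨d, f, rfl⟩ := exists_eq_prev h1
    obtain rfl : d = .caller := code_dir_injective h2
    exact h f hψ

theorem popD_iff (s t : Data) : PopD L s t ↔ LocalPop φ (absSet φ s) (absSet φ t) := by
  unfold PopD LocalPop AbsNextPrev
  rw [forall_caller_iff hL, ← pInfCode_mem, ← pInfCode_mem]
  refine and_congr (and_congr (linkD_iff hL .abs s t) ?_) Iff.rfl
  rw [Set.ext_iff]
  constructor
  · intro h χ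
    simp only [callerSet, Set.mem_ofPred_eq]
    refine and_congr_left fun ⟨ψ, hψ⟩ => ?_
    subst hψ
    by_cases hc : prev .caller ψ ∈ closure φ
    · rw [mem_absSet hc, mem_absSet hc]; exact h ψ hc
    · exact ⟨fun h => absurd (absSet_subset _ h) hc, fun h => absurd (absSet_subset _ h) hc⟩
  · intro h ψ hψ
    have := h (prev .caller ψ)
    rw [← mem_absSet hψ, ← mem_absSet hψ]
    simpa [callerSet] using this

theorem atomD_iff (s : Data) : AtomD L s ↔ IsAtom φ (absSet φ s) := by
  unfold AtomD
  rw [hL.forall_iff, truCode_mem (φ := φ), callCode_mem (φ := φ), retCode_mem (φ := φ),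
    intCode_mem (φ := φ), nextTopCode_mem (φ := φ), prevTopCode_mem (φ := φ)]
  constructor
  · rintro ⟨h1, h2, h3⟩
    refine ⟨absSet_subset s, h1, fun ψ hψ => ?_, fun f g hψ => ?_, h2, fun d f g hψ => ?_,
      fun d f g hψ => ?_, fun h4 ψ hψ => ?_, fun h4 ψ hψ => ?_⟩
    · obtain ⟨h4, h5, -⟩ := h3 ψ hψ
      rw [mem_absSet hψ, mem_absSet (negate_mem_closure hψ), code_negate]
      split_ifs with h6
      · exact h4 h6
      · exact h5 h6
    · rw [mem_absSet hψ, mem_absSet (mem_closure_of_args hψ (by simp [args])),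
        mem_absSet (mem_closure_of_args hψ (by simp [args]))]
      exact (h3 _ hψ).2.2.1 rfl
    · rw [mem_absSet hψ, mem_absSet (mem_closure_of_args hψ (by simp [args])),
        mem_absSet (mem_closure_of_args hψ (by simp [args])),
        mem_absSet (next_untl_mem_closure hψ)]
      exact (h3 _ hψ).2.2.2.1 rfl
    · rw [mem_absSet hψ, mem_absSet (mem_closure_of_args hψ (by simp [args])),
        mem_absSet (mem_closure_of_args hψ (by simp [args])),
        mem_absSet (prev_since_mem_closure hψ)]
      exact (h3 _ hψ).2.2.2.2.1 rfl
    · rw [mem_absSet hψ]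
      exact (h3 _ hψ).2.2.2.2.2.1 h4 rfl rfl
    · rw [mem_absSet hψ]
      exact (h3 _ hψ).2.2.2.2.2.2 h4 rfl rfl
  · intro h
    refine ⟨h.tru_mem, h.exactly_one, fun ψ hψ => ⟨fun h1 => ?_, fun h1 => ?_, fun h1 => ?_,
      fun h1 => ?_, fun h1 => ?_, fun h1 h2 h3 => ?_, fun h1 h2 h3 => ?_⟩⟩
    · have := h.neg_iff ψ hψ
      rwa [mem_absSet hψ, mem_absSet (negate_mem_closure hψ), code_negate, if_pos h1] at this
    · have := h.neg_iff ψ hψ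
      rwa [mem_absSet hψ, mem_absSet (negate_mem_closure hψ), code_negate, if_neg h1] at this
    · obtain ⟨f, g, rfl⟩ := exists_eq_or h1
      have := h.or_iff f g hψ
      rwa [mem_absSet hψ, mem_absSet (mem_closure_of_args hψ (by simp [args])),
        mem_absSet (mem_closure_of_args hψ (by simp [args]))] at this
    · obtain ⟨d, f, g, rfl⟩ := exists_eq_untl h1
      have := h.untl_iff d f g hψ
      rwa [mem_absSet hψ, mem_absSet (mem_closure_of_args hψ (by simp [args])),
        mem_absSet (mem_closure_of_args hψ (by simp [args])),
        mem_absSet (next_untl_mem_closure hψ)] at this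
    · obtain ⟨d, f, g, rfl⟩ := exists_eq_since h1
      have := h.since_iff d f g hψ
      rwa [mem_absSet hψ, mem_absSet (mem_closure_of_args hψ (by simp [args])),
        mem_absSet (mem_closure_of_args hψ (by simp [args])),
        mem_absSet (prev_since_mem_closure hψ)] at this
    · obtain ⟨d, f, rfl⟩ := exists_eq_next h2
      obtain rfl : d = .abs := code_fDir_injective h3
      rw [← mem_absSet hψ]
      exact h.next_abs h1 f hψ
    · obtain ⟨d, f, rfl⟩ := exists_eq_prev h2
      obtain rfl : d = .abs := code_dir_injective h3
      rw [← mem_absSet hψ]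
      exact h.prev_abs h1 f hψ

theorem stepD_iff (s t : Data) : StepD L s t ↔ LocalStep φ (absSet φ s) (absSet φ t) := by
  unfold StepD
  rw [atomD_iff hL, popD_iff hL, forall_caller_iff hL, forall_caller_iff hL,
    callCode_mem (φ := φ), retCode_mem (φ := φ), nextTopCode_mem (φ := φ),
    prevTopCode_mem (φ := φ), pInfCode_mem (φ := φ), pInfCode_mem (φ := φ)]
  have h0 : LinkD L (tag 0) s t ↔ _ := linkD_iff hL .glob s t
  rw [h0]
  have h1 : (∀ ψ, prev .caller ψ ∈ closure φ → (prev .caller ψ).code ∉ t.toList) ↔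
      callerSet (absSet φ t) = ∅ := by
    rw [Set.eq_empty_iff_forall_notMem]
    constructor
    · rintro h χ ⟨hχ, ψ, rfl⟩
      have hc := absSet_subset _ hχ
      exact h ψ hc ((mem_absSet hc).1 hχ)
    · intro h ψ hψ h'
      exact h _ ⟨(mem_absSet hψ).2 h', ψ, rfl⟩
  have h2 : (∀ ψ, prev .caller ψ ∈ closure φ →
      ((prev .caller ψ).code ∈ t.toList ↔ (prev .caller ψ).code.tl.tl ∈ s.toList)) ↔
      callerSet (absSet φ t) =
        {χ | χ ∈ closure φ ∧ ∃ ψ, χ = prev .caller ψ ∧ ψ ∈ absSet φ s} := by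
    rw [Set.ext_iff]
    constructor
    · intro h χ
      simp only [callerSet, Set.mem_ofPred_eq]
      constructor
      · rintro ⟨hχ, ψ, rfl⟩
        have hc := absSet_subset _ hχ
        refine ⟨hc, ψ, rfl, (mem_absSet (mem_closure_of_args hc (by simp [args]))).2 ?_⟩
        exact (h ψ hc).1 ((mem_absSet hc).1 hχ)
      · rintro ⟨hc, ψ, rfl, hψ⟩
        refine ⟨(mem_absSet hc).2 ((h ψ hc).2 ?_), ψ, rfl⟩
        exact (mem_absSet (mem_closure_of_args hc (by simp [args]))).1 hψ
    · intro h ψ hψ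
      have := h (prev .caller ψ)
      simp only [callerSet, Set.mem_ofPred_eq, hψ, true_and, prev.injEq, exists_eq_left',
        exists_eq', and_true, mem_absSet hψ,
        mem_absSet (mem_closure_of_args hψ (show ψ ∈ _ by simp [args]))] at this
      exact this
  rw [h1, h2]
  constructor
  · rintro ⟨a1, a2, a3, a4, a5, a6⟩
    exact ⟨a1, a2, a3, a4, a5, a6⟩
  · rintro ⟨a1, a2, a3, a4, a5, a6⟩
    exact ⟨a1, a2, a3, a4, a5, a6⟩

theorem initD_iff (s : Data) : InitD (φ.map some).code L s ↔ φ.map some ∈ absSet φ s ∧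
    ∀ d ψ, prev d ψ ∈ closure φ → neg (prev d ψ) ∈ absSet φ s := by
  unfold InitD
  rw [hL.forall_iff, mem_absSet map_some_mem_closure]
  refine and_congr Iff.rfl ⟨fun h d ψ hψ => ?_, fun h ψ hψ h1 => ?_⟩
  · rw [mem_absSet (neg_prev_mem_closure hψ)]
    exact h _ hψ rfl
  · obtain ⟨d, f, rfl⟩ := exists_eq_prev h1
    exact (mem_absSet (neg_prev_mem_closure hψ)).1 (h d f hψ)

/-- The acceptance sets express fairness. -/
theorem genFair_iff (st : ℕ → Data) : GenFair φ (fun i => absSet φ (st i)) ↔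
    ∀ χ ∈ L.toList, ∀ m, ∃ i, m ≤ i ∧ AccD χ (st i) := by
  rw [hL.forall_iff]
  unfold AccD
  simp only [pInfCode_mem (φ := φ)]
  constructor
  · intro h ψ hψ m
    by_cases hu : ψ.code.hd = tag 6
    · obtain ⟨d, f, g, rfl⟩ := exists_eq_untl hu
      cases d with
      | glob =>
        obtain ⟨i, h1, h2⟩ := h.untl_glob f g hψ m
        rw [mem_absSet (mem_closure_of_args hψ (by simp [args])),
          mem_absSet (neg_untl_mem_closure hψ)] at h2
        exact ⟨i, h1, fun _ => h2, Or.inl ⟨rfl, rfl⟩⟩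
      | abs =>
        obtain ⟨i, h1, h2, h3⟩ := h.untl_abs f g hψ m
        rw [mem_absSet (mem_closure_of_args hψ (by simp [args])),
          mem_absSet (neg_untl_mem_closure hψ)] at h3
        exact ⟨i, h1, fun _ => h3, Or.inr h2⟩
    · obtain ⟨i, h1, h2⟩ := h.inf m
      exact ⟨i, h1, fun h => absurd h hu, Or.inr h2⟩
  · intro h
    refine ⟨fun m => ?_, fun f g hψ m => ?_, fun f g hψ m => ?_⟩
    · obtain ⟨i, h1, -, h2⟩ := h tru tru_mem_closure m
      exact ⟨i, h1, h2.resolve_left fun h => by simp [Formula.code, tag_inj] at h⟩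
    · obtain ⟨i, h1, h2, -⟩ := h _ hψ m
      refine ⟨i, h1, ?_⟩
      rw [mem_absSet (mem_closure_of_args hψ (by simp [args])),
        mem_absSet (neg_untl_mem_closure hψ)]
      exact h2 rfl
    · obtain ⟨i, h1, h2, h3⟩ := h _ hψ m
      refine ⟨i, h1, h3.resolve_left fun h => ?_, ?_⟩
      · have h5 : tag 1 = tag 0 := h.2
        simp [tag_inj] at h5
      · rw [mem_absSet (mem_closure_of_args hψ (by simp [args])),
          mem_absSet (neg_untl_mem_closure hψ)]
        exact h2 rfl

end AbsSet

/-! ### Trees as clock constraints -/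

theorem notCode_code (b : Bool) : notCode (Enc.code b) = Enc.code (!b) := by
  cases b <;> simp [notCode, Enc.code, tag]

theorem belowCode_code (I : Interval) :
    belowCode (Enc.code I) = Enc.code (Guard.within I.below) := by
  have h : belowCode (Enc.code I) = .cons .nil (.cons .nil (.cons (tag 1) (.cons (Enc.code I.lo)
    (notCode (Enc.code I.loClosed))))) := rfl
  rw [h, notCode_code]
  have h0 : (Enc.code 0 : Data) = .nil := by simp [Enc.code, listCode]
  change _ = Data.cons .nil (.cons (Enc.code 0) (.cons (Enc.code true) (.cons (Enc.code I.lo)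
    (Enc.code (!I.loClosed)))))
  rw [h0]
  rfl

theorem aboveCode_code (I : Interval) : aboveCode (Enc.code I) = Enc.code I.above := by
  obtain ⟨lo, lc, _ | ⟨b, c⟩⟩ := I
  · simp [aboveCode, Enc.code, Interval.above]
  · have h : aboveCode (Enc.code (⟨lo, lc, some (b, c)⟩ : Interval)) =
        .cons .nil (.cons (Enc.code b) (.cons (notCode (Enc.code c)) .nil)) := by
      simp [aboveCode, Enc.code]
    rw [h, notCode_code]
    rfl

section AbsGuard
variable {n : ℕ} {φ : Formula (Fin (n + 3))}
  {P' : Type} [RecProps P'] [Fintype P'] [DecidableEq P'] [Enc P']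
  {lab : P' → Formula (Option (Fin (n + 3)))}

/-- The code of an atomic constraint. -/
def pairCode (c : Clock P' × Guard) : Data := .cons (Enc.code c.1) (Enc.code c.2)

/-- The atomic constraints whose codes are in the list `θ`. -/
def absGuard (φ : Formula (Fin (n + 3))) (lab : P' → Formula (Option (Fin (n + 3)))) (θ : Data) :
    Constraint P' :=
  (guardSet φ lab).filter fun c => pairCode c ∈ θ.toList

/-- The list `K` consists of the pairs of the code of a proposition and the code of its label. -/
def ListsLabels (lab : P' → Formula (Option (Fin (n + 3)))) (K : Data) : Prop :=
  ∀ d, d ∈ K.toList ↔ ∃ p, Data.cons (Enc.code p) (lab p).code = d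

omit [RecProps P'] in
theorem clockD_iff {s θ : Data} {χ : Formula (Option (Fin (n + 3)))} (hχ : χ ∈ closure φ)
    (z : Clock P') {I : Interval} (hI : χ.code.tl.tl.hd = Enc.code I)
    (hz : ∀ g ∈ I.guards, (z, g) ∈ guardSet φ lab) :
    ClockD s θ χ.code (Enc.code z) ↔
      (χ ∈ absSet φ s → (z, Guard.within I) ∈ absGuard φ lab θ) ∧
      (χ ∉ absSet φ s → (z, Guard.within I.below) ∈ absGuard φ lab θ ∨
        (z, I.above) ∈ absGuard φ lab θ ∨ (z, Guard.undef) ∈ absGuard φ lab θ) := by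
  have hg : ∀ g ∈ I.guards, ((z, g) ∈ absGuard φ lab θ ↔
      Data.cons (Enc.code z) (Enc.code g) ∈ θ.toList) := fun g h => by
    unfold absGuard
    rw [Finset.mem_filter]
    exact ⟨fun h' => h'.2, fun h' => ⟨hz g h, h'⟩⟩
  rw [mem_absSet hχ, hg _ (by simp [Interval.guards]), hg _ (by simp [Interval.guards]),
    hg _ (by simp [Interval.guards]), hg _ (by simp [Interval.guards])]
  unfold ClockD
  rw [hI, belowCode_code, aboveCode_code]
  rfl

omit [RecProps P'] in
theorem guardD_iff {L K : Data} (hL : ListsClosure φ L) (hK : ListsLabels lab K) (s θ : Data) :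
    GuardD L K s θ ↔ GuardsFor φ lab (absSet φ s) (absGuard φ lab θ) := by
  unfold GuardD GuardsFor
  rw [hL.forall_iff]
  have hK' : ∀ {q : Data → Prop}, (∀ e ∈ K.toList, q e) ↔
      ∀ p, q (.cons (Enc.code p) (lab p).code) := by
    intro q
    constructor
    · exact fun h p => h _ ((hK _).2 ⟨p, rfl⟩)
    · rintro h e he
      obtain ⟨p, rfl⟩ := (hK e).1 he
      exact h p
  simp only [hK', tl_cons, hd_cons]
  constructor
  · intro h
    refine ⟨fun d I p hp => ?_, fun d I p hp => ?_⟩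
    · exact (clockD_iff hp (.recorder d p) rfl fun g hg => recorder_mem_guardSet hp hg).1
        ((h _ hp p rfl).1 rfl)
    · exact (clockD_iff hp (.predictor d p) rfl fun g hg => predictor_mem_guardSet hp hg).1
        ((h _ hp p rfl).2 rfl)
  · rintro ⟨h1, h2⟩ ψ hψ p hp
    refine ⟨fun h3 => ?_, fun h3 => ?_⟩
    · obtain ⟨d, I, f, rfl⟩ := exists_eq_prevClock h3
      obtain rfl : lab p = f := code_injective hp
      exact (clockD_iff hψ (.recorder d p) rfl fun g hg => recorder_mem_guardSet hψ hg).2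
        (h1 d I p hψ)
    · obtain ⟨d, I, f, rfl⟩ := exists_eq_nextClock h3
      obtain rfl : lab p = f := code_injective hp
      exact (clockD_iff hψ (.predictor d p) rfl fun g hg => predictor_mem_guardSet hψ hg).2
        (h2 d I p hψ)

end AbsGuard
end ECNTL
namespace ECNTL
open RecProps Data Formula

/-! ### The automaton -/

/-- The code of `γ` as a symbol read by pop transitions, and the code of the bottom symbol. -/
def optList (PL : Data) : Data := .cons .nil (PL.map (.cons .nil))

/-- The tuples `(s, θ, g, s')` such that `s'` may follow the state `s` and the constraint `θ`
asserts the real-time formulas of `s`. -/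
noncomputable def nextD (L K PL s θ g : Data) : Data :=
  (PL.filter fun s' => StepD L s s' ∧ GuardD L K s θ).map fun s' => .cons s (.cons θ (.cons g s'))

/-- The tuples as above for all states `s`, all constraints `θ` and all `g`, each `g` being a symbol
or the bottom symbol. -/
noncomputable def transD (L K PL PG : Data) : Data :=
  PL.flatMap fun s => PG.flatMap fun θ => (optList PL).flatMap fun g => nextD L K PL s θ g

/-- The push transitions. At a call in state `s` the symbol `s` is pushed. -/
noncomputable def pushD (L K PL PG : Data) : Data :=
  (transD L K PL PG).filter fun d =>
    callCode ∈ d.hd.toList ∧ d.tl.tl.hd = .cons .nil d.hd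

/-- The pop transitions. The popped symbol is the state at the matching call. -/
noncomputable def popTransD (L K PL PG : Data) : Data :=
  (transD L K PL PG).filter fun d =>
    retCode ∈ d.hd.toList ∧ (d.tl.tl.hd = .nil → prevTopCode ∉ d.hd.toList) ∧
      (¬ d.tl.tl.hd = .nil → PopD L d.tl.tl.hd.tl d.hd)

/-- The internal transitions. -/
noncomputable def intD (L K PL PG : Data) : Data :=
  (transD L K PL PG).filter fun d => intCode ∈ d.hd.toList ∧ d.tl.tl.hd = .nil

/-- The code of the letter read in state `s`. -/
noncomputable def letterD (K s : Data) : Data :=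
  (K.filter fun e => e.tl ∈ s.toList).map hd

/-- The description of the automaton. -/
noncomputable def descD (F L K PL PG : Data) : Data :=
  .cons PL (.cons PL (.cons (PL.filter fun s => InitD F L s) (.cons
    ((pushD L K PL PG).map fun d => .cons d.hd (.cons (letterD K d.hd)
      (.cons d.tl.hd (.cons d.tl.tl.tl d.tl.tl.hd.tl)))) (.cons
    ((popTransD L K PL PG).map fun d => .cons d.hd (.cons (letterD K d.hd)
      (.cons d.tl.hd (.cons d.tl.tl.hd d.tl.tl.tl)))) (.cons
    ((intD L K PL PG).map fun d => .cons d.hd (.cons (letterD K d.hd)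
      (.cons d.tl.hd d.tl.tl.tl)))
    (L.map fun χ => PL.filter fun s => AccD χ s))))))

theorem mem_optList {PL g : Data} :
    g ∈ (optList PL).toList ↔ g = .nil ∨ ∃ γ ∈ PL.toList, g = .cons .nil γ := by
  simp [optList, eq_comm]

theorem mem_transD {L K PL PG d : Data} : d ∈ (transD L K PL PG).toList ↔
    d = .cons d.hd (.cons d.tl.hd (.cons d.tl.tl.hd d.tl.tl.tl)) ∧ d.hd ∈ PL.toList ∧
      d.tl.hd ∈ PG.toList ∧ d.tl.tl.hd ∈ (optList PL).toList ∧ d.tl.tl.tl ∈ PL.toList ∧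
      StepD L d.hd d.tl.tl.tl ∧ GuardD L K d.hd d.tl.hd := by
  simp only [transD, nextD, toList_flatMap, toList_map, List.mem_flatMap, List.mem_map,
    Data.mem_filter]
  constructor
  · rintro ⟨s, hs, θ, hθ, g, hg, s', ⟨hs', h1, h2⟩, rfl⟩
    exact ⟨rfl, hs, hθ, hg, hs', h1, h2⟩
  · rintro ⟨hd, hs, hθ, hg, hs', h1, h2⟩
    exact ⟨_, hs, _, hθ, _, hg, _, ⟨hs', h1, h2⟩, hd.symm⟩

/-- A list of codes describes a finite set. -/
theorem isCode_toFinset_map {α : Type} [Rep α] [DecidableEq α] {l : Data} {f : Data → α}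
    {c : Data → Data} (h : ∀ e ∈ l.toList, Rep.IsCode (f e) (c e)) :
    Rep.IsCode (l.toList.map f).toFinset (l.map c) := by
  refine ⟨l.toList.map c, rfl, fun a ha => ?_, fun y hy => ?_⟩
  · obtain ⟨e, he, rfl⟩ := List.mem_map.1 (List.mem_toFinset.1 ha)
    exact ⟨c e, List.mem_map_of_mem he, h e he⟩
  · obtain ⟨e, he, rfl⟩ := List.mem_map.1 hy
    exact ⟨f e, List.mem_toFinset.2 (List.mem_map_of_mem he), h e he⟩

theorem isCode_toFinset (l : Data) : Rep.IsCode l.toList.toFinset l :=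
  ⟨l.toList, by simp, fun a ha => ⟨a, by simpa using ha, rfl⟩,
    fun y hy => ⟨y, by simpa using hy, rfl⟩⟩

section Automaton
variable {n : ℕ} (φ : Formula (Fin (n + 3)))
  {P' : Type} [RecProps P'] [Fintype P'] [DecidableEq P'] [Enc P']
  (lab : P' → Formula (Option (Fin (n + 3))))

/-- The letter read in state `s`. -/
def letterOf (s : Data) : Finset P' := Finset.univ.filter fun p => lab p ∈ absSet φ s

/-- The list `G` consists of the codes of the atomic constraints used. -/
def ListsGuards (G : Data) : Prop :=
  ∀ d, d ∈ G.toList ↔ ∃ c ∈ guardSet φ lab, pairCode c = d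

variable {φ lab} (hl : IsLabelling lab) {L K G : Data} (hL : ListsClosure φ L)

omit [Enc P'] [DecidableEq P'] in
include hl hL in
theorem kind_letterOf {s : Data} (h : AtomD L s) :
    (callCode ∈ s.toList → IsCall (letterOf φ lab s)) ∧
    (retCode ∈ s.toList → IsRet (letterOf φ lab s)) ∧
    (intCode ∈ s.toList → IsInt (letterOf φ lab s)) := by
  have h1 := ((atomD_iff hL s).1 h).exactly_one
  simp only [IsCall, IsRet, IsInt, letterOf, Finset.mem_filter, Finset.mem_univ, true_and,
    hl.call_eq, hl.ret_eq, hl.intl_eq, callCode_mem (φ := φ), retCode_mem (φ := φ),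
    intCode_mem (φ := φ)]
  tauto

open Classical in
variable (φ lab G K) in
/-- The automaton guesses an atom of `φ` for each position and checks the local conditions. States
and stack symbols are lists of codes of formulas. -/
noncomputable def automaton : ECNA P' Data Data where
  states := L.pow.toList.toFinset
  stackSyms := L.pow.toList.toFinset
  init := (L.pow.filter fun s => InitD (φ.map some).code L s).toList.toFinset
  push := ((pushD L K L.pow G.pow).toList.map fun d => (d.hd, letterOf φ lab d.hd,
    absGuard φ lab d.tl.hd, d.tl.tl.tl, d.tl.tl.hd.tl)).toFinset
  pop := ((popTransD L K L.pow G.pow).toList.map fun d => (d.hd, letterOf φ lab d.hd,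
    absGuard φ lab d.tl.hd, if d.tl.tl.hd = .nil then none else some d.tl.tl.hd.tl,
    d.tl.tl.tl)).toFinset
  internal := ((intD L K L.pow G.pow).toList.map fun d => (d.hd, letterOf φ lab d.hd,
    absGuard φ lab d.tl.hd, d.tl.tl.tl)).toFinset
  acc := (L.toList.map fun χ => (L.pow.filter fun s => AccD χ s).toList.toFinset).toFinset
  init_sub := by
    intro s hs
    simp only [List.mem_toFinset, Data.mem_filter] at hs ⊢
    exact hs.1
  push_mem := by
    intro q a θ q' γ h
    simp only [List.mem_toFinset, List.mem_map, pushD, Data.mem_filter, Prod.mk.injEq,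
      mem_transD] at h ⊢
    obtain ⟨d, ⟨⟨-, h1, -, -, h2, h3, -⟩, h4, h5⟩, rfl, rfl, -, rfl, rfl⟩ := h
    exact ⟨h1, (kind_letterOf hl hL h3.1).1 h4, h2, by rw [h5]; exact h1⟩
  pop_mem := by
    intro q a θ g q' h
    simp only [List.mem_toFinset, List.mem_map, popTransD, Data.mem_filter, Prod.mk.injEq,
      mem_transD] at h ⊢
    obtain ⟨d, ⟨⟨-, h1, -, hg, h2, h3, -⟩, h4, h5⟩, rfl, rfl, -, rfl, rfl⟩ := h
    refine ⟨h1, (kind_letterOf hl hL h3.1).2.1 h4, fun γ hγ => ?_, h2⟩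
    split_ifs at hγ with hn
    obtain ⟨γ', h6, h7⟩ := (mem_optList.1 hg).resolve_left hn
    rw [h7, tl_cons, Option.some.injEq] at hγ
    rwa [← hγ]
  internal_mem := by
    intro q a θ q' h
    simp only [List.mem_toFinset, List.mem_map, intD, Data.mem_filter, Prod.mk.injEq,
      mem_transD] at h ⊢
    obtain ⟨d, ⟨⟨-, h1, -, -, h2, h3, -⟩, h4, -⟩, rfl, rfl, -, rfl⟩ := h
    exact ⟨h1, (kind_letterOf hl hL h3.1).2.2 h4, h2⟩
  acc_sub := by
    intro F hF s hs
    simp only [List.mem_toFinset, List.mem_map] at hF ⊢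
    obtain ⟨χ, -, rfl⟩ := hF
    simp only [List.mem_toFinset, Data.mem_filter] at hs
    exact hs.1

/-! The following three lemmas describe the transitions by their components. -/

theorem mem_push_iff {q q' γ : Data} {a : Finset P'} {θ : Constraint P'} :
    (q, a, θ, q', γ) ∈ (automaton φ lab hl K G hL).push ↔
      ∃ θ' ∈ G.pow.toList, absGuard φ lab θ' = θ ∧ letterOf φ lab q = a ∧ γ = q ∧
        q ∈ L.pow.toList ∧ q' ∈ L.pow.toList ∧ StepD L q q' ∧ GuardD L K q θ' ∧
        callCode ∈ q.toList := by
  simp only [automaton, List.mem_toFinset, List.mem_map, pushD, Data.mem_filter, Prod.mk.injEq,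
    mem_transD]
  constructor
  · rintro ⟨d, ⟨⟨-, h1, h2, -, h3, h4, h5⟩, h6, h7⟩, rfl, rfl, rfl, rfl, rfl⟩
    exact ⟨_, h2, rfl, rfl, by rw [h7, tl_cons], h1, h3, h4, h5, h6⟩
  · rintro ⟨θ', h1, rfl, rfl, rfl, h2, h3, h4, h5, h6⟩
    exact ⟨.cons γ (.cons θ' (.cons (.cons .nil γ) q')), ⟨⟨rfl, h2, h1,
      mem_optList.2 (Or.inr ⟨γ, h2, rfl⟩), h3, h4, h5⟩, h6, rfl⟩, rfl, rfl, rfl, rfl, rfl⟩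

theorem mem_internal_iff {q q' : Data} {a : Finset P'} {θ : Constraint P'} :
    (q, a, θ, q') ∈ (automaton φ lab hl K G hL).internal ↔
      ∃ θ' ∈ G.pow.toList, absGuard φ lab θ' = θ ∧ letterOf φ lab q = a ∧
        q ∈ L.pow.toList ∧ q' ∈ L.pow.toList ∧ StepD L q q' ∧ GuardD L K q θ' ∧
        intCode ∈ q.toList := by
  simp only [automaton, List.mem_toFinset, List.mem_map, intD, Data.mem_filter, Prod.mk.injEq,
    mem_transD]
  constructor
  · rintro ⟨d, ⟨⟨-, h1, h2, -, h3, h4, h5⟩, h6, -⟩, rfl, rfl, rfl, rfl⟩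
    exact ⟨_, h2, rfl, rfl, h1, h3, h4, h5, h6⟩
  · rintro ⟨θ', h1, rfl, rfl, h2, h3, h4, h5, h6⟩
    exact ⟨.cons q (.cons θ' (.cons .nil q')), ⟨⟨rfl, h2, h1,
      mem_optList.2 (Or.inl rfl), h3, h4, h5⟩, h6, rfl⟩, rfl, rfl, rfl, rfl⟩

theorem mem_pop_iff {q q' : Data} {g : Option Data} {a : Finset P'} {θ : Constraint P'} :
    (q, a, θ, g, q') ∈ (automaton φ lab hl K G hL).pop ↔
      ∃ θ' ∈ G.pow.toList, absGuard φ lab θ' = θ ∧ letterOf φ lab q = a ∧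
        q ∈ L.pow.toList ∧ q' ∈ L.pow.toList ∧ StepD L q q' ∧ GuardD L K q θ' ∧
        retCode ∈ q.toList ∧ (g = none → prevTopCode ∉ q.toList) ∧
        ∀ γ, g = some γ → γ ∈ L.pow.toList ∧ PopD L γ q := by
  simp only [automaton, List.mem_toFinset, List.mem_map, popTransD, Data.mem_filter,
    Prod.mk.injEq, mem_transD]
  constructor
  · rintro ⟨d, ⟨⟨-, h1, h2, hg, h3, h4, h5⟩, h6, h7, h8⟩, rfl, rfl, rfl, rfl, rfl⟩
    refine ⟨_, h2, rfl, rfl, h1, h3, h4, h5, h6, fun h => h7 ?_, fun γ hγ => ?_⟩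
    · by_contra hn
      simp [hn] at h
    · split_ifs at hγ with hn
      obtain ⟨γ', h9, h10⟩ := (mem_optList.1 hg).resolve_left hn
      have h11 := h8 hn
      rw [h10, tl_cons] at hγ h11
      rw [← Option.some.inj hγ]
      exact ⟨h9, h11⟩
  · rintro ⟨θ', h1, rfl, rfl, h2, h3, h4, h5, h6, h7, h8⟩
    cases g with
    | none =>
      exact ⟨.cons q (.cons θ' (.cons .nil q')), ⟨⟨rfl, h2, h1, mem_optList.2 (Or.inl rfl), h3,
        h4, h5⟩, h6, fun _ => h7 rfl, fun h => absurd rfl h⟩, rfl, rfl, rfl, rfl, rfl⟩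
    | some γ =>
      obtain ⟨h9, h10⟩ := h8 γ rfl
      exact ⟨.cons q (.cons θ' (.cons (.cons .nil γ) q')), ⟨⟨rfl, h2, h1,
        mem_optList.2 (Or.inr ⟨γ, h9, rfl⟩), h3, h4, h5⟩, h6, fun h => by simp at h,
        fun _ => h10⟩, rfl, rfl, rfl, by simp, rfl⟩

omit [RecProps P'] in
theorem isCode_absGuard (hG : ListsGuards φ lab G) {θ : Data}
    (hθ : θ ∈ G.pow.toList) : Rep.IsCode (absGuard φ lab θ) θ := by
  have hpair : ∀ c : Clock P' × Guard, Rep.IsCode c (pairCode c) := fun c => ⟨_, _, rfl, rfl, rfl⟩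
  refine ⟨θ.toList, by simp, fun c hc => ?_, fun y hy => ?_⟩
  · exact ⟨pairCode c, (Finset.mem_filter.1 hc).2, hpair c⟩
  · obtain ⟨c, hc, rfl⟩ := (hG y).1 (subset_of_mem_pow hθ y hy)
    exact ⟨c, Finset.mem_filter.2 ⟨hc, hy⟩, hpair c⟩

omit [RecProps P'] [DecidableEq P'] in
theorem isCode_letterOf (hK : ListsLabels lab K) (hlab : ∀ p, lab p ∈ closure φ) (s : Data) :
    Rep.IsCode (letterOf φ lab s) (letterD K s) := by
  refine ⟨(letterD K s).toList, by simp, fun p hp => ?_, fun y hy => ?_⟩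
  · refine ⟨Enc.code p, ?_, rfl⟩
    simp only [letterD, toList_map, List.mem_map, Data.mem_filter]
    exact ⟨_, ⟨(hK _).2 ⟨p, rfl⟩, (mem_absSet (hlab p)).1 (Finset.mem_filter.1 hp).2⟩, rfl⟩
  · simp only [letterD, toList_map, List.mem_map, Data.mem_filter] at hy
    obtain ⟨e, ⟨h1, h2⟩, rfl⟩ := hy
    obtain ⟨p, rfl⟩ := (hK e).1 h1
    exact ⟨p, Finset.mem_filter.2 ⟨Finset.mem_univ p, (mem_absSet (hlab p)).2 h2⟩, rfl⟩

theorem isCode_automaton (hK : ListsLabels lab K) (hG : ListsGuards φ lab G)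
    (hlab : ∀ p, lab p ∈ closure φ) :
    (automaton φ lab hl K G hL).IsCode (descD (φ.map some).code L K L.pow G.pow) := by
  classical
  refine ⟨_, _, rfl, isCode_toFinset _, _, _, rfl, isCode_toFinset _, _, _, rfl,
    isCode_toFinset _, _, _, rfl, isCode_toFinset_map fun d hd => ?_, _, _, rfl,
    isCode_toFinset_map fun d hd => ?_, _, _, rfl, isCode_toFinset_map fun d hd => ?_,
    isCode_toFinset_map fun d hd => isCode_toFinset _⟩
  · simp only [pushD, Data.mem_filter, mem_transD] at hd
    obtain ⟨⟨-, h1, h2, -, h3, h4, h5⟩, h6, h7⟩ := hd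
    exact ⟨_, _, rfl, rfl, _, _, rfl, isCode_letterOf hK hlab _, _, _, rfl,
      isCode_absGuard hG h2, _, _, rfl, rfl, rfl⟩
  · simp only [popTransD, Data.mem_filter, mem_transD] at hd
    obtain ⟨⟨-, h1, h2, hg, h3, h4, h5⟩, h6, h7⟩ := hd
    refine ⟨_, _, rfl, rfl, _, _, rfl, isCode_letterOf hK hlab _, _, _, rfl,
      isCode_absGuard hG h2, _, _, rfl, ?_, rfl⟩
    rcases mem_optList.1 hg with h | ⟨γ, -, h⟩
    · rw [h, if_pos rfl]; rfl
    · rw [h, if_neg (by simp)]; rfl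
  · simp only [intD, Data.mem_filter, mem_transD] at hd
    obtain ⟨⟨-, h1, h2, hg, h3, h4, h5⟩, h6, h7⟩ := hd
    exact ⟨_, _, rfl, rfl, _, _, rfl, isCode_letterOf hK hlab _, _, _, rfl,
      isCode_absGuard hG h2, rfl⟩

include hL in
/-- Each set of formulas of the closure is given by some state. -/
theorem exists_absSet_eq {A : Finset (Formula (Option (Fin (n + 3))))} (hA : A ⊆ closure φ) :
    ∃ s ∈ L.pow.toList, absSet φ s = A := by
  obtain ⟨s, hs, h⟩ := exists_mem_pow L fun e => ∃ ψ ∈ A, ψ.code = e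
  refine ⟨s, hs, Finset.ext fun ψ => ?_⟩
  constructor
  · intro h1
    obtain ⟨-, χ, h2, h3⟩ := (h _).1 ((mem_absSet (absSet_subset _ h1)).1 h1)
    rwa [← code_injective h3]
  · intro h1
    exact (mem_absSet (hA h1)).2 ((h _).2 ⟨(hL _).2 ⟨ψ, hA h1, rfl⟩, ψ, h1, rfl⟩)

omit [RecProps P'] [Fintype P'] [DecidableEq P'] in
theorem pairCode_injective (hE : Function.Injective (Enc.code : P' → Data)) :
    Function.Injective (pairCode : Clock P' × Guard → Data) := by
  rintro ⟨z, g⟩ ⟨z', g'⟩ h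
  simp only [pairCode, Data.cons.injEq] at h
  rw [code_clock_injective hE h.1, code_guard_injective h.2]

omit [RecProps P'] in
theorem exists_absGuard_eq (hE : Function.Injective (Enc.code : P' → Data))
    (hG : ListsGuards φ lab G) {θ : Constraint P'} (hθ : θ ⊆ guardSet φ lab) :
    ∃ s ∈ G.pow.toList, absGuard φ lab s = θ := by
  obtain ⟨s, hs, h⟩ := exists_mem_pow G fun e => ∃ c ∈ θ, pairCode c = e
  refine ⟨s, hs, Finset.ext fun c => ?_⟩
  rw [absGuard, Finset.mem_filter, h]
  constructor
  · rintro ⟨-, -, c', h2, h3⟩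
    rwa [← pairCode_injective hE h3]
  · exact fun h1 => ⟨hθ h1, (hG _).2 ⟨c, hθ h1, rfl⟩, c, h1, rfl⟩

/-- The runs of the automaton are the sequences of atoms that satisfy the local conditions. -/
theorem accepts_automaton_iff (hE : Function.Injective (Enc.code : P' → Data))
    (hK : ListsLabels lab K) (hG : ListsGuards φ lab G) (w : TimedWord P') :
    (automaton φ lab hl K G hL).Accepts w ↔
      ∃ α, GenHintikka φ lab w α ∧ GenFair φ α ∧ φ.map some ∈ α 0 := by
  classical
  constructor
  · rintro ⟨st, stk, hrun, hacc⟩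
    have key : ∀ i, letterOf φ lab (st i) = w.letter i ∧ StepD L (st i) (st (i + 1)) ∧
        ∃ θ, GuardD L K (st i) θ ∧ Constraint.Sat (absGuard φ lab θ) w i := by
      intro i
      rcases w.letter_mem i with h | h | h
      · obtain ⟨θ, γ, h1, -, h3⟩ := hrun.push i h
        obtain ⟨θ', -, rfl, h2, -, -, -, h4, h5, -⟩ := (mem_push_iff hl hL).1 h1
        exact ⟨h2, h4, θ', h5, h3⟩
      · obtain ⟨θ, g, h1, h3, -⟩ := hrun.pop i h
        obtain ⟨θ', -, rfl, h2, -, -, h4, h5, -⟩ := (mem_pop_iff hl hL).1 h1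
        exact ⟨h2, h4, θ', h5, h3⟩
      · obtain ⟨θ, h1, -, h3⟩ := hrun.internal i h
        obtain ⟨θ', -, rfl, h2, -, -, h4, h5, -⟩ := (mem_internal_iff hl hL).1 h1
        exact ⟨h2, h4, θ', h5, h3⟩
    -- The stack of the run holds the states at the pending calls.
    have hstk : ∀ i, stk i = (pstk w.letter i).map st := by
      intro i
      induction i with
      | zero => simpa [pstk] using hrun.start_stack
      | succ i ih =>
        rcases w.letter_mem i with h | h | h
        · obtain ⟨θ, γ, h1, h2, -⟩ := hrun.push i h
          obtain ⟨-, -, -, -, rfl, -⟩ := (mem_push_iff hl hL).1 h1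
          rw [h2, ih, pstk_succ_call h, List.map_cons]
        · obtain ⟨θ, g, -, -, ⟨γ, -, h2⟩ | ⟨-, h2, h3⟩⟩ := hrun.pop i h
          · rw [pstk_succ_ret h, List.map_tail, ← ih, h2, List.tail_cons]
          · rw [pstk_succ_ret h, List.map_tail, ← ih, h2, h3, List.tail_nil]
        · obtain ⟨θ, -, h2, -⟩ := hrun.internal i h
          rw [h2, ih, pstk_succ_int (fun h' => h.2.1 h'.1) fun h' => h.2.2 h'.1]
    have hfair : GenFair φ fun i => absSet φ (st i) := by
      refine (genFair_iff hL st).2 fun χ hχ m => ?_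
      obtain ⟨i, hi, h⟩ := hacc _ (List.mem_toFinset.2 (List.mem_map_of_mem hχ)) m
      exact ⟨i, hi, (Data.mem_filter.1 (List.mem_toFinset.1 h)).2⟩
    have hinit := (initD_iff hL _).1 (Data.mem_filter.1 (List.mem_toFinset.1 hrun.start)).2
    refine ⟨fun i => absSet φ (st i), (genHintikka_iff_local hl hfair.inf).2
      ⟨fun i p => ?_, hinit.2, fun i => (stepD_iff hL _ _).1 (key i).2.1, fun i j h => ?_,
        fun i h h' => ?_, fun i => ?_⟩, hfair, hinit.1⟩
    · rw [← (key i).1]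
      simp [letterOf]
    · rw [← popD_iff hL]
      obtain ⟨θ, g, h1, -, h2⟩ := hrun.pop j h.2.2.1
      have h3 := hstk j
      rw [h.pstk_eq, List.map_cons] at h3
      obtain ⟨γ, rfl, h4⟩ | ⟨-, h4, -⟩ := h2
      · rw [h3, List.cons.injEq] at h4
        rw [h4.1]
        obtain ⟨-, -, -, -, -, -, -, -, -, -, h5⟩ := (mem_pop_iff hl hL).1 h1
        exact (h5 γ rfl).2
      · simp [h3] at h4
    · rw [← prevTopCode_mem]
      obtain ⟨θ, g, h1, -, h2⟩ := hrun.pop i h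
      obtain ⟨-, -, -, -, -, -, -, -, -, h5, -⟩ := (mem_pop_iff hl hL).1 h1
      have h3 := hstk i
      rw [(pstk_eq_nil_iff w.letter_mem h).2 h', List.map_nil] at h3
      obtain ⟨γ, -, h4⟩ | ⟨h4, -⟩ := h2
      · simp [h3] at h4
      · exact h5 h4
    · obtain ⟨-, -, θ, h1, h2⟩ := key i
      exact (clocksAgree_iff i _).2
        ⟨_, Finset.filter_subset _ _, (guardD_iff hL hK _ _).1 h1, h2⟩
  · rintro ⟨α, H, hfair, hφ⟩
    choose st hst hα using fun i => exists_absSet_eq hL (H.atom i).sub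
    obtain rfl : (fun i => absSet φ (st i)) = α := funext hα
    obtain ⟨read, hinit, hstep, hpop, hbot, hclk⟩ := (genHintikka_iff_local hl hfair.inf).1 H
    have hlet : ∀ i, letterOf φ lab (st i) = w.letter i := fun i => by
      ext p
      simp [letterOf, read]
    have hθ : ∀ i, ∃ θ ∈ G.pow.toList, GuardD L K (st i) θ ∧
        Constraint.Sat (absGuard φ lab θ) w i := by
      intro i
      obtain ⟨θ, h1, h2, h3⟩ := (clocksAgree_iff i _).1 (hclk i)
      obtain ⟨θ, h4, rfl⟩ := exists_absGuard_eq hE hG h1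
      exact ⟨θ, h4, (guardD_iff hL hK _ _).2 h2, h3⟩
    have hstep' : ∀ i, StepD L (st i) (st (i + 1)) := fun i => (stepD_iff hL _ _).2 (hstep i)
    -- The stack of the run is read off the stack of pending calls.
    refine ⟨st, fun i => (pstk w.letter i).map st, ⟨?_, by simp [pstk], fun i h => ?_,
      fun i h => ?_, fun i h => ?_⟩, fun F hF m => ?_⟩
    · exact List.mem_toFinset.2 (Data.mem_filter.2 ⟨hst 0, (initD_iff hL _).2 ⟨hφ, hinit⟩⟩)
    · obtain ⟨θ, h1, h2, h3⟩ := hθ i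
      refine ⟨absGuard φ lab θ, st i, (mem_push_iff hl hL).2 ⟨θ, h1, rfl, hlet i, rfl, hst i,
        hst (i + 1), hstep' i, h2, ?_⟩, by rw [pstk_succ_call h, List.map_cons], h3⟩
      rw [callCode_mem (φ := φ)]
      exact (isCall_iff_of_read hl read i).1 h
    · obtain ⟨θ, h1, h2, h3⟩ := hθ i
      have hr : retCode ∈ (st i).toList := by
        rw [retCode_mem (φ := φ)]
        exact (isRet_iff_of_read hl read i).1 h
      cases hs : pstk w.letter i with
      | nil =>
        refine ⟨absGuard φ lab θ, none, (mem_pop_iff hl hL).2 ⟨θ, h1, rfl, hlet i, hst i,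
          hst (i + 1), hstep' i, h2, hr, fun _ => ?_, by simp⟩, h3, Or.inr ⟨rfl, ?_, ?_⟩⟩
        · rw [prevTopCode_mem (φ := φ)]
          exact hbot i h ((pstk_eq_nil_iff w.letter_mem h).1 hs)
        · simp
        · simp [pstk_succ_ret h, hs]
      | cons j rest =>
        refine ⟨absGuard φ lab θ, some (st j), (mem_pop_iff hl hL).2 ⟨θ, h1, rfl, hlet i, hst i,
          hst (i + 1), hstep' i, h2, hr, by simp, ?_⟩, h3, Or.inl ⟨_, rfl, ?_⟩⟩
        · rintro γ hγ
          obtain rfl := Option.some.inj hγ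
          exact ⟨hst j, (popD_iff hL _ _).2 (hpop j i (matching_of_pstk w.letter_mem h hs))⟩
        · simp [pstk_succ_ret h, hs]
    · obtain ⟨θ, h1, h2, h3⟩ := hθ i
      refine ⟨absGuard φ lab θ, (mem_internal_iff hl hL).2 ⟨θ, h1, rfl, hlet i, hst i,
        hst (i + 1), hstep' i, h2, ?_⟩,
        by rw [pstk_succ_int (fun h' => h.2.1 h'.1) fun h' => h.2.2 h'.1], h3⟩
      rw [intCode_mem (φ := φ), ← hl.intl_eq, ← read]
      exact h.1
    · obtain ⟨χ, hχ, rfl⟩ := List.mem_map.1 (List.mem_toFinset.1 hF)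
      obtain ⟨i, hi, h⟩ := (genFair_iff hL st).1 hfair χ hχ m
      exact ⟨i, hi, List.mem_toFinset.2 (Data.mem_filter.2 ⟨hst i, h⟩)⟩

end Automaton
end ECNTL
namespace ECNTL
open RecProps Data Formula

/-! ### The size of the automaton -/

theorem consts_subset_of_mem_sub {P : Type} [DecidableEq P] {χ φ : Formula P} (h : χ ∈ φ.sub) :
    χ.consts ⊆ φ.consts := by
  induction φ with
  | tru => simp [sub] at h; simp [h]
  | prop p => simp [sub] at h; simp [h]
  | or f g ihf ihg =>
    simp only [sub, Finset.mem_insert, Finset.mem_union] at h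
    rcases h with rfl | h | h
    · rfl
    · exact (ihf h).trans Finset.subset_union_left
    · exact (ihg h).trans Finset.subset_union_right
  | untl d f g ihf ihg =>
    simp only [sub, Finset.mem_insert, Finset.mem_union] at h
    rcases h with rfl | h | h
    · rfl
    · exact (ihf h).trans Finset.subset_union_left
    · exact (ihg h).trans Finset.subset_union_right
  | since d f g ihf ihg =>
    simp only [sub, Finset.mem_insert, Finset.mem_union] at h
    rcases h with rfl | h | h
    · rfl
    · exact (ihf h).trans Finset.subset_union_left
    · exact (ihg h).trans Finset.subset_union_right
  | neg f ih =>
    simp only [sub, Finset.mem_insert] at h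
    rcases h with rfl | h
    · rfl
    · exact ih h
  | next d f ih =>
    simp only [sub, Finset.mem_insert] at h
    rcases h with rfl | h
    · rfl
    · exact ih h
  | prev d f ih =>
    simp only [sub, Finset.mem_insert] at h
    rcases h with rfl | h
    · rfl
    · exact ih h
  | nextClock d I f ih =>
    simp only [sub, Finset.mem_insert] at h
    rcases h with rfl | h
    · rfl
    · exact (ih h).trans Finset.subset_union_right
  | prevClock d I f ih =>
    simp only [sub, Finset.mem_insert] at h
    rcases h with rfl | h
    · rfl
    · exact (ih h).trans Finset.subset_union_right

theorem consts_map {P P' : Type} (e : P → P') (φ : Formula P) : (φ.map e).consts = φ.consts := by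
  induction φ <;> simp_all [Formula.map, Formula.consts]

theorem card_closure_le {n : ℕ} (φ : Formula (Fin (n + 3))) :
    (closure φ).card ≤ 4 * φ.len + 2 * n + 14 := by
  have h1 : (closure φ).card ≤ (closureBase φ).card + (closureBase φ).card :=
    (Finset.card_union_le _ _).trans (Nat.add_le_add_left Finset.card_image_le _)
  have h2 : (closureBase φ).card ≤ 3 + (n + 3 + 1) + φ.len + φ.len := by
    refine (Finset.card_union_le _ _).trans (Nat.add_le_add ((Finset.card_union_le _ _).trans
      (Nat.add_le_add ((Finset.card_union_le _ _).trans (Nat.add_le_add Finset.card_le_three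
      ?_)) ?_)) ?_)
    · exact Finset.card_image_le.trans (by simp)
    · rw [sub_map_some]
      exact Finset.card_image_le
    · refine (Finset.card_biUnion_le_card_mul _ _ 1 fun χ _ => ?_).trans ?_
      · cases χ <;> simp [unfolding]
      · rw [mul_one, sub_map_some]
        exact Finset.card_image_le
  omega

section Bounds
variable {n : ℕ} {φ : Formula (Fin (n + 3))}
  {P' : Type} [RecProps P'] [Fintype P'] [DecidableEq P'] [Enc P']
  {lab : P' → Formula (Option (Fin (n + 3)))} (hl : IsLabelling lab) {L K G : Data}
  (hL : ListsClosure φ L)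

omit [RecProps P'] [Enc P'] in
theorem mem_guardSet_iff {c : Clock P' × Guard} : c ∈ guardSet φ lab ↔
    ∃ χ ∈ (φ.map some).sub, c ∈ guardPairs lab χ := by
  rw [guardSet, Finset.mem_biUnion]
  constructor
  · rintro ⟨χ, h1, h2⟩
    refine ⟨χ, ?_, h2⟩
    cases χ with
    | prevClock d I f => exact prevClock_mem_sub h1
    | nextClock d I f => exact nextClock_mem_sub h1
    | _ => simp [guardPairs] at h2
  · rintro ⟨χ, h1, h2⟩
    refine ⟨χ, mem_closure.2 (Or.inl (mem_closureBase.2 ?_)), h2⟩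
    exact Or.inr (Or.inr (Or.inr (Or.inr (Or.inl h1))))

theorem uses_automaton {c : Clock P' × Guard} (h : (automaton φ lab hl K G hL).Uses c) :
    c ∈ guardSet φ lab := by
  rcases h with ⟨⟨q, a, θ, q', γ⟩, hδ, h⟩ | ⟨⟨q, a, θ, g, q'⟩, hδ, h⟩ | ⟨⟨q, a, θ, q'⟩, hδ, h⟩
  · obtain ⟨θ', -, rfl, -⟩ := (mem_push_iff hl hL).1 hδ
    exact Finset.filter_subset _ _ h
  · obtain ⟨θ', -, rfl, -⟩ := (mem_pop_iff hl hL).1 hδ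
    exact Finset.filter_subset _ _ h
  · obtain ⟨θ', -, rfl, -⟩ := (mem_internal_iff hl hL).1 hδ
    exact Finset.filter_subset _ _ h

theorem consts_automaton : (automaton φ lab hl K G hL).consts ⊆ insert 0 (φ.consts : Set ℕ) := by
  rintro k ⟨z, g, h, hk⟩
  obtain ⟨χ, hχ, hz⟩ := mem_guardSet_iff.1 (uses_automaton hl hL h)
  have hc := consts_subset_of_mem_sub hχ
  rw [consts_map] at hc
  rw [← Finset.coe_insert, Finset.mem_coe]
  cases χ with
  | prevClock d I f =>
    simp only [guardPairs, Finset.mem_biUnion, Finset.mem_image, Prod.mk.injEq] at hz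
    obtain ⟨p, -, g', hg, -, rfl⟩ := hz
    exact Finset.insert_subset_insert 0 (Finset.subset_union_left.trans hc)
      (Interval.guards_consts hg hk)
  | nextClock d I f =>
    simp only [guardPairs, Finset.mem_biUnion, Finset.mem_image, Prod.mk.injEq] at hz
    obtain ⟨p, -, g', hg, -, rfl⟩ := hz
    exact Finset.insert_subset_insert 0 (Finset.subset_union_left.trans hc)
      (Interval.guards_consts hg hk)
  | _ => simp [guardPairs] at hz

omit [RecProps P'] [Enc P'] [DecidableEq P'] in
theorem card_filter_lab_le (hinj : Function.Injective lab) (f : Formula (Option (Fin (n + 3)))) :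
    (Finset.univ.filter fun p => lab p = f).card ≤ 1 :=
  Finset.card_le_one.2 fun _ hp _ hq => hinj
    ((Finset.mem_filter.1 hp).2.trans (Finset.mem_filter.1 hq).2.symm)

omit [RecProps P'] [Enc P'] in
/-- A real-time formula uses at most one clock. -/
theorem card_image_fst_guardPairs (hinj : Function.Injective lab)
    (χ : Formula (Option (Fin (n + 3)))) : ((guardPairs lab χ).image Prod.fst).card ≤ 1 := by
  refine Finset.card_le_one.2 fun z hz z' hz' => ?_
  simp only [Finset.mem_image] at hz hz'
  obtain ⟨⟨_, g⟩, hz, rfl⟩ := hz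
  obtain ⟨⟨_, g'⟩, hz', rfl⟩ := hz'
  cases χ with
  | prevClock d I f =>
    simp only [guardPairs, Finset.mem_biUnion, Finset.mem_image, Prod.mk.injEq, Finset.mem_filter,
      Finset.mem_univ, true_and] at hz hz'
    obtain ⟨p, hp, -, -, rfl, -⟩ := hz
    obtain ⟨q, hq, -, -, rfl, -⟩ := hz'
    rw [hinj (hp.trans hq.symm)]
  | nextClock d I f =>
    simp only [guardPairs, Finset.mem_biUnion, Finset.mem_image, Prod.mk.injEq, Finset.mem_filter,
      Finset.mem_univ, true_and] at hz hz'
    obtain ⟨p, hp, -, -, rfl, -⟩ := hz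
    obtain ⟨q, hq, -, -, rfl, -⟩ := hz'
    rw [hinj (hp.trans hq.symm)]
  | _ => simp [guardPairs] at hz

theorem clocks_automaton : (automaton φ lab hl K G hL).clocks.Finite ∧
    (automaton φ lab hl K G hL).clocks.ncard ≤ φ.len := by
  have hsub : (automaton φ lab hl K G hL).clocks ⊆
      ((φ.map some).sub.biUnion fun χ => (guardPairs lab χ).image Prod.fst : Finset _) := by
    rintro z ⟨g, h⟩
    obtain ⟨χ, h1, h2⟩ := mem_guardSet_iff.1 (uses_automaton hl hL h)
    exact Finset.mem_coe.2 (Finset.mem_biUnion.2 ⟨χ, h1, Finset.mem_image_of_mem _ h2⟩)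
  refine ⟨(Finset.finite_toSet _).subset hsub, (Set.ncard_le_ncard hsub
    (Finset.finite_toSet _)).trans ?_⟩
  rw [Set.ncard_coe_finset]
  refine (Finset.card_biUnion_le_card_mul _ _ 1 fun χ _ =>
    card_image_fst_guardPairs hl.injective χ).trans ?_
  rw [mul_one, sub_map_some]
  exact Finset.card_image_le

omit [RecProps P'] [Enc P'] in
theorem card_guardSet_le (hinj : Function.Injective lab) :
    (guardSet φ lab).card ≤ 4 * (closure φ).card := by
  rw [mul_comm]
  refine Finset.card_biUnion_le_card_mul _ _ 4 fun χ _ => ?_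
  have h4 : ∀ (I : Interval) (z : P' → Clock P') (p : P'),
      (I.guards.image fun g => (z p, g)).card ≤ 4 := fun I z p =>
    Finset.card_image_le.trans Finset.card_le_four
  cases χ with
  | prevClock d I f =>
    exact (Finset.card_biUnion_le_card_mul _ _ 4 fun p _ => h4 I (.recorder d) p).trans
      (Nat.mul_le_mul_right 4 (card_filter_lab_le hinj f))
  | nextClock d I f =>
    exact (Finset.card_biUnion_le_card_mul _ _ 4 fun p _ => h4 I (.predictor d) p).trans
      (Nat.mul_le_mul_right 4 (card_filter_lab_le hinj f))
  | _ => simp [guardPairs]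

theorem card_toFinset_pow_le (L : Data) : L.pow.toList.toFinset.card ≤ 2 ^ L.toList.length := by
  rw [← length_pow]
  exact List.toFinset_card_le _

end Bounds
end ECNTL
namespace ECNTL
open RecProps Data Formula

/-! ### Programs for formulas -/

/-- The list of the codes of the immediate subformulas. -/
noncomputable def argsD (e : Data) : Data :=
  if e.hd = tag 2 then .cons e.tl.hd (.cons e.tl.tl .nil) else
  if e.hd = tag 3 then .cons e.tl .nil else
  if e.hd = tag 4 ∨ e.hd = tag 5 then .cons e.tl.tl .nil else
  if e.hd = tag 6 ∨ e.hd = tag 7 then .cons e.tl.tl.hd (.cons e.tl.tl.tl .nil) else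
  if e.hd = tag 8 ∨ e.hd = tag 9 then .cons e.tl.tl.tl .nil else .nil

theorem size_argsD_le (e : Data) : (argsD e).size ≤ e.size := by
  have h2 : ∀ d : Data, d.hd.size + d.tl.size ≤ d.size + 1 := by
    intro d; cases d <;> simp; omega
  have h3 := h2 e.tl
  have h4 := h2 e.tl.tl
  have h5 := e.tl.hd.size_pos
  have h6 := e.tl.tl.hd.size_pos
  have h8 : ∀ k, e.hd = tag (k + 1) → e.size = 2 * k + 4 + e.tl.size := by
    intro k h
    cases e with
    | nil => simp [tag] at h
    | cons a b => obtain rfl : a = tag (k + 1) := h; simp [size_tag]; omega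
  unfold argsD
  split
  · next h => have := h8 1 h; simp; omega
  split
  · next h => have := h8 2 h; simp; omega
  split
  · next h => rcases h with h | h <;> have := h8 _ h <;> simp <;> omega
  split
  · next h => rcases h with h | h <;> have := h8 _ h <;> simp <;> omega
  split
  · next h => rcases h with h | h <;> have := h8 _ h <;> simp <;> omega
  · exact e.size_pos

theorem PT.argsD {F : Data → Data} (hF : PT F) : PT fun x => argsD (F x) := by
  classical
  have h : ∀ k, PTP fun x => (F x).hd = tag k := fun k => .eq (.hd hF) (.const _)
  exact PTP.ite (h 2) (.pair (.hd (.tl hF)) (.pair (.tl (.tl hF)) .nil))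
    (PTP.ite (h 3) (.pair (.tl hF) .nil)
    (PTP.ite (.or (h 4) (h 5)) (.pair (.tl (.tl hF)) .nil)
    (PTP.ite (.or (h 6) (h 7)) (.pair (.hd (.tl (.tl hF))) (.pair (.tl (.tl (.tl hF))) .nil))
    (PTP.ite (.or (h 8) (h 9)) (.pair (.tl (.tl (.tl hF))) .nil) .nil))))

/-- One step of the traversal of a formula. The left component collects the subformulas visited,
the right one is the stack of those still to be visited. -/
noncomputable def visit (y : Data) : Data :=
  if y.tl = .nil then y else
    .cons (.cons y.tl.hd y.hd) (listCode ((argsD y.tl.hd).toList ++ y.tl.tl.toList))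

theorem PT.visit : PT visit := by
  classical
  exact PTP.ite (.eq_nil (.tl .id)) .id (.pair (.pair (.hd (.tl .id)) (.hd .id))
    (.append (.argsD (.hd (.tl .id))) (.tl (.tl .id))))

theorem visit_size (y : Data) : (visit y).hd.size ≤ y.hd.size + y.tl.size ∧
    (y.tl ≠ .nil → (visit y).tl.size < y.tl.size) ∧ (y.tl = .nil → visit y = y) := by
  refine ⟨?_, fun h => ?_, fun h => if_pos h⟩
  · unfold visit
    split_ifs with h
    · omega
    · obtain ⟨a, b, hab⟩ : ∃ a b, y.tl = .cons a b := by
        cases hy : y.tl with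
        | nil => exact absurd hy h
        | cons a b => exact ⟨a, b, rfl⟩
      have := b.size_pos
      simp [hab]; omega
  · obtain ⟨a, b, hab⟩ : ∃ a b, y.tl = .cons a b := by
      cases hy : y.tl with
      | nil => exact absurd hy h
      | cons a b => exact ⟨a, b, rfl⟩
    have h1 := size_listCode_append (argsD a).toList b.toList
    have h2 := size_argsD_le a
    rw [listCode_toList, listCode_toList] at h1
    simp only [visit, hab, hd_cons, tl_cons, size_cons, reduceCtorEq, if_false]
    omega

/-- The stack shrinks at each step, so that a number of steps equal to its size empties it, while
the list of visited subformulas stays of quadratic size. -/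
theorem visit_iterate_size (x : Data) (j : ℕ) : (visit^[j] x).tl.size ≤ x.tl.size ∧
    (visit^[j] x).hd.size ≤ x.hd.size + j * x.tl.size ∧
    ((visit^[j] x).tl = .nil ∨ (visit^[j] x).tl.size + j ≤ x.tl.size) := by
  induction j with
  | zero => simp
  | succ j ih =>
    obtain ⟨h1, h2, h3⟩ := visit_size (visit^[j] x)
    obtain ⟨h4, h5, h6⟩ := ih
    rw [Function.iterate_succ_apply', Nat.add_mul, one_mul]
    by_cases h : (visit^[j] x).tl = .nil
    · rw [h3 h]
      exact ⟨h4, by omega, Or.inl h⟩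
    · have := h2 h
      have := h6.resolve_left h
      exact ⟨by omega, by omega, Or.inr (by omega)⟩

theorem visit_iterate_tl (x : Data) : (visit^[x.size] x).tl = .nil := by
  refine (visit_iterate_size x x.size).2.2.resolve_right fun h => ?_
  have := tl_size_le x
  have := (visit^[x.size] x).tl.size_pos
  omega

theorem PT.visit_iterate : PT fun x => ECNTL.visit^[x.size] x := by
  refine PT.iterate PT.visit (PT.tl .id) (fun x => (visit_size x).2.2) 3 fun x =>
    ⟨x.size, ?_, visit_iterate_tl x, rfl, fun j hj => ?_⟩
  · exact (Nat.le_succ _).trans (Nat.le_self_pow (by simp) _)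
  · obtain ⟨h1, h2, -⟩ := visit_iterate_size x j
    have h3 := tl_size_le x
    have h4 := hd_size_le x
    have h5 : (ECNTL.visit^[j] x).size ≤
        (ECNTL.visit^[j] x).hd.size + (ECNTL.visit^[j] x).tl.size + 1 := by
      cases (ECNTL.visit^[j] x) <;> simp
    have h6 : j * x.tl.size ≤ x.size * x.size := Nat.mul_le_mul hj h3
    have : (x.size + 1) ^ 3 = x.size ^ 3 + 3 * x.size ^ 2 + 3 * x.size + 1 := by ring
    nlinarith [Nat.zero_le (x.size ^ 3)]

/-- The codes of the subformulas of the formula with code `d`, each after its own subformulas. -/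
noncomputable def subsD (d : Data) : Data :=
  (visit^[(Data.cons .nil (.cons d .nil)).size] (.cons .nil (.cons d .nil))).hd

theorem PT.subsD {F : Data → Data} (hF : PT F) : PT fun x => subsD (F x) :=
  .hd (PT.comp PT.visit_iterate (.pair .nil (.pair hF .nil)))

/-- The subformulas, with repetitions, each occurrence after those of its own subformulas. -/
def Formula.postorder {P : Type} : Formula P → List (Formula P)
  | tru => [tru]
  | prop p => [prop p]
  | or f g => g.postorder ++ f.postorder ++ [or f g]
  | neg f => f.postorder ++ [neg f]
  | next d f => f.postorder ++ [next d f]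
  | prev d f => f.postorder ++ [prev d f]
  | untl d f g => g.postorder ++ f.postorder ++ [untl d f g]
  | since d f g => g.postorder ++ f.postorder ++ [since d f g]
  | nextClock d I f => f.postorder ++ [nextClock d I f]
  | prevClock d I f => f.postorder ++ [prevClock d I f]

theorem mem_postorder {P : Type} [DecidableEq P] {φ χ : Formula P} :
    χ ∈ φ.postorder ↔ χ ∈ φ.sub := by
  induction φ <;> simp_all [postorder, sub] <;> tauto

section Codes
variable {P : Type} [Enc P]

/-- The traversal of a formula on top of the stack ends with its subformulas listed in postorder. -/
theorem visit_postorder (φ : Formula P) : ∀ (l : List Data) (w : Data), ∃ m,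
    visit^[m] (.cons (listCode l) (.cons φ.code w)) =
      .cons (listCode ((φ.postorder.map Formula.code) ++ l)) w := by
  have step : ∀ (φ : Formula P) (l : List Data) (w : Data),
      visit (.cons (listCode l) (.cons φ.code w)) =
        .cons (listCode (φ.code :: l)) (listCode (φ.args.map Formula.code ++ w.toList)) := by
    intro φ l w
    cases φ <;> simp [visit, argsD, Formula.code, args, tag_inj, listCode]
  induction φ with
  | tru | prop p => exact fun l w => ⟨1, by simp [step, args, postorder]⟩
  | or f g ihf ihg | untl d f g ihf ihg | since d f g ihf ihg =>
    intro l w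
    obtain ⟨m, hm⟩ := ihf (_ :: l) (.cons g.code w)
    obtain ⟨k, hk⟩ := ihg (f.postorder.map Formula.code ++ (_ :: l)) w
    refine ⟨k + (m + 1), ?_⟩
    rw [Function.iterate_add_apply, Function.iterate_succ_apply, step]
    simp only [args, List.map_cons, List.map_nil, List.cons_append, List.nil_append, listCode,
      listCode_toList] at hm hk ⊢
    rw [hm, hk]
    simp [postorder]
  | neg f ih | next d f ih | prev d f ih | nextClock d I f ih | prevClock d I f ih =>
    intro l w
    obtain ⟨m, hm⟩ := ih (_ :: l) w
    refine ⟨m + 1, ?_⟩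
    rw [Function.iterate_succ_apply, step]
    simp only [args, List.map_cons, List.map_nil, List.cons_append, List.nil_append, listCode,
      listCode_toList] at hm ⊢
    rw [hm]
    simp [postorder]

theorem subsD_code (φ : Formula P) : subsD φ.code = listCode (φ.postorder.map Formula.code) := by
  obtain ⟨m, hm⟩ := visit_postorder φ [] .nil
  simp only [List.append_nil] at hm
  set x : Data := .cons .nil (.cons φ.code .nil) with hx
  have h1 := visit_iterate_tl x
  have h2 : ∀ y : Data, y.tl = .nil → ∀ d, visit^[d] y = y := fun y hy d =>
    Function.iterate_fixed ((visit_size y).2.2 hy) d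
  have h3 : visit^[x.size] x = visit^[m] x := by
    rcases le_total x.size m with h | h
    · obtain ⟨d, rfl⟩ := Nat.exists_eq_add_of_le h
      rw [Nat.add_comm, Function.iterate_add_apply, h2 _ h1]
    · obtain ⟨d, hd⟩ := Nat.exists_eq_add_of_le h
      rw [hd, Nat.add_comm, Function.iterate_add_apply, h2 _ (by rw [hx]; erw [hm]; rfl)]
  rw [subsD, ← hx, h3]
  erw [hm]
  rfl

end Codes
end ECNTL
namespace ECNTL
open RecProps Data Formula

/-! ### Programs for the closure and the clock constraints -/

/-- One step of the evaluation of the renaming of propositions `p` to `some p`: the values of the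
immediate subformulas of `e` on top of the stack `v` are replaced by the value of `e`. -/
noncomputable def renameStep (v e : Data) : Data :=
  if e.hd = tag 1 then .cons (.cons (tag 1) (.cons .nil e.tl)) v else
  if e.hd = tag 2 then .cons (.cons (tag 2) (.cons v.hd v.tl.hd)) v.tl.tl else
  if e.hd = tag 3 then .cons (.cons (tag 3) v.hd) v.tl else
  if e.hd = tag 4 ∨ e.hd = tag 5 then .cons (.cons e.hd (.cons e.tl.hd v.hd)) v.tl else
  if e.hd = tag 6 ∨ e.hd = tag 7 then
    .cons (.cons e.hd (.cons e.tl.hd (.cons v.hd v.tl.hd))) v.tl.tl else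
  if e.hd = tag 8 ∨ e.hd = tag 9 then
    .cons (.cons e.hd (.cons e.tl.hd (.cons e.tl.tl.hd v.hd))) v.tl else .cons e v

theorem size_renameStep_le (v e : Data) : (renameStep v e).size ≤ v.size + 3 * e.size + 20 := by
  have h2 : ∀ d : Data, d.hd.size + d.tl.size ≤ d.size + 1 := by
    intro d; cases d <;> simp; omega
  have h3 := h2 e
  have h4 := h2 e.tl
  have h5 := h2 e.tl.tl
  have h6 := h2 v
  have h7 := h2 v.tl
  have := e.hd.size_pos
  have := e.tl.size_pos
  have := e.tl.hd.size_pos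
  have := e.tl.tl.size_pos
  have := e.tl.tl.tl.size_pos
  unfold renameStep
  repeat' split
  all_goals (simp only [size_cons, size_nil, size_tag]; omega)

/-- The code of the formula with code `d` after the renaming of propositions `p` to `some p`. -/
noncomputable def renameD (d : Data) : Data :=
  ((subsD d).toList.foldl (fun v e => renameStep v e) .nil).hd

theorem PT.renameD {F : Data → Data} (hF : PT F) : PT fun x => renameD (F x) := by
  classical
  have hv : PT fun y => (fun _ e v => renameStep v e : Data → Data → Data → Data)
      y.hd y.tl.hd y.tl.tl := by
    have he : PT fun y => y.tl.hd := .hd (.tl .id)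
    have hv : PT fun y => y.tl.tl := .tl (.tl .id)
    have h : ∀ k, PTP fun y => y.tl.hd.hd = tag k := fun k => .eq (.hd he) (.const _)
    unfold renameStep
    refine PTP.ite (h 1) (.pair (.pair (.const _) (.pair .nil (.tl he))) hv)
      (PTP.ite (h 2) (.pair (.pair (.const _) (.pair (.hd hv) (.hd (.tl hv)))) (.tl (.tl hv)))
      (PTP.ite (h 3) (.pair (.pair (.const _) (.hd hv)) (.tl hv))
      (PTP.ite (.or (h 4) (h 5)) (.pair (.pair (.hd he) (.pair (.hd (.tl he)) (.hd hv))) (.tl hv))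
      (PTP.ite (.or (h 6) (h 7)) (.pair (.pair (.hd he) (.pair (.hd (.tl he))
        (.pair (.hd hv) (.hd (.tl hv))))) (.tl (.tl hv)))
      (PTP.ite (.or (h 8) (h 9)) (.pair (.pair (.hd he) (.pair (.hd (.tl he))
        (.pair (.hd (.tl (.tl he))) (.hd hv)))) (.tl hv)) (.pair he hv))))))
  have hL : PT ECNTL.subsD := PT.subsD .id
  have h : PT ECNTL.renameD := by
    refine PT.hd (PT.foldl_of_growth (g := fun _ e v => renameStep v e) hL PT.nil hv ?_)
    obtain ⟨k, hk⟩ := hL.size_le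
    refine ⟨k + 5, fun x e he a => (size_renameStep_le a e).trans ?_⟩
    have h1 := (size_of_mem he).le.trans (hk x)
    have h2 : 1 ≤ (x.size + 1) ^ k := Nat.one_le_pow _ _ (by omega)
    have h3 : 2 ^ 5 ≤ (x.size + 1) ^ 5 := Nat.pow_le_pow_left (two_le_size_add_one x) 5
    have h4 : (x.size + 1) ^ k * 2 ^ 5 ≤ (x.size + 1) ^ (k + 5) := by
      rw [pow_add]; exact Nat.mul_le_mul_left _ h3
    omega
  exact PT.comp h hF

theorem renameD_code {P : Type} [Enc P] (φ : Formula P) :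
    renameD φ.code = (φ.map some).code := by
  -- In postorder, the values of the immediate subformulas are on top of the stack when needed.
  have key : ∀ (φ : Formula P) (v : Data),
      (φ.postorder.map Formula.code).foldl (fun v e => renameStep v e) v =
        .cons (φ.map some).code v := by
    intro φ
    induction φ with
    | tru | prop p =>
      intro v; simp [postorder, renameStep, Formula.code, tag_inj, Formula.map]; try rfl
    | or f g ihf ihg | untl d f g ihf ihg | since d f g ihf ihg =>
      intro v
      simp only [postorder, List.map_append, List.foldl_append, ihf, ihg]
      simp [renameStep, Formula.code, tag_inj, Formula.map]
    | neg f ih | next d f ih | prev d f ih | nextClock d I f ih | prevClock d I f ih =>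
      intro v
      simp only [postorder, List.map_append, List.foldl_append, ih]
      simp [renameStep, Formula.code, tag_inj, Formula.map]
  rw [renameD, subsD_code, toList_listCode, key, hd_cons]

/-- The code of the negation of the formula with code `e`. -/
noncomputable def negD (e : Data) : Data := if e.hd = tag 3 then e.tl else .cons (tag 3) e

/-- The list of the codes of the unfoldings of the formula with code `e`. -/
noncomputable def unfoldD (e : Data) : Data :=
  if e.hd = tag 6 then .cons (.cons (tag 4) (.cons e.tl.hd e)) .nil else
  if e.hd = tag 7 then .cons (.cons (tag 5) (.cons e.tl.hd e)) .nil else .nil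

/-- The codes of the formulas of the closure without the negations, where `pl` is the list of all
propositions and `F` the code of the formula with propositions renamed. -/
noncomputable def baseD (pl F : Data) : Data :=
  listCode ((Data.cons truCode (.cons nextTopCode (.cons prevTopCode (.cons pInfCode
    (pl.map fun c => .cons (tag 1) (.cons .nil c)))))).toList ++
    (listCode ((subsD F).toList ++ ((subsD F).flatMap unfoldD).toList)).toList)

/-- The codes of the formulas of the closure. Repetitions are removed, since the length of the list
enters the number of states exponentially. -/
noncomputable def closureD (pl F : Data) : Data :=
  (listCode ((baseD pl F).toList ++ ((baseD pl F).map negD).toList)).dedup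

theorem PT.negD {F : Data → Data} (hF : PT F) : PT fun x => negD (F x) := by
  classical
  exact PTP.ite (.eq (.hd hF) (.const _)) (.tl hF) (.pair (.const _) hF)

theorem PT.unfoldD {F : Data → Data} (hF : PT F) : PT fun x => unfoldD (F x) := by
  classical
  exact PTP.ite (.eq (.hd hF) (.const _))
      (.pair (.pair (.const _) (.pair (.hd (.tl hF)) hF)) .nil)
    (PTP.ite (.eq (.hd hF) (.const _))
      (.pair (.pair (.const _) (.pair (.hd (.tl hF)) hF)) .nil) .nil)

theorem PT.closureD {Fp FF : Data → Data} (hp : PT Fp) (hF : PT FF) :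
    PT fun x => closureD (Fp x) (FF x) := by
  have hb : PT fun x => baseD (Fp x) (FF x) :=
    .append (.pair (.const _) (.pair (.const _) (.pair (.const _) (.pair (.const _)
      (PT.map (f := fun _ c => .cons (tag 1) (.cons .nil c)) hp
        (.pair (.const _) (.pair .nil (.tl .id))))))))
      (.append (.subsD hF) (PT.flatMap (f := fun _ e => ECNTL.unfoldD e) (.subsD hF)
        (.unfoldD (.tl .id))))
  exact .dedup (.append hb (PT.map (f := fun _ e => ECNTL.negD e) hb (.negD (.tl .id))))

section
variable {n : ℕ}

/-- The list of all propositions. -/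
def propList (n : ℕ) : Data := listCode ((List.finRange (n + 3)).map Enc.code)

theorem mem_propList {d : Data} : d ∈ (propList n).toList ↔ ∃ p : Fin (n + 3), Enc.code p = d := by
  simp [propList]

theorem mem_unfoldD {χ : Formula (Option (Fin (n + 3)))} {d : Data} :
    d ∈ (unfoldD χ.code).toList ↔ ∃ ψ ∈ χ.unfolding, ψ.code = d := by
  cases χ <;> simp [unfoldD, Formula.code, tag_inj, unfolding, eq_comm]

theorem exists_mem_closureBase (φ : Formula (Fin (n + 3)))
    (q : Formula (Option (Fin (n + 3))) → Prop) :
    (∃ ψ ∈ closureBase φ, q ψ) ↔ q tru ∨ q (next .abs tru) ∨ q (prev .abs tru) ∨ (∃ p, q (prop p)) ∨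
      (∃ χ ∈ (φ.map some).sub, q χ) ∨ ∃ χ ∈ (φ.map some).sub, ∃ ψ ∈ χ.unfolding, q ψ := by
  simp only [mem_closureBase]
  constructor
  · rintro ⟨ψ, rfl | rfl | rfl | ⟨p, rfl⟩ | h | ⟨χ, h, h'⟩, hq⟩
    · exact Or.inl hq
    · exact Or.inr (Or.inl hq)
    · exact Or.inr (Or.inr (Or.inl hq))
    · exact Or.inr (Or.inr (Or.inr (Or.inl ⟨p, hq⟩)))
    · exact Or.inr (Or.inr (Or.inr (Or.inr (Or.inl ⟨_, h, hq⟩))))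
    · exact Or.inr (Or.inr (Or.inr (Or.inr (Or.inr ⟨χ, h, _, h', hq⟩))))
  · rintro (hq | hq | hq | ⟨p, hq⟩ | ⟨χ, h, hq⟩ | ⟨χ, h, ψ, h', hq⟩)
    · exact ⟨tru, Or.inl rfl, hq⟩
    · exact ⟨next .abs tru, Or.inr (Or.inl rfl), hq⟩
    · exact ⟨prev .abs tru, Or.inr (Or.inr (Or.inl rfl)), hq⟩
    · exact ⟨_, Or.inr (Or.inr (Or.inr (Or.inl ⟨p, rfl⟩))), hq⟩
    · exact ⟨χ, Or.inr (Or.inr (Or.inr (Or.inr (Or.inl h)))), hq⟩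
    · exact ⟨ψ, Or.inr (Or.inr (Or.inr (Or.inr (Or.inr ⟨χ, h, h'⟩)))), hq⟩

theorem mem_baseD (φ : Formula (Fin (n + 3))) (d : Data) :
    d ∈ (baseD (propList n) (φ.map some).code).toList ↔ ∃ ψ ∈ closureBase φ, ψ.code = d := by
  have hp : (∃ p : Option (Fin (n + 3)), (prop p).code = d) ↔
      pInfCode = d ∨ ∃ p : Fin (n + 3), Data.cons (tag 1) (.cons .nil (Enc.code p)) = d := by
    constructor
    · rintro ⟨_ | p, rfl⟩
      · exact Or.inl rfl
      · exact Or.inr ⟨p, rfl⟩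
    · rintro (rfl | ⟨p, rfl⟩)
      · exact ⟨none, rfl⟩
      · exact ⟨some p, rfl⟩
  have h0 : (tru : Formula (Option (Fin (n + 3)))).code = truCode ∧
    (next .abs tru : Formula (Option (Fin (n + 3)))).code = nextTopCode ∧
    (prev .abs tru : Formula (Option (Fin (n + 3)))).code = prevTopCode := ⟨rfl, rfl, rfl⟩
  rw [exists_mem_closureBase, hp, h0.1, h0.2.1, h0.2.2]
  simp only [← mem_unfoldD]
  simp only [baseD, subsD_code, toList_listCode, toList_cons, toList_map, toList_flatMap,
    List.mem_append, List.mem_cons, List.mem_map, List.mem_flatMap, mem_propList,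
    exists_exists_eq_and, exists_exists_and_eq_and, mem_postorder, or_assoc, eq_comm (a := d)]

theorem listsClosure_closureD (φ : Formula (Fin (n + 3))) :
    ListsClosure φ (closureD (propList n) (φ.map some).code) := by
  intro d
  have hneg : ∀ ψ : Formula (Option (Fin (n + 3))), negD ψ.code = ψ.negate.code := fun ψ =>
    (code_negate ψ).symm
  rw [closureD, (dedup_spec _).2]
  simp only [toList_listCode, toList_map, List.mem_append, List.mem_map, mem_baseD,
    mem_closure]
  constructor
  · rintro (⟨ψ, h, rfl⟩ | ⟨e, ⟨ψ, h, rfl⟩, rfl⟩)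
    · exact ⟨ψ, Or.inl h, rfl⟩
    · exact ⟨ψ.negate, Or.inr ⟨ψ, h, rfl⟩, (hneg ψ).symm⟩
  · rintro ⟨ψ, h | ⟨χ, h, rfl⟩, rfl⟩
    · exact Or.inl ⟨ψ, h, rfl⟩
    · exact Or.inr ⟨_, ⟨χ, h, rfl⟩, hneg χ⟩

theorem length_closureD_le (φ : Formula (Fin (n + 3))) :
    (closureD (propList n) (φ.map some).code).toList.length ≤ (closure φ).card := by
  rw [← List.toFinset_card_of_nodup (show (closureD _ _).toList.Nodup from (dedup_spec _).1)]
  refine (Finset.card_le_card fun d hd => ?_).trans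
    (Finset.card_image_le (s := closure φ) (f := Formula.code))
  exact Finset.mem_image.2 ((listsClosure_closureD φ d).1 (List.mem_toFinset.1 hd))

end

/-- The codes of the atomic constraints on the clock with code `z` for the interval with code
`I`. -/
noncomputable def guardsD (z I : Data) : Data :=
  .cons (.cons z (.cons .nil I)) (.cons (.cons z (belowCode I)) (.cons (.cons z (aboveCode I))
    (.cons (.cons z .nil) .nil)))

/-- The codes of the atomic constraints used by the automaton: for each real-time formula `χ` in `L`
and each proposition of the alphabet whose label, according to `K`, is the argument of `χ`. -/
noncomputable def guardListD (L K : Data) : Data :=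
  (L.flatMap fun χ => K.flatMap fun e =>
    if e.tl = χ.tl.tl.tl ∧ χ.hd = tag 9 then
      guardsD (.cons (tag 0) (.cons χ.tl.hd e.hd)) χ.tl.tl.hd else
    if e.tl = χ.tl.tl.tl ∧ χ.hd = tag 8 then
      guardsD (.cons (tag 1) (.cons χ.tl.hd e.hd)) χ.tl.tl.hd else .nil).dedup

theorem PT.guardsD {Fz FI : Data → Data} (hz : PT Fz) (hI : PT FI) :
    PT fun x => guardsD (Fz x) (FI x) :=
  .pair (.pair hz (.pair .nil hI)) (.pair (.pair hz (.belowCode hI)) (.pair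
    (.pair hz (.aboveCode hI)) (.pair (.pair hz .nil) .nil)))

theorem PT.guardListD {FL FK : Data → Data} (hL : PT FL) (hK : PT FK) :
    PT fun x => guardListD (FL x) (FK x) := by
  classical
  have h : PT fun x => ECNTL.guardListD x.hd x.tl := by
    have hχ : PT fun y => y.hd.tl := .tl (.hd .id)
    have he : PT fun y => y.tl := .tl .id
    refine .dedup (PT.flatMap (f := fun x χ => x.tl.flatMap fun e => _) (.hd .id)
      (PT.flatMap (f := fun y e => _) (.tl (.hd .id)) ?_))
    refine PTP.ite (.and (.eq (.tl he) (.tl (.tl (.tl hχ)))) (.eq (.hd hχ) (.const _)))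
      (.guardsD (.pair (.const _) (.pair (.hd (.tl hχ)) (.hd he))) (.hd (.tl (.tl hχ))))
      (PTP.ite (.and (.eq (.tl he) (.tl (.tl (.tl hχ)))) (.eq (.hd hχ) (.const _)))
      (.guardsD (.pair (.const _) (.pair (.hd (.tl hχ)) (.hd he))) (.hd (.tl (.tl hχ)))) .nil)
  exact PT.comp (G := fun x => ECNTL.guardListD x.hd x.tl) h (.pair hL hK)

section Guards
variable {n : ℕ} {φ : Formula (Fin (n + 3))}
  {P' : Type} [Fintype P'] [DecidableEq P'] [Enc P']
  {lab : P' → Formula (Option (Fin (n + 3)))} {L K : Data}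

omit [Fintype P'] [DecidableEq P'] in
theorem mem_guardsD (z : Clock P') (I : Interval) (d : Data) :
    d ∈ (guardsD (Enc.code z) (Enc.code I)).toList ↔ ∃ g ∈ I.guards, pairCode (z, g) = d := by
  simp only [guardsD, belowCode_code, aboveCode_code, toList_cons, toList_nil, List.mem_cons,
    List.not_mem_nil, or_false, Interval.guards, Finset.mem_insert, Finset.mem_singleton,
    exists_eq_or_imp, exists_eq_left, eq_comm (b := d)]
  rfl

theorem listsGuards_guardListD (hL : ListsClosure φ L) (hK : ListsLabels lab K) :
    ListsGuards φ lab (guardListD L K) := by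
  intro d
  rw [guardListD, (dedup_spec _).2]
  simp only [toList_flatMap, List.mem_flatMap, guardSet, Finset.mem_biUnion]
  constructor
  · rintro ⟨c, hc, e, he, hd⟩
    obtain ⟨χ, hχ, rfl⟩ := (hL c).1 hc
    obtain ⟨p, rfl⟩ := (hK e).1 he
    split_ifs at hd with h1 h2
    · obtain ⟨d', I, f, rfl⟩ := exists_eq_prevClock h1.2
      obtain rfl : lab p = f := code_injective h1.1
      obtain ⟨g, hg, rfl⟩ := (mem_guardsD (.recorder d' p) I d).1 hd
      exact ⟨_, ⟨_, hχ, by simp [guardPairs, hg]⟩, rfl⟩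
    · obtain ⟨d', I, f, rfl⟩ := exists_eq_nextClock h2.2
      obtain rfl : lab p = f := code_injective h2.1
      obtain ⟨g, hg, rfl⟩ := (mem_guardsD (.predictor d' p) I d).1 hd
      exact ⟨_, ⟨_, hχ, by simp [guardPairs, hg]⟩, rfl⟩
    · simp at hd
  · rintro ⟨c, ⟨χ, hχ, hc⟩, rfl⟩
    cases χ with
    | prevClock d I f =>
      simp only [guardPairs, Finset.mem_biUnion, Finset.mem_image, Finset.mem_filter,
        Finset.mem_univ, true_and] at hc
      obtain ⟨p, rfl, g, hg, rfl⟩ := hc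
      refine ⟨_, (hL _).2 ⟨_, hχ, rfl⟩, _, (hK _).2 ⟨p, rfl⟩, ?_⟩
      rw [if_pos ⟨rfl, rfl⟩]
      exact (mem_guardsD (.recorder d p) I _).2 ⟨g, hg, rfl⟩
    | nextClock d I f =>
      simp only [guardPairs, Finset.mem_biUnion, Finset.mem_image, Finset.mem_filter,
        Finset.mem_univ, true_and] at hc
      obtain ⟨p, rfl, g, hg, rfl⟩ := hc
      refine ⟨_, (hL _).2 ⟨_, hχ, rfl⟩, _, (hK _).2 ⟨p, rfl⟩, ?_⟩
      rw [if_neg (by simp [Formula.code, tag_inj]), if_pos ⟨rfl, rfl⟩]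
      exact (mem_guardsD (.predictor d p) I _).2 ⟨g, hg, rfl⟩
    | _ => simp [guardPairs] at hc

theorem length_guardListD_le (hL : ListsClosure φ L) (hK : ListsLabels lab K) :
    (guardListD L K).toList.length ≤ (guardSet φ lab).card := by
  rw [← List.toFinset_card_of_nodup (show (guardListD _ _).toList.Nodup from (dedup_spec _).1)]
  refine (Finset.card_le_card fun d hd => ?_).trans
    (Finset.card_image_le (s := guardSet φ lab) (f := pairCode))
  exact Finset.mem_image.2 ((listsGuards_guardListD hL hK d).1 (List.mem_toFinset.1 hd))

end Guards
end ECNTL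
namespace ECNTL
open RecProps Data Formula

/-! ### The program for the automaton -/

theorem PT.nextD {FL FK FP Fs Ft Fg : Data → Data} (hL : PT FL) (hK : PT FK) (hP : PT FP)
    (hs : PT Fs) (ht : PT Ft) (hg : PT Fg) :
    PT fun x => nextD (FL x) (FK x) (FP x) (Fs x) (Ft x) (Fg x) := by
  have hc : ∀ {F : Data → Data}, PT F → PT fun y => F y.hd := fun hF => PT.comp hF (.hd .id)
  exact PT.map (f := fun x s' => .cons (Fs x) (.cons (Ft x) (.cons (Fg x) s')))
    (PT.filter (c := fun x s' => StepD (FL x) (Fs x) s' ∧ GuardD (FL x) (FK x) (Fs x) (Ft x)) hP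
      (.and (.stepD (hc hL) (hc hs) (.tl .id)) (.guardD (hc hL) (hc hK) (hc hs) (hc ht))))
    (.pair (hc hs) (.pair (hc ht) (.pair (hc hg) (.tl .id))))

theorem PT.optList {F : Data → Data} (hF : PT F) : PT fun x => optList (F x) :=
  .pair .nil (PT.map (f := fun _ e => .cons .nil e) hF (.pair .nil (.tl .id)))

theorem PT.transD {FL FK FP FG : Data → Data} (hL : PT FL) (hK : PT FK) (hP : PT FP) (hG : PT FG) :
    PT fun x => transD (FL x) (FK x) (FP x) (FG x) := by
  have hc : ∀ {F : Data → Data}, PT F → PT fun y => F y.hd := fun hF => PT.comp hF (.hd .id)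
  refine PT.flatMap (f := fun x s => (FG x).flatMap fun θ => (ECNTL.optList (FP x)).flatMap fun g =>
    ECNTL.nextD (FL x) (FK x) (FP x) s θ g) hP ?_
  refine PT.flatMap (f := fun y θ => (ECNTL.optList (FP y.hd)).flatMap fun g =>
    ECNTL.nextD (FL y.hd) (FK y.hd) (FP y.hd) y.tl θ g) (hc hG) ?_
  refine PT.flatMap (f := fun z g =>
    ECNTL.nextD (FL z.hd.hd) (FK z.hd.hd) (FP z.hd.hd) z.hd.tl z.tl g) (.optList (hc (hc hP))) ?_
  exact .nextD (hc (hc (hc hL))) (hc (hc (hc hK))) (hc (hc (hc hP))) (.tl (.hd (.hd .id)))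
    (.tl (.hd .id)) (.tl .id)

theorem PT.letterD {FK Fs : Data → Data} (hK : PT FK) (hs : PT Fs) :
    PT fun x => letterD (FK x) (Fs x) := by
  have h : PT fun x => ECNTL.letterD x.hd x.tl :=
    PT.map (f := fun _ e => e.hd) (PT.filter (c := fun x e => e.tl ∈ x.tl.toList) (.hd .id)
      (.mem (.tl (.tl .id)) (.tl (.hd .id)))) (.hd (.tl .id))
  exact PT.comp (G := fun x => ECNTL.letterD x.hd x.tl) h (.pair hK hs)

theorem PT.descD {FF FL FK FP FG : Data → Data} (hF : PT FF) (hL : PT FL) (hK : PT FK) (hP : PT FP)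
    (hG : PT FG) : PT fun x => descD (FF x) (FL x) (FK x) (FP x) (FG x) := by
  have hT := PT.transD hL hK hP hG
  have hL' : PT fun y => FL y.hd := PT.comp hL (.hd .id)
  have hK' : PT fun y => FK y.hd := PT.comp hK (.hd .id)
  have hP' : PT fun y => FP y.hd := PT.comp hP (.hd .id)
  have hF' : PT fun y => FF y.hd := PT.comp hF (.hd .id)
  have hd : PT fun y : Data => y.tl := .tl .id
  refine .pair hP (.pair hP (.pair ?_ (.pair ?_ (.pair ?_ (.pair ?_ ?_)))))
  · exact PT.filter (c := fun x s => InitD (FF x) (FL x) s) hP (.initD hF' hL' hd)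
  · refine PT.map (f := fun x d => .cons d.hd (.cons (ECNTL.letterD (FK x) d.hd)
      (.cons d.tl.hd (.cons d.tl.tl.tl d.tl.tl.hd.tl)))) ?_
      (.pair (.hd hd) (.pair (.letterD hK' (.hd hd)) (.pair (.hd (.tl hd))
        (.pair (.tl (.tl (.tl hd))) (.tl (.hd (.tl (.tl hd))))))))
    exact PT.filter (c := fun x d => callCode ∈ d.hd.toList ∧ d.tl.tl.hd = .cons .nil d.hd) hT
      (.and (.mem (.const _) (.hd hd)) (.eq (.hd (.tl (.tl hd))) (.pair .nil (.hd hd))))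
  · refine PT.map (f := fun x d => .cons d.hd (.cons (ECNTL.letterD (FK x) d.hd)
      (.cons d.tl.hd (.cons d.tl.tl.hd d.tl.tl.tl)))) ?_
      (.pair (.hd hd) (.pair (.letterD hK' (.hd hd)) (.pair (.hd (.tl hd))
        (.pair (.hd (.tl (.tl hd))) (.tl (.tl (.tl hd)))))))
    exact PT.filter (c := fun x d => retCode ∈ d.hd.toList ∧
      (d.tl.tl.hd = .nil → prevTopCode ∉ d.hd.toList) ∧
      (¬ d.tl.tl.hd = .nil → PopD (FL x) d.tl.tl.hd.tl d.hd)) hT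
      (.and (.mem (.const _) (.hd hd)) (.and
        (.imp (.eq_nil (.hd (.tl (.tl hd)))) (.not (.mem (.const _) (.hd hd))))
        (.imp (.not (.eq_nil (.hd (.tl (.tl hd)))))
          (.popD hL' (.tl (.hd (.tl (.tl hd)))) (.hd hd)))))
  · refine PT.map (f := fun x d => .cons d.hd (.cons (ECNTL.letterD (FK x) d.hd)
      (.cons d.tl.hd d.tl.tl.tl))) ?_
      (.pair (.hd hd) (.pair (.letterD hK' (.hd hd)) (.pair (.hd (.tl hd))
        (.tl (.tl (.tl hd))))))
    exact PT.filter (c := fun x d => intCode ∈ d.hd.toList ∧ d.tl.tl.hd = .nil) hT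
      (.and (.mem (.const _) (.hd hd)) (.eq_nil (.hd (.tl (.tl hd)))))
  · exact PT.map (f := fun x χ => (FP x).filter fun s => AccD χ s) hL
      (PT.filter (c := fun y s => AccD y.tl s) hP' (.accD (.tl (.hd .id)) (.tl .id)))

/-- The description of the automaton is computed in time polynomial in the sizes of the input and
of the power sets of the lists of formulas and of atomic constraints. -/
theorem descD_runs {FF FL FK : Data → Data} (hF : PT FF) (hL : PT FL) (hK : PT FK) :
    ∃ p k, ∀ x, ∃ t, Prog.Runs p x (descD (FF x) (FL x) (FK x) (FL x).pow
      (guardListD (FL x) (FK x)).pow) t ∧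
      t ≤ (2 ^ ((FL x).toList.length + (guardListD (FL x) (FK x)).toList.length) *
        (x.size + 1)) ^ k := by
  obtain ⟨a, ka, ha⟩ := PT.pair hF (PT.pair hL hK)
  obtain ⟨l, kl, hl⟩ := hL
  obtain ⟨g, kg, hg⟩ := PT.guardListD ⟨l, kl, hl⟩ hK
  obtain ⟨w, kw, hw⟩ := pow_runs
  obtain ⟨d, kd, hd⟩ : PT fun y => descD y.hd.hd y.hd.tl.hd y.hd.tl.tl y.tl.hd y.tl.tl :=
    .descD (.hd (.hd .id)) (.hd (.tl (.hd .id))) (.tl (.tl (.hd .id))) (.hd (.tl .id))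
      (.tl (.tl .id))
  refine ⟨.seq (.pair a (.pair (.seq l w) (.seq g w))) d, (ka + kl + kg + (kl + 4) * kw +
    (kg + 4) * kw + 1 + 5) + (ka + kl + kg + (kl + 4) * kw + (kg + 4) * kw + 1 + 5) * kd + 0 + 2,
    fun x => ?_⟩
  obtain ⟨ta, ra, ba⟩ := ha x
  obtain ⟨tl, rl, bl⟩ := hl x
  obtain ⟨tg, rg, bg⟩ := hg x
  obtain ⟨tv, rv, bv⟩ := hw (FL x)
  obtain ⟨tu, ru, bu⟩ := hw (guardListD (FL x) (FK x))
  have hrun := Prog.Runs.pair ra (.pair (.seq rl rv) (.seq rg ru))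
  obtain ⟨td, rd, bd⟩ := hd (.cons (.cons (FF x) (.cons (FL x) (FK x))) (.cons (FL x).pow
    (guardListD (FL x) (FK x)).pow))
  refine ⟨_, .seq hrun rd, ?_⟩
  have hout := hrun.output_le
  beta_reduce at hout
  set B := 2 ^ ((FL x).toList.length + (guardListD (FL x) (FK x)).toList.length) * (x.size + 1)
    with hB
  have hx : x.size + 1 ≤ B := Nat.le_mul_of_pos_left _ (by positivity)
  have hB2 : 2 ≤ B := (two_le_size_add_one x).trans hx
  have h1 : 1 ≤ x.size + 1 := by omega
  have hpow : ∀ (M : Data) (km t : ℕ), M.size ≤ (x.size + 1) ^ km →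
      t ≤ (2 ^ M.toList.length * (M.size + 5)) ^ kw → 2 ^ M.toList.length ≤ B →
      t ≤ B ^ ((km + 4) * kw) := by
    intro M km t h2 h3 h4
    refine h3.trans ?_
    rw [pow_mul]
    refine Nat.pow_le_pow_left ?_ kw
    rw [pow_succ' B (km + 3)]
    refine Nat.mul_le_mul h4 ?_
    have h5 : (x.size + 1) ^ km ≤ B ^ km := Nat.pow_le_pow_left hx km
    have h6 : 2 ^ 3 ≤ B ^ 3 := Nat.pow_le_pow_left hB2 3
    have h7 : 1 ≤ B ^ km := Nat.one_le_pow _ _ (by omega)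
    rw [pow_add]
    nlinarith
  have hBL : 2 ^ (FL x).toList.length ≤ B := by
    rw [hB, pow_add, Nat.mul_assoc]
    exact Nat.le_mul_of_pos_right _ (by positivity)
  have hBG : 2 ^ (guardListD (FL x) (FK x)).toList.length ≤ B := by
    rw [hB, pow_add, Nat.mul_comm (2 ^ _), Nat.mul_assoc]
    exact Nat.le_mul_of_pos_right _ (by positivity)
  have bv' := hpow _ kl tv (rl.output_le.trans bl) bv hBL
  have bu' := hpow _ kg tu (rg.output_le.trans bg) bu hBG
  generalize he : ka + kl + kg + (kl + 4) * kw + (kg + 4) * kw + 1 = e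
  have hmono : ∀ {i}, i ≤ e → B ^ i ≤ B ^ e := fun h => Nat.pow_le_pow_right (by omega) h
  have b1 : ta ≤ B ^ e := (ba.trans (Nat.pow_le_pow_left hx _)).trans (hmono (by omega))
  have b2 : tl ≤ B ^ e := (bl.trans (Nat.pow_le_pow_left hx _)).trans (hmono (by omega))
  have b3 : tg ≤ B ^ e := (bg.trans (Nat.pow_le_pow_left hx _)).trans (hmono (by omega))
  have b4 : tv ≤ B ^ e := bv'.trans (hmono (by omega))
  have b5 : tu ≤ B ^ e := bu'.trans (hmono (by omega))
  have b6 : x.size + 1 ≤ B ^ e := by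
    have := hmono (i := 1) (by omega)
    rw [pow_one] at this
    exact hx.trans this
  have hT : ta + (tl + tv + 1 + (tg + tu + 1) + x.size) + x.size + 1 ≤ B ^ (e + 5) := by
    have h6 : 2 ^ 5 ≤ B ^ 5 := Nat.pow_le_pow_left hB2 5
    rw [pow_add]
    nlinarith
  have hD : td ≤ B ^ ((e + 5) * kd) := by
    rw [pow_mul]
    exact bd.trans (Nat.pow_le_pow_left (by omega) _)
  have := pow_add_three_le hB2 (e + 5) ((e + 5) * kd) 0
  rw [pow_zero] at this
  omega

/-! ### The size of the input -/

theorem size_code_nat_le (k : ℕ) : (Enc.code k : Data).size ≤ 4 * Nat.size k + 1 := by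
  refine (size_listCode_le_of_mem (B := 3) fun e he => ?_).trans ?_
  · obtain ⟨b, -, rfl⟩ := List.mem_map.1 he
    cases b <;> simp [Enc.code, tag]
  · rw [List.length_map, Nat.size_eq_bits_len, Nat.mul_comm]

theorem size_code_interval_le {I : Interval} {κ : ℕ} (h : ∀ k ∈ I.consts, Nat.size k ≤ κ) :
    (Enc.code I : Data).size ≤ 8 * κ + 15 := by
  have hb : ∀ b : Bool, (Enc.code b : Data).size ≤ 3 := by
    intro b; cases b <;> simp [Enc.code, tag]
  obtain ⟨lo, lc, _ | ⟨b, c⟩⟩ := I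
  · have h1 := h lo (by simp [Interval.consts])
    have h2 := size_code_nat_le lo
    have h3 := hb lc
    change (Data.cons (Enc.code lo) (.cons (Enc.code lc) .nil)).size ≤ _
    simp only [size_cons, size_nil]; omega
  · have h1 := h lo (by simp [Interval.consts])
    have h2 := size_code_nat_le lo
    have h3 := hb lc
    have h4 := h b (by simp [Interval.consts])
    have h5 := size_code_nat_le b
    have h6 := hb c
    change (Data.cons (Enc.code lo) (.cons (Enc.code lc) (.cons (Enc.code b) (Enc.code c)))).size ≤
      _
    simp only [size_cons]; omega

theorem size_code_dir_le (d : Dir) : (Enc.code d : Data).size ≤ 5 := by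
  cases d <;> simp [Enc.code, tag]

theorem size_code_fDir_le (d : FDir) : (Enc.code d : Data).size ≤ 5 := size_code_dir_le d.toDir

theorem size_code_fin_le {n : ℕ} (p : Fin (n + 3)) : (Enc.code p : Data).size ≤ 4 * n + 9 := by
  have h1 := size_code_nat_le p.val
  have h2 : Nat.size p.val ≤ n + 2 :=
    Nat.size_le.2 ((show p.val ≤ n + 2 by omega).trans_lt Nat.lt_two_pow_self)
  change (Enc.code p.val : Data).size ≤ _
  omega

theorem sizeOf_le_of_mem_sub {P : Type} [SizeOf P] [DecidableEq P] {χ φ : Formula P}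
    (h : χ ∈ φ.sub) : sizeOf χ ≤ sizeOf φ := by
  induction φ <;> simp only [sub, Finset.mem_insert, Finset.mem_union, Finset.mem_singleton] at h
    <;> grind

/-- The syntax tree of a formula is at most exponential in the number of subformulas: with each of
the at most two immediate subformulas the number of subformulas drops. -/
theorem size_code_formula_le {n κ : ℕ} (φ : Formula (Fin (n + 3)))
    (h : ∀ k ∈ φ.consts, Nat.size k ≤ κ) :
    φ.code.size + (50 + 8 * κ + 4 * n) ≤ (50 + 8 * κ + 4 * n) * 2 ^ φ.len := by
  have leaf : ∀ {a s : ℕ}, s ≤ a → s + a ≤ a * 2 ^ 1 := by intro a s h; omega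
  have unary : ∀ {a s : ℕ} {f ψ : Formula (Fin (n + 3))}, f.sub ⊆ ψ.sub → ψ ∈ ψ.sub →
      sizeOf f < sizeOf ψ → s ≤ f.code.size + a → f.code.size + a ≤ a * 2 ^ f.len →
      s + a ≤ a * 2 ^ ψ.len := by
    intro a s f ψ h1 h2 h3 h4 h5
    have h6 : f.len + 1 ≤ ψ.len := Finset.card_lt_card ⟨h1, fun h =>
      absurd (sizeOf_le_of_mem_sub (h h2)) (by omega)⟩
    have h7 : 2 ^ (f.len + 1) ≤ 2 ^ ψ.len := Nat.pow_le_pow_right (by omega) h6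
    rw [pow_succ] at h7
    nlinarith
  have binary : ∀ {a s : ℕ} {f g ψ : Formula (Fin (n + 3))}, f.sub ⊆ ψ.sub → g.sub ⊆ ψ.sub →
      ψ ∈ ψ.sub → sizeOf f < sizeOf ψ → sizeOf g < sizeOf ψ →
      s ≤ f.code.size + g.code.size + a → f.code.size + a ≤ a * 2 ^ f.len →
      g.code.size + a ≤ a * 2 ^ g.len → s + a ≤ a * 2 ^ ψ.len := by
    intro a s f g ψ h1 h1' h2 h3 h3' h4 h5 h5'
    have h6 : f.len + 1 ≤ ψ.len := Finset.card_lt_card ⟨h1, fun h =>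
      absurd (sizeOf_le_of_mem_sub (h h2)) (by omega)⟩
    have h6' : g.len + 1 ≤ ψ.len := Finset.card_lt_card ⟨h1', fun h =>
      absurd (sizeOf_le_of_mem_sub (h h2)) (by omega)⟩
    have h7 : 2 ^ (f.len + 1) ≤ 2 ^ ψ.len := Nat.pow_le_pow_right (by omega) h6
    have h7' : 2 ^ (g.len + 1) ≤ 2 ^ ψ.len := Nat.pow_le_pow_right (by omega) h6'
    rw [pow_succ] at h7 h7'
    nlinarith
  induction φ with
  | tru => exact leaf (by simp [Formula.code, size_tag]; omega)
  | prop p =>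
    have := size_code_fin_le p
    exact leaf (by simp [Formula.code, size_tag]; omega)
  | or f g ihf ihg =>
    refine binary (by simp [sub]; grind) (by simp [sub]; grind) (by simp [sub]) (by simp +arith)
      (by simp +arith) ?_ (ihf fun k hk => h k ?_) (ihg fun k hk => h k ?_)
    · simp only [Formula.code, size_cons, size_tag]; omega
    · simp [consts, hk]
    · simp [consts, hk]
  | untl d f g ihf ihg =>
    have := size_code_fDir_le d
    refine binary (by simp [sub]; grind) (by simp [sub]; grind) (by simp [sub]) (by simp +arith)
      (by simp +arith) ?_ (ihf fun k hk => h k ?_) (ihg fun k hk => h k ?_)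
    · simp only [Formula.code, size_cons, size_tag]; omega
    · simp [consts, hk]
    · simp [consts, hk]
  | since d f g ihf ihg =>
    have := size_code_dir_le d
    refine binary (by simp [sub]; grind) (by simp [sub]; grind) (by simp [sub]) (by simp +arith)
      (by simp +arith) ?_ (ihf fun k hk => h k ?_) (ihg fun k hk => h k ?_)
    · simp only [Formula.code, size_cons, size_tag]; omega
    · simp [consts, hk]
    · simp [consts, hk]
  | neg f ih =>
    refine unary (by simp [sub]) (by simp [sub]) (by simp) ?_ (ih h)
    simp only [Formula.code, size_cons, size_tag]; omega
  | next d f ih =>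
    have := size_code_fDir_le d
    refine unary (by simp [sub]) (by simp [sub]) (by simp +arith) ?_ (ih h)
    simp only [Formula.code, size_cons, size_tag]; omega
  | prev d f ih =>
    have := size_code_dir_le d
    refine unary (by simp [sub]) (by simp [sub]) (by simp +arith) ?_ (ih h)
    simp only [Formula.code, size_cons, size_tag]; omega
  | nextClock d I f ih =>
    have := size_code_fDir_le d
    have := size_code_interval_le (I := I) (κ := κ) fun k hk => h k (by simp [consts, hk])
    refine unary (by simp [sub]) (by simp [sub]) (by simp +arith) ?_
      (ih fun k hk => h k (by simp [consts, hk]))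
    simp only [Formula.code, size_cons, size_tag]; omega
  | prevClock d I f ih =>
    have := size_code_dir_le d
    have := size_code_interval_le (I := I) (κ := κ) fun k hk => h k (by simp [consts, hk])
    refine unary (by simp [sub]) (by simp [sub]) (by simp +arith) ?_
      (ih fun k hk => h k (by simp [consts, hk]))
    simp only [Formula.code, size_cons, size_tag]; omega

end ECNTL
namespace ECNTL
open RecProps Data Formula

theorem one_le_len {P : Type} [DecidableEq P] (φ : Formula P) : 1 ≤ φ.len :=
  Finset.card_pos.2 ⟨φ, by cases φ <;> simp [sub]⟩

/-- The input of the algorithm is at most exponential in `n + size(φ)`. -/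
theorem size_inputCode_le {n : ℕ} (φ : Formula (Fin (n + 3))) :
    (inputCode n φ).size + 1 ≤ 2 ^ (8 * (n + φ.size)) := by
  obtain ⟨κ, hκ⟩ : ∃ κ, κ = Nat.size (φ.consts.sup id) := ⟨_, rfl⟩
  have h1 := size_code_formula_le φ (κ := κ) fun k hk =>
    hκ ▸ Nat.size_le_size (Finset.le_sup (f := id) hk)
  have h2 : (propList n).size ≤ (n + 3) * (4 * n + 10) + 1 := by
    refine (size_listCode_le_of_mem (B := 4 * n + 9) fun e he => ?_).trans (by simp)
    obtain ⟨p, -, rfl⟩ := List.mem_map.1 he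
    exact size_code_fin_le p
  have h3 : (inputCode n φ).size = (propList n).size + φ.code.size + 1 := rfl
  have hN : n + φ.size = n + φ.len + κ := by rw [Formula.size, hκ, Nat.add_assoc]
  have hl := one_le_len φ
  have h4 : 2 ^ φ.len ≤ 2 ^ (n + φ.size) := Nat.pow_le_pow_right (by omega) (by omega)
  have h5 : n + φ.size < 2 ^ (n + φ.size) := Nat.lt_two_pow_self
  have h6 : 2 ^ (8 * (n + φ.size)) = (2 ^ (n + φ.size)) ^ 6 * (2 ^ (n + φ.size)) ^ 2 := by
    rw [← pow_add, Nat.mul_comm, pow_mul]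
  rw [h3, h6]
  generalize 2 ^ (n + φ.size) = u at *
  have h7 : 2 ^ 6 ≤ u ^ 6 := Nat.pow_le_pow_left (by omega) 6
  have h8 := Nat.mul_le_mul_right (u ^ 2) h7
  have h9 : (n + 3) * (4 * n + 10) ≤ (2 * u) * (7 * u) := Nat.mul_le_mul (by omega) (by omega)
  have h10 : (50 + 8 * κ + 4 * n) * 2 ^ φ.len ≤ (50 + 12 * u) * u :=
    Nat.mul_le_mul (by omega) h4
  nlinarith

/-! ### The construction -/

/-- The construction, for any labelling of the letters that can be computed from the input. -/
theorem exists_automaton {FK : Data → Data} (hK : PT FK) : ∃ (p : Prog) (C : ℕ),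
    ∀ (n : ℕ) (φ : Formula (Fin (n + 3))) (P' : Type) [RecProps P'] [Fintype P'] [DecidableEq P']
      [Enc P'] (lab : P' → Formula (Option (Fin (n + 3)))), IsLabelling lab →
      (∀ p, lab p ∈ closure φ) → Function.Injective (Enc.code : P' → Data) →
      ListsLabels lab (FK (inputCode n φ)) →
      ∃ (x : Data) (t : ℕ) (A : ECNA P' Data Data),
        p.Runs (inputCode n φ) x t ∧ t ≤ 2 ^ (C * (n + φ.size)) ∧ A.IsCode x ∧
        A.states.card ≤ 2 ^ (C * (n + φ.len)) ∧
        A.stackSyms.card ≤ 2 ^ (C * (n + φ.len)) ∧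
        A.consts ⊆ insert 0 (φ.consts : Set ℕ) ∧
        A.clocks.Finite ∧ A.clocks.ncard ≤ C * φ.len ∧
        ∀ w : TimedWord P', A.Accepts w ↔
          ∃ α, GenHintikka φ lab w α ∧ GenFair φ α ∧ φ.map some ∈ α 0 := by
  have hF : PT fun x => renameD x.tl := .renameD (.tl .id)
  have hL : PT fun x => closureD x.hd (renameD x.tl) := .closureD (.hd .id) hF
  obtain ⟨p, k, hp⟩ := descD_runs hF hL hK
  -- The closure has at most `18 (n + |φ|)` members, with four atomic constraints for each of them,
  -- and the input has size below `2 ^ (8 (n + size(φ)))`; here `98 = 18 + 4 * 18 + 8`.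
  refine ⟨p, 98 * k + 18, fun n φ P' _ _ _ _ lab hl hlab hE hKl => ?_⟩
  obtain ⟨t, hrun, ht⟩ := hp (inputCode n φ)
  have hin : renameD (inputCode n φ).tl = (φ.map some).code := renameD_code φ
  have hhd : (inputCode n φ).hd = propList n := rfl
  simp only [hin, hhd] at hrun ht
  have hLφ := listsClosure_closureD φ
  have hG := listsGuards_guardListD hLφ hKl
  have hl1 := one_le_len φ
  have hlenL : (closureD (propList n) (φ.map some).code).toList.length ≤ 18 * (n + φ.len) :=
    ((length_closureD_le φ).trans (card_closure_le φ)).trans (by omega)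
  have hlenG : (guardListD (closureD (propList n) (φ.map some).code)
      (FK (inputCode n φ))).toList.length ≤ 72 * (n + φ.len) := by
    have h1 := length_guardListD_le hLφ hKl
    have h2 := card_guardSet_le (φ := φ) hl.injective
    have h3 := card_closure_le φ
    omega
  have hstates : 2 ^ (closureD (propList n) (φ.map some).code).toList.length ≤
      2 ^ ((98 * k + 18) * (n + φ.len)) := by
    refine Nat.pow_le_pow_right (by omega) (hlenL.trans (Nat.mul_le_mul_right _ (by omega)))
  obtain ⟨hfin, hcard⟩ := clocks_automaton (K := FK (inputCode n φ)) (G := guardListD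
    (closureD (propList n) (φ.map some).code) (FK (inputCode n φ))) hl hLφ
  refine ⟨_, t, automaton φ lab hl _ _ hLφ, hrun, ht.trans ?_, isCode_automaton hl hLφ hKl hG hlab,
    (card_toFinset_pow_le _).trans hstates, (card_toFinset_pow_le _).trans hstates,
    consts_automaton hl hLφ, hfin, hcard.trans (Nat.le_mul_of_pos_left _ (by omega)),
    accepts_automaton_iff hl hLφ hE hKl hG⟩
  have hsize : φ.len ≤ φ.size := Nat.le_add_right _ _
  have h1 := Nat.mul_le_mul (Nat.pow_le_pow_right (n := 2) (by omega) (show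
    (closureD (propList n) (φ.map some).code).toList.length + (guardListD
      (closureD (propList n) (φ.map some).code) (FK (inputCode n φ))).toList.length ≤
      90 * (n + φ.size) by omega)) (size_inputCode_le φ)
  rw [← pow_add] at h1
  refine (Nat.pow_le_pow_left h1 k).trans ?_
  rw [← pow_mul]
  refine Nat.pow_le_pow_right (by omega) ?_
  nlinarith [Nat.zero_le (18 * (n + φ.size))]

end ECNTL

theorem mainTheorem4 :
    (∃ (p : Prog) (C : ℕ), ∀ (n : ℕ) (φ : ECNTL.Formula (Fin (n + 3))),
      ∃ (x : Data) (t : ℕ) (A : ECNA (ClProp φ) Data Data),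
        p.Runs (inputCode n φ) x t ∧ t ≤ 2 ^ (C * (n + φ.size)) ∧ A.IsCode x ∧
        A.states.card ≤ 2 ^ (C * (n + φ.len)) ∧
        A.stackSyms.card ≤ 2 ^ (C * (n + φ.len)) ∧
        A.consts ⊆ insert 0 (φ.consts : Set ℕ) ∧
        A.clocks.Finite ∧ A.clocks.ncard ≤ C * φ.len ∧
        ∀ w : TimedWord (ClProp φ), A.Accepts w ↔ IsInitFairHintikka φ w) ∧
    (∃ (p : Prog) (C : ℕ), ∀ (n : ℕ) (φ : ECNTL.Formula (Fin (n + 3))), φ.NonRecursive →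
      ∃ (x : Data) (t : ℕ) (A : ECNA (Fin (n + 3)) Data Data),
        p.Runs (inputCode n φ) x t ∧ t ≤ 2 ^ (C * (n + φ.size)) ∧ A.IsCode x ∧
        A.states.card ≤ 2 ^ (C * (n + φ.len)) ∧
        A.stackSyms.card ≤ 2 ^ (C * (n + φ.len)) ∧
        A.consts ⊆ insert 0 (φ.consts : Set ℕ) ∧
        A.clocks.Finite ∧ A.clocks.ncard ≤ C * φ.len ∧
        ∀ w : TimedWord (Fin (n + 3)), A.Accepts w ↔ φ.IsModel w) := by
  constructor
  -- Over the alphabet of the closure, every formula is its own label.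
  · obtain ⟨p, C, h⟩ := exists_automaton
      (FK := fun x => (closureD x.hd (renameD x.tl)).map fun e => .cons e e)
      (PT.map (f := fun _ e => .cons e e) (.closureD (.hd .id) (.renameD (.tl .id)))
        (.pair (.tl .id) (.tl .id)))
    refine ⟨p, C, fun n φ => ?_⟩
    obtain ⟨x, t, A, h1, h2, h3, h4, h5, h6, h7, h8, h9⟩ := h n φ (ClProp φ) Subtype.val
      isLabelling_val Subtype.property
      (fun a b hab => Subtype.ext (code_injective hab)) fun d => by
        rw [Data.toList_map, List.mem_map]
        constructor
        · rintro ⟨e, he, rfl⟩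
          rw [show renameD (inputCode n φ).tl = (φ.map some).code from renameD_code φ] at he
          obtain ⟨ψ, hψ, rfl⟩ := (listsClosure_closureD φ e).1 he
          exact ⟨⟨ψ, hψ⟩, rfl⟩
        · rintro ⟨ψ, rfl⟩
          refine ⟨ψ.1.code, ?_, rfl⟩
          rw [show renameD (inputCode n φ).tl = (φ.map some).code from renameD_code φ]
          exact (listsClosure_closureD φ _).2 ⟨ψ.1, ψ.2, rfl⟩
    exact ⟨x, t, A, h1, h2, h3, h4, h5, h6, h7, h8, fun w =>
      (h9 w).trans (exists_genHintikka_val_iff w)⟩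
  -- Over the alphabet `Prop`, the label of `p` is the formula `p`, with code `cons (tag 1) (cons
  -- nil c)` if `c` is the code of `p`.
  · obtain ⟨p, C, h⟩ := exists_automaton
      (FK := fun x => x.hd.map fun c => .cons c (.cons (tag 1) (.cons .nil c)))
      (PT.map (f := fun _ c => .cons c (.cons (tag 1) (.cons .nil c))) (.hd .id)
        (.pair (.tl .id) (.pair (.const _) (.pair .nil (.tl .id)))))
    refine ⟨p, C, fun n φ hφ => ?_⟩
    obtain ⟨x, t, A, h1, h2, h3, h4, h5, h6, h7, h8, h9⟩ := h n φ (Fin (n + 3))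
      (fun p => Formula.prop (some p)) isLabelling_prop (fun p => prop_mem_closure φ _)
      code_fin_injective fun d => by
        rw [Data.toList_map, List.mem_map]
        constructor
        · rintro ⟨e, he, rfl⟩
          obtain ⟨p, rfl⟩ := mem_propList.1 he
          exact ⟨p, rfl⟩
        · rintro ⟨p, rfl⟩
          exact ⟨Enc.code p, mem_propList.2 ⟨p, rfl⟩, rfl⟩
    exact ⟨x, t, A, h1, h2, h3, h4, h5, h6, h7, h8, fun w =>
      (h9 w).trans (exists_genHintikka_iff hφ w)⟩
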